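/- Let $k>\tfrac12$ and $d>0$ be real numbers. **The slit torus $\mathcal T_k(d)$.** Slit the extended $\zeta$-plane along $[-1,1]$ and glue, by translations, the upper edge of $[-1,0]$ to the lower edge of $[0,1]$ and the upper edge of $[0,1]$ to the lower edge of $[-1,0]$. Cut the result along the vertical ray from $\zeta=di$ to $\infty$ and sew in a flat cone of angle $2\pi(k-1)$, symmetrically with respect to the imaginary axis, so that the total angle at $di$ becomes $2\pi k$ (for $k<1$, remove a sector of angle $2\pi(1-k)$ about the ray and glue its two sides; for $k=1$, do nothing). The result is a torus $\mathcal T_k(d)$ with a complex structure (given by the flat coordinate $\zeta$ off the cone points, and extended over them). Let $e_1$, $e_2$, $v_2$ be its points $\zeta=\infty$, $\zeta=di$, $\zeta=0$. Its imaginary axis is the fixed point set of the reflection induced by $\zeta\mapsto-\bar\zeta$; it consists of $\{\zeta = i\eta:\eta\le d\}$, the middle line of the sewn-in cone (which joins $e_2$ to $e_1$; for $k\le1$ it is the image of the ray, respectively of the sides of the removed sector), and $e_1$. **The rhombic model.** Let $\tau\in\mathbb C\setminus\mathbb R$, $|\tau|=1$, let $\mathcal O=\frac{1+\tau}2$ be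 the centre of the rhombus with vertices $0,1,1+\tau,\tau$, and call the diagonal $\{\mathcal O+t\frac{1-\tau}2:-1\le t\le1\}$ horizontal, with $1$ as its right end. Let $\varphi:\mathbb C/(\mathbb Z+\tau\mathbb Z)\to\mathcal T_k(d)$ be a conformal diffeomorphism such that 1. the image of the horizontal diagonal is the imaginary axis; 2. $E_1=\varphi^{-1}(e_1)$ and $E_2=\varphi^{-1}(e_2)$ are symmetric with respect to the other diagonal, and $E_1$ lies to the left of $\mathcal O$; 3. the part of the horizontal diagonal from $E_2$ to $E_1$ that passes through the vertex of the rhombus (the point $1\equiv\tau$) is mapped to the middle line of the sewn-in cone. Let $V_2=\varphi^{-1}(v_2)$, and let $V_1$ be its image under the rotation by $180^\circ$ about $\mathcal O$. (So $E_1,E_2,V_2$ are the pole and the zeros of the multivalued form $g\,dh=\varphi^*(d\zeta)$, and $E_2,E_1,V_1$ those of $\frac1g\,dh=-r^*(g\,dh)$, where $r$ is this rotation.) **Proposition.** There are real numbers $0<a<b<1$ such that, modulo the lattice $\mathbb Z+\tau\mathbb Z$, $$E_1=\mathcal O-b\,\tfrac{1-\tau}2,\quad E_2=\mathcal O+b\,\tfrac{1-\tau}2,\quad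 V_1=\mathcal O-a\,\tfrac{1-\tau}2,\quad V_2=\mathcal O+a\,\tfrac{1-\tau}2,$$ and $$a+kb=k.$$ -/

import Mathlib

noncomputable section

open Complex Topology

namespace Helicoid

/-! ### The slit model

Notation: `ζ` is the coordinate of the slit plane, `z` is the conformal coordinate on the cone
that is centred at `ζ = d i`.

Sewing the flat cone `S_{k-1}` into the `ζ`-plane along the ray from `d i` to `∞` (for `k < 1`:
removing an `S_{1-k}`) gives a flat cone with vertex `d i` and total angle `2 π k`. In polar
coordinates `(r, θ)` at the vertex, with `|θ| ≤ π k` measured from the downward vertical and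
`θ = ± π k` identified, the sector `|θ| < π` (for `k ≥ 1`) is the `ζ`-plane minus the ray and
`π ≤ |θ| ≤ π k` is the sewn-in cone, half of it on each side of the ray. Its conformal coordinate
is `z ∈ ℂ ∪ {∞}` with `r = |z| ^ k`, `θ = k arg z`; the flat coordinate is `ζ = d i - i z ^ k`. -/

/-- The flat coordinate `ζ = d i - i z ^ k` (branch cut along `θ = ± π k`, that is, `z < 0`). -/
def dev (k d : ℝ) (z : ℂ) : ℂ := d * I - I * z ^ (k : ℂ)

/-- The conformal coordinate `z` of the point `ζ` of the slit plane, for `Im ζ < d`. -/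
def coneCoord (k d : ℝ) (ζ : ℂ) : ℂ := (d + I * ζ) ^ (k : ℂ)⁻¹

theorem dev_coneCoord {k d : ℝ} (hk : 1 / 2 < k) {ζ : ℂ} (hζ : ζ.im < d) :
    dev k d (coneCoord k d ζ) = ζ := by
  have hk0 : (0 : ℝ) < k := by linarith
  have hre : 0 < ((d : ℂ) + I * ζ).re := by simp; linarith
  have harg := Complex.abs_arg_lt_pi_div_two_iff.2 (Or.inl hre)
  have him : (Complex.log ((d : ℂ) + I * ζ) * (k : ℂ)⁻¹).im
      = Complex.arg ((d : ℂ) + I * ζ) * k⁻¹ := by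
    rw [← Complex.ofReal_inv, Complex.im_mul_ofReal, Complex.log_im]
  have hinv : k⁻¹ < 2 := by
    rw [inv_lt_comm₀ hk0 (by norm_num)]; linarith
  have hinv0 : 0 < k⁻¹ := inv_pos.2 hk0
  have habs : |Complex.arg ((d : ℂ) + I * ζ) * k⁻¹| < Real.pi := by
    rw [abs_mul, abs_of_pos hinv0]
    nlinarith [Real.pi_pos, abs_nonneg (Complex.arg ((d : ℂ) + I * ζ))]
  have hpow : (coneCoord k d ζ) ^ (k : ℂ) = d + I * ζ := by
    unfold coneCoord
    rw [← Complex.cpow_mul _ (by rw [him]; exact (abs_lt.1 habs).1)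
      (by rw [him]; exact (abs_lt.1 habs).2.le),
      inv_mul_cancel₀ (by exact_mod_cast hk0.ne'), Complex.cpow_one]
  unfold dev
  rw [hpow]
  linear_combination (-ζ) * Complex.I_mul_I

/-- The open lower half-plane `Im ζ < 0` of the slit plane, as a region of the cone. -/
def lowerSheet (k d : ℝ) : Set ℂ := {z | k * |arg z| < Real.pi / 2 ∧ (dev k d z).im < 0}

/-- The cone (with its point at infinity) minus the open lower half-plane: the closed upper
half-plane with the cone sewn in, in the coordinate `z`. -/
def UpperPiece (k d : ℝ) : Set (OnePoint ℂ) := {p | ∀ z : ℂ, p = z → z ∉ lowerSheet k d}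

/-- The closed lower half-plane with its point at infinity, in the coordinate `ζ`. -/
def LowerPiece : Set (OnePoint ℂ) := {p | ∀ ζ : ℂ, p = ζ → ζ.im ≤ 0}

theorem infty_mem_upperPiece (k d : ℝ) : (OnePoint.infty : OnePoint ℂ) ∈ UpperPiece k d :=
  fun z hz => absurd hz (OnePoint.infty_ne_coe z)

theorem infty_mem_lowerPiece : (OnePoint.infty : OnePoint ℂ) ∈ LowerPiece :=
  fun z hz => absurd hz (OnePoint.infty_ne_coe z)

theorem mem_upperPiece {k d : ℝ} {z : ℂ} (h : z ∉ lowerSheet k d) :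
    (z : OnePoint ℂ) ∈ UpperPiece k d := by
  intro w hw
  rwa [← OnePoint.coe_injective hw]

theorem mem_lowerPiece {ζ : ℂ} (h : ζ.im ≤ 0) : (ζ : OnePoint ℂ) ∈ LowerPiece := by
  intro w hw
  rwa [← OnePoint.coe_injective hw]

theorem coneCoord_mem_upperPiece {k d : ℝ} (hk : 1 / 2 < k) {ζ : ℂ} (h0 : 0 ≤ ζ.im)
    (hd : ζ.im < d) : (coneCoord k d ζ : OnePoint ℂ) ∈ UpperPiece k d := by
  refine mem_upperPiece fun h => ?_
  have h2 := h.2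
  rw [dev_coneCoord hk hd] at h2
  exact absurd h2 (not_lt.2 h0)

theorem zero_mem_upperPiece {k d : ℝ} (hk : 1 / 2 < k) (hd : 0 < d) :
    ((0 : ℂ) : OnePoint ℂ) ∈ UpperPiece k d := by
  refine mem_upperPiece fun h => ?_
  have h2 := h.2
  have hk' : (k : ℂ) ≠ 0 := by
    have : k ≠ 0 := by linarith
    exact_mod_cast this
  simp [dev, Complex.zero_cpow hk'] at h2
  linarith

/-- How the real line seen from above (point `x`) is glued to the real line seen from below
(point `y`): identically outside the slit `[-1, 1]`; the upper edge of `[-1, 0]` is glued to the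
lower edge of `[0, 1]`, and the upper edge of `[0, 1]` to the lower edge of `[-1, 0]`, by
translations. -/
def SlitMatch (x y : ℝ) : Prop :=
  (1 ≤ |x| ∧ y = x) ∨ (-1 ≤ x ∧ x ≤ 0 ∧ y = x + 1) ∨ (0 ≤ x ∧ x ≤ 1 ∧ y = x - 1)

/-- The gluing of the two closed pieces along their boundaries `ℝ ∪ {∞}`. -/
inductive Glue (k d : ℝ) : UpperPiece k d ⊕ LowerPiece → UpperPiece k d ⊕ LowerPiece → Prop
  | infty : Glue k d (Sum.inl ⟨OnePoint.infty, infty_mem_upperPiece k d⟩)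
      (Sum.inr ⟨OnePoint.infty, infty_mem_lowerPiece⟩)
  | real (x y : ℝ) (hxy : SlitMatch x y)
      (hx : (coneCoord k d x : OnePoint ℂ) ∈ UpperPiece k d)
      (hy : ((y : ℂ) : OnePoint ℂ) ∈ LowerPiece) :
      Glue k d (Sum.inl ⟨_, hx⟩) (Sum.inr ⟨_, hy⟩)

/-- The torus `T_k(d)` as an identification space (with the quotient topology). -/
def SlitTorus (k d : ℝ) : Type := Quot (Glue k d)

instance (k d : ℝ) : TopologicalSpace (SlitTorus k d) :=
  inferInstanceAs (TopologicalSpace (Quot (Glue k d)))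

/-- The point of the torus given by a point of the upper piece. -/
def upper {k d : ℝ} (p : OnePoint ℂ) (h : p ∈ UpperPiece k d) : SlitTorus k d :=
  Quot.mk _ (Sum.inl ⟨p, h⟩)

/-- The point of the torus given by a point of the lower piece. -/
def lower (k d : ℝ) (p : OnePoint ℂ) (h : p ∈ LowerPiece) : SlitTorus k d :=
  Quot.mk _ (Sum.inr ⟨p, h⟩)

/-- The cone point `e₁`, at `ζ = ∞`. -/
def e₁ (k d : ℝ) : SlitTorus k d := upper OnePoint.infty (infty_mem_upperPiece k d)

/-- The cone point `e₂`, at `ζ = d i`. -/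
def e₂ {k d : ℝ} (hk : 1 / 2 < k) (hd : 0 < d) : SlitTorus k d :=
  upper ((0 : ℂ) : OnePoint ℂ) (zero_mem_upperPiece hk hd)

/-- The cone point `v₂`, at `ζ = 0` (the common image of `-1`, `0` and `1` on either edge). -/
def v₂ {k d : ℝ} (hk : 1 / 2 < k) (hd : 0 < d) : SlitTorus k d :=
  upper (coneCoord k d 0 : OnePoint ℂ) (coneCoord_mem_upperPiece hk (by simp) (by simpa using hd))

/-- The fixed point set of the reflection `ζ ↦ - conj ζ`, `z ↦ conj z`: the imaginary axis. -/
def imaginaryAxis (k d : ℝ) : Set (SlitTorus k d) :=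
  {e₁ k d} ∪ {p | ∃ (x : ℝ) (h : ((x : ℂ) : OnePoint ℂ) ∈ UpperPiece k d), p = upper _ h} ∪
    {p | ∃ (η : ℝ) (h : ((η * I : ℂ) : OnePoint ℂ) ∈ LowerPiece), p = lower k d _ h}

/-- The part of the imaginary axis from `e₂` to `e₁` in the sewn-in cone (its middle line). -/
def cutRay (k d : ℝ) : Set (SlitTorus k d) :=
  {e₁ k d} ∪
    {p | ∃ (x : ℝ) (h : ((x : ℂ) : OnePoint ℂ) ∈ UpperPiece k d), x ≤ 0 ∧ p = upper _ h}

/-! ### Local coordinates on the slit model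

The inverses of three holomorphic coordinates that together cover `T_k(d)` minus `e₁` and `v₂`. -/

/-- The slit `[-1, 1]` in the coordinate `z`. -/
def slitArc (k d : ℝ) : Set ℂ := {z | ∃ x : ℝ, |x| ≤ 1 ∧ z = coneCoord k d x}

open Classical in
/-- The coordinate `z` off the slit. -/
def coneChart (k d : ℝ) (z : ℂ) : SlitTorus k d :=
  if h : z ∈ lowerSheet k d then lower k d _ (mem_lowerPiece (ζ := dev k d z) h.2.le)
  else upper _ (mem_upperPiece h)

/-- A flat coordinate near an edge of the slit: it is `ζ` above the edge and `ζ - c` below it,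
where the translation by `c` glues the upper edge to the lower one. -/
def edgeChart {k d : ℝ} (hk : 1 / 2 < k) (c : ℝ) (ξ : ℂ) (hξ : ξ.im < d) : SlitTorus k d :=
  if h : 0 ≤ ξ.im then upper _ (coneCoord_mem_upperPiece hk h hξ)
  else lower k d _ (mem_lowerPiece (ζ := ξ + c) (by simpa using (not_le.1 h).le))

/-! ### The rhombic model -/

/-- The lattice spanned by `1` and `τ`. -/
abbrev lattice (τ : ℂ) : AddSubgroup ℂ := AddSubgroup.closure {1, τ}

/-- The torus `ℂ / ⟨1, τ⟩`. -/
abbrev Torus (τ : ℂ) : Type := ℂ ⧸ lattice τ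

/-- The point `O + t (1 - τ) / 2`, `O = (1 + τ) / 2`; for `-1 ≤ t ≤ 1` these are the points of the
horizontal diagonal (from `τ` to `1`) of the rhombus with vertices `0, 1, 1 + τ, τ`. -/
def diag (τ : ℂ) (t : ℝ) : Torus τ := ((((1 + τ) / 2 + t * ((1 - τ) / 2) : ℂ)) : Torus τ)

/-- The involution `r`: rotation by `180°` about `O`, i.e. `w ↦ 2 O - w`. -/
def rot (τ : ℂ) (p : Torus τ) : Torus τ := ((1 + τ : ℂ) : Torus τ) - p

/-- A map from a subset `s` of `ℂ` to the torus is holomorphic if near each point of `s` it lifts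
to a holomorphic function. -/
def IsHolomorphicOn {τ : ℂ} (s : Set ℂ) (f : ∀ ξ ∈ s, Torus τ) : Prop :=
  ∀ ξ₀ ∈ s, ∃ g : ℂ → ℂ, AnalyticAt ℂ g ξ₀ ∧ ∀ᶠ ξ in 𝓝 ξ₀, ∀ h : ξ ∈ s, f ξ h = (g ξ : Torus τ)

/-- A conformal diffeomorphism from `ℂ / ⟨1, τ⟩` to `T_k(d)`: a homeomorphism whose inverse is
holomorphic in the local coordinates. The complex structure of `T_k(d)` at the cone points `e₁` and
`v₂` is by definition the extension of the one off these points, and a homeomorphism that is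
conformal off these points is conformal. -/
structure IsConformal {k d : ℝ} (hk : 1 / 2 < k) {τ : ℂ} (φ : Torus τ ≃ₜ SlitTorus k d) :
    Prop where
  cone : IsHolomorphicOn (slitArc k d)ᶜ fun z _ => φ.symm (coneChart k d z)
  left_edge : IsHolomorphicOn {ξ | -1 < ξ.re ∧ ξ.re < 0 ∧ ξ.im < d} fun ξ h =>
    φ.symm (edgeChart hk 1 ξ h.2.2)
  right_edge : IsHolomorphicOn {ξ | 0 < ξ.re ∧ ξ.re < 1 ∧ ξ.im < d} fun ξ h =>
    φ.symm (edgeChart hk (-1) ξ h.2.2)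

/-- The normalized conformal diffeomorphisms from a rhombic torus to the slit model. -/
structure IsRhombicModel {k d : ℝ} (hk : 1 / 2 < k) (hd : 0 < d) {τ : ℂ}
    (φ : Torus τ ≃ₜ SlitTorus k d) : Prop where
  /-- the rhombus has unit sides and is not degenerate -/
  norm_eq : ‖τ‖ = 1
  im_ne : τ.im ≠ 0
  conformal : IsConformal hk φ
  /-- the imaginary axis is the image of the horizontal diagonal -/
  image_diag : φ '' (diag τ '' Set.Icc (-1) 1) = imaginaryAxis k d
  /-- the preimages `E₁`, `E₂` of `e₁`, `e₂` are symmetric with respect to the vertical diagonal,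
  `E₁` is to the left of the centre, and the segment of the diagonal from `E₂` to `E₁` through the
  vertex is mapped to the middle line of the sewn-in cone -/
  ends : ∃ t : ℝ, 0 < t ∧ t < 1 ∧ φ.symm (e₁ k d) = diag τ (-t) ∧ φ.symm (e₂ hk hd) = diag τ t ∧
    φ '' (diag τ '' Set.Icc t (2 - t)) = cutRay k d

end Helicoid

end

open Complex Topology Set Filter

namespace Helicoid

/-! Write `w = (1 + τ)/2 + s (1 - τ)/2`. Since `|τ| = 1`, the diagonals of the rhombus are
perpendicular, so in the coordinate `s` the lattice is generated by `1 + T i` and `-1 + T i` for a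
real `T > 0`, and the horizontal diagonal is the real axis. The torus is the strip `0 < Im s < T`
modulo `2`, with its two edges glued by `1 + T i`. Let `-b`, `b`, `a` be the real positions of `e₁`,
`e₂`, `v₂`.

Put `F = dζ/ds`. The gluings of the slit are translations and the cone only rotates `dζ`, so `F` is
single valued on the open strip and `h = F'/F` is meromorphic on the whole torus. Its poles are
simple: residue `-(k+1)` at `-b`, `k-1` at `b`, and the order of the zero of `dζ` at `a`, which must
be `2` because the residues add up to `0`.

Integrating `h` expresses `log F` on the strip as a regular function plus the sum of `ρ_i log (1 -
exp (π i (s - p_i)))`. Between `-b` and `a` the function `h` is real, so the imaginary part of the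
regular function is constant on the real axis. The logarithmic terms have mean zero over a period,
and this removes any additive constant when the two edges of the strip are compared. So the change
of `arg F` from a point `x₀` of `(-b, a)` on the lower edge to a point over `x₁` in `(a, b)` on the
upper edge is explicit: up to sign it is `2π (a + k b - k)` (`HasStripPoles.exists_log`).

On the other hand take the arc that is straight in `ζ`, from the imaginary axis at height `-d/2`
through the slit to height `d/2`. Along it `F γ'` is constant, and at both ends `F` is a positive
multiple of `i`, so the tangents of `γ` at its ends are parallel and point the same way. This gives
only that `a + k b - k` is an integer. But `γ` is simple, starts on the lower edge and ends on the
upper one, so by Hopf's argument its tangent turns by at most `π` (`abs_turning_le`). The turning is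
therefore `0`, and `a + k b = k` (`HasStripPoles.relation_of_arc`, `relation_of_hasEnds`). -/

/-! ### Local complex analysis, primitives and logarithms -/

/-- A holomorphic function that is injective near a point has nonzero derivative there. -/
theorem deriv_ne_zero_of_injOn_nhds {f : ℂ → ℂ} {z₀ : ℂ} (hf : AnalyticAt ℂ f z₀) {U : Set ℂ}
    (hU : U ∈ 𝓝 z₀) (hinj : InjOn f U) : deriv f z₀ ≠ 0 := by
  intro hd
  have hfs : AnalyticAt ℂ (fun z => f z - f z₀) z₀ := hf.sub analyticAt_const
  have hnz : ¬ ∀ᶠ z in 𝓝 z₀, f z - f z₀ = 0 := by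
    intro h
    have h1 : ∀ᶠ z in 𝓝[≠] z₀, f z - f z₀ = 0 ∧ z ∈ U ∧ z ≠ z₀ :=
      (h.filter_mono nhdsWithin_le_nhds).and
        (Filter.Eventually.and (mem_nhdsWithin_of_mem_nhds hU) self_mem_nhdsWithin)
    obtain ⟨z, h2, h3, h4⟩ := h1.exists
    exact h4 (hinj h3 (mem_of_mem_nhds hU) (sub_eq_zero.1 h2))
  obtain ⟨n, g, hg, hg0, hfg⟩ := hfs.exists_eventuallyEq_pow_smul_nonzero_iff.2 hnz
  have hn0 : n ≠ 0 := by
    rintro rfl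
    have := hfg.self_of_nhds
    simp at this
    exact hg0 this.symm
  have hn1 : n ≠ 1 := by
    rintro rfl
    have h1 : HasDerivAt (fun z => (z - z₀) ^ 1 • g z) (g z₀) z₀ := by
      have := ((hasDerivAt_id z₀).sub_const z₀).mul hg.differentiableAt.hasDerivAt
      simpa [Pi.mul_def] using this
    have h2 : HasDerivAt (fun z => f z - f z₀) (g z₀) z₀ := h1.congr_of_eventuallyEq hfg
    have h3 := hf.differentiableAt.hasDerivAt.sub_const (f z₀)
    exact hg0 ((h2.unique h3).trans hd)
  -- an `n`-th root of `f - f z₀`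
  set c : ℂ := g z₀ ^ ((n : ℂ)⁻¹) with hc
  have hcn : c ^ n = g z₀ := Complex.cpow_nat_inv_pow _ hn0
  have hc0 : c ≠ 0 := by
    intro h; rw [h, zero_pow hn0] at hcn; exact hg0 hcn.symm
  set ρ : ℂ → ℂ := fun z => c * (g z / g z₀) ^ ((n : ℂ)⁻¹) with hρ
  have hρa : AnalyticAt ℂ ρ z₀ := by
    refine analyticAt_const.mul ((hg.div analyticAt_const hg0).cpow analyticAt_const ?_)
    simp [div_self hg0]
  have hρn : ∀ z, ρ z ^ n = g z := fun z => by
    simp only [hρ, mul_pow, Complex.cpow_nat_inv_pow _ hn0, hcn]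
    field_simp
  have hρ0 : ρ z₀ = c := by simp [hρ, div_self hg0]
  set ψ : ℂ → ℂ := fun z => (z - z₀) * ρ z with hψ
  have hψa : AnalyticAt ℂ ψ z₀ := (analyticAt_id.sub analyticAt_const).mul hρa
  have hψd : deriv ψ z₀ ≠ 0 := by
    have : HasDerivAt ψ c z₀ := by
      have := ((hasDerivAt_id z₀).sub_const z₀).mul hρa.differentiableAt.hasDerivAt
      simpa [Pi.mul_def, hρ0] using this
    rw [this.deriv]; exact hc0
  have hψ0 : ψ z₀ = 0 := by simp [hψ]
  have hmap : map ψ (𝓝 z₀) = 𝓝 0 := by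
    have := hψa.hasStrictDerivAt.map_nhds_eq hψd
    rwa [hψ0] at this
  have hV : U ∩ {z | f z - f z₀ = (z - z₀) ^ n • g z} ∈ 𝓝 z₀ := inter_mem hU hfg
  have hW : ψ '' (U ∩ {z | f z - f z₀ = (z - z₀) ^ n • g z}) ∈ 𝓝 (0 : ℂ) := by
    rw [← hmap]; exact image_mem_map hV
  -- `ψ` is a local homeomorphism at `z₀` and `f = f z₀ + ψ ^ n` near `z₀`. So points with
  -- `ψ`-values `y` and `ω y` have the same image under `f`, against injectivity as `n ≥ 2`.
  set ω : ℂ := Complex.exp (2 * Real.pi * I / n) with hω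
  have hωp : IsPrimitiveRoot ω n := Complex.isPrimitiveRoot_exp n hn0
  have hω1 : ω ≠ 1 := hωp.ne_one (by omega)
  have hW2 : ∀ᶠ y in 𝓝[≠] (0 : ℂ), y ∈ ψ '' (U ∩ {z | f z - f z₀ = (z - z₀) ^ n • g z}) ∧
      ω * y ∈ ψ '' (U ∩ {z | f z - f z₀ = (z - z₀) ^ n • g z}) ∧ y ≠ 0 := by
    have hcont : Tendsto (fun y => ω * y) (𝓝 (0 : ℂ)) (𝓝 0) := by
      have : Continuous fun y : ℂ => ω * y := by fun_prop
      simpa using this.tendsto 0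
    exact Filter.Eventually.and (mem_nhdsWithin_of_mem_nhds hW)
      (Filter.Eventually.and (mem_nhdsWithin_of_mem_nhds (hcont hW)) self_mem_nhdsWithin)
  obtain ⟨y, ⟨z₁, ⟨hz₁U, hz₁⟩, hy₁⟩, ⟨z₂, ⟨hz₂U, hz₂⟩, hy₂⟩, hy0⟩ := hW2.exists
  have hfψ : ∀ z, f z - f z₀ = (z - z₀) ^ n • g z → f z = f z₀ + ψ z ^ n := fun z hz => by
    rw [hψ]; simp only [mul_pow, hρn]; rw [← sub_eq_iff_eq_add', hz, smul_eq_mul]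
  have : f z₁ = f z₂ := by
    rw [hfψ z₁ hz₁, hfψ z₂ hz₂, hy₁, hy₂, mul_pow, hωp.pow_eq_one, one_mul]
  have h12 := hinj hz₁U hz₂U this
  rw [h12, hy₂] at hy₁
  exact hω1 (mul_right_cancel₀ hy0 (by rw [hy₁, one_mul]))

/-- Riemann's removable singularity theorem, in a form that allows many singularities. -/
theorem exists_analytic_extension {f : ℂ → ℂ} {U : Set ℂ}
    (h : ∀ s ∈ U, ∃ g : ℂ → ℂ, AnalyticAt ℂ g s ∧ f =ᶠ[𝓝[≠] s] g) :
    ∃ R : ℂ → ℂ, ∀ s ∈ U, AnalyticAt ℂ R s ∧ f =ᶠ[𝓝[≠] s] R := by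
  have hlim : ∀ (g : ℂ → ℂ) (s : ℂ), ContinuousAt g s → f =ᶠ[𝓝[≠] s] g →
      limUnder (𝓝[≠] s) f = g s := fun g s hg hfg =>
    (Tendsto.congr' hfg.symm (hg.tendsto.mono_left nhdsWithin_le_nhds)).limUnder_eq
  -- The punctured limit is one formula for the extension at all points, so no choice of local
  -- extensions has to be patched.
  refine ⟨fun s => limUnder (𝓝[≠] s) f, fun s hs => ?_⟩
  obtain ⟨g, hg, hfg⟩ := h s hs
  have key : (fun s => limUnder (𝓝[≠] s) f) =ᶠ[𝓝 s] g := by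
    have h1 := hg.eventually_analyticAt
    have h2 : ∀ᶠ z in 𝓝 s, z ≠ s → f z = g z := eventually_nhdsWithin_iff.1 hfg
    filter_upwards [h1, h2.eventually_nhds] with z hz hz2
    rcases eq_or_ne z s with rfl | hne
    · exact hlim g z hz.continuousAt hfg
    · refine hlim g z hz.continuousAt ?_
      have h3 : ∀ᶠ y in 𝓝 z, y ≠ s := isOpen_ne.mem_nhds hne
      refine Filter.EventuallyEq.filter_mono ?_ nhdsWithin_le_nhds
      filter_upwards [hz2, h3] with y hy hy2 using hy hy2
  exact ⟨hg.congr key.symm, hfg.trans (key.symm.filter_mono nhdsWithin_le_nhds)⟩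

/-- A primitive on a convex open set. -/
theorem exists_primitive {f : ℂ → ℂ} {U : Set ℂ} (hU : Convex ℝ U) (hUo : IsOpen U)
    (hf : ∀ s ∈ U, AnalyticAt ℂ f s) : ∃ g : ℂ → ℂ, ∀ s ∈ U, HasDerivAt g (f s) s := by
  obtain ⟨g, hg⟩ := hU.exists_forall_hasDerivWithinAt (𝕜 := ℂ)
    (fun s hs => (hf s hs).differentiableAt.differentiableWithinAt)
  exact ⟨g, fun s hs => (hg s hs).hasDerivAt (hUo.mem_nhds hs)⟩

/-- A function with zero derivative on a convex set is constant there. -/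
theorem eq_of_hasDerivAt_eq {f g f' : ℂ → ℂ} {U : Set ℂ} (hU : Convex ℝ U)
    (hf : ∀ s ∈ U, HasDerivAt f (f' s) s) (hg : ∀ s ∈ U, HasDerivAt g (f' s) s) {x y : ℂ}
    (hx : x ∈ U) (hy : y ∈ U) : f x - g x = f y - g y := by
  have := hU.norm_image_sub_le_of_norm_hasDerivWithin_le (𝕜 := ℂ) (f := fun s => f s - g s)
    (f' := fun s => f' s - f' s) (C := 0)
    (fun s hs => ((hf s hs).sub (hg s hs)).hasDerivWithinAt) (by simp) hy hx
  simpa [sub_eq_zero] using this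

/-- A log of a curve whose exponential is constant is constant. -/
theorem eq_of_exp_eq_const {l : ℝ → ℂ} {c : ℂ} (hl : ContinuousOn l (Icc 0 1))
    (hc : ∀ t ∈ Ioo (0 : ℝ) 1, exp (l t) = c) : l 0 = l 1 := by
  have hc' : ∀ t ∈ Icc (0 : ℝ) 1, exp (l t) = c := by
    have h1 : EqOn (fun t => exp (l t)) (fun _ => c) (Icc 0 1) := by
      have : Icc (0 : ℝ) 1 ⊆ closure (Ioo 0 1) := by rw [closure_Ioo (by norm_num)]
      exact EqOn.of_subset_closure hc hl.cexp continuousOn_const Ioo_subset_Icc_self this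
    exact h1
  have hc0 : c ≠ 0 := by rw [← hc' 0 (by simp)]; exact exp_ne_zero _
  exact isCoveringMap_exp.isSeparatedMap.constOn_of_comp
    isCoveringMap_exp.isLocalHomeomorph.isLocallyInjective (s := Icc (0 : ℝ) 1) (g := l)
    isPreconnected_Icc hl (fun a ha b hb => Subtype.ext ((hc' a ha).trans (hc' b hb).symm))
    (by simp) (by simp)

/-! ### Hopf's bound on the turning of a tangent -/

/-- The image of `θ` is an interval that contains no multiple of `π`, hence it stays between the two
consecutive multiples around `θ t₀`. -/
theorem mem_Ioo_of_sin_pos {θ : ℝ → ℝ} {s : Set ℝ} (hs : IsPreconnected s)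
    (hθ : ContinuousOn θ s) (hsin : ∀ t ∈ s, 0 < Real.sin (θ t)) {n : ℤ} {t₀ t : ℝ} (ht₀ : t₀ ∈ s)
    (h₀ : θ t₀ ∈ Ioo (n * Real.pi) (n * Real.pi + Real.pi)) (ht : t ∈ s) :
    θ t ∈ Ioo (n * Real.pi) (n * Real.pi + Real.pi) := by
  have hoc := (hs.image θ hθ).ordConnected
  by_contra hcon
  have hzero : ∀ m : ℤ, (m * Real.pi : ℝ) ∉ θ '' s := by
    rintro m ⟨x, hx, hxm⟩
    have := hsin x hx
    rw [hxm, Real.sin_int_mul_pi] at this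
    exact lt_irrefl _ this
  rcases not_and_or.1 hcon with h | h
  · exact hzero n (hoc.out (mem_image_of_mem θ ht) (mem_image_of_mem θ ht₀)
      ⟨not_lt.1 h, h₀.1.le⟩)
  · refine hzero (n + 1) ?_
    have : ((n + 1 : ℤ) * Real.pi : ℝ) = n * Real.pi + Real.pi := by push_cast; ring
    rw [this]
    exact hoc.out (mem_image_of_mem θ ht₀) (mem_image_of_mem θ ht) ⟨h₀.2.le, not_lt.1 h⟩

/-- Turning of the tangent of a simple arc that starts at its lowest point and ends at its highest
point (Hopf's argument): it is at most `π`. -/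
theorem abs_turning_le {γ v l : ℝ → ℂ} (hγ : ContinuousOn γ (Icc 0 1))
    (hv : ContinuousOn v (Icc 0 1)) (hγv : ∀ t ∈ Ioo (0 : ℝ) 1, HasDerivAt γ (v t) t)
    (hinj : InjOn γ (Icc 0 1)) (h0 : ∀ t ∈ Ioc (0 : ℝ) 1, (γ 0).im < (γ t).im)
    (h1 : ∀ t ∈ Ico (0 : ℝ) 1, (γ t).im < (γ 1).im)
    (hl : ContinuousOn l (Icc 0 1)) (hlv : ∀ t ∈ Icc (0 : ℝ) 1, exp (l t) = v t) :
    |(l 1).im - (l 0).im| ≤ Real.pi := by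
  -- Clamping to `[0, 1]` extends the secant map to all of `ℝ²`, which is open and simply connected,
  -- so that it has a global logarithm.
  set c : ℝ → ℝ := fun x => max 0 (min x 1) with hc
  have hcc : Continuous c := by fun_prop
  have hcm : ∀ x, c x ∈ Icc (0 : ℝ) 1 := fun x => ⟨le_max_left _ _, max_le (by norm_num) (min_le_right _ _)⟩
  have hci : ∀ x ∈ Icc (0 : ℝ) 1, c x = x := fun x hx => by
    simp [hc, min_eq_left hx.2, max_eq_right hx.1]
  set V : ℝ → ℂ := fun x => v (c x) with hV
  have hVc : Continuous V := hv.comp_continuous hcc hcm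
  -- `K (x, y)` is the slope `(γ y - γ x) / (y - x)`, written as a mean of `v` so that it extends
  -- continuously to the diagonal with value `v`.
  set K : ℝ × ℝ → ℂ := fun p => ∫ r in (0 : ℝ)..1, V (c p.1 + (c p.2 - c p.1) * r) with hK
  have hKc : Continuous K := by
    refine intervalIntegral.continuous_parametric_intervalIntegral_of_continuous' ?_ 0 1
    exact hVc.comp (by fun_prop)
  have hKs : ∀ x ∈ Icc (0 : ℝ) 1, ∀ y ∈ Icc (0 : ℝ) 1, ((y - x : ℝ) : ℂ) * K (x, y) = γ y - γ x := by
    have main : ∀ x ∈ Icc (0 : ℝ) 1, ∀ y ∈ Icc (0 : ℝ) 1, x ≤ y → ∫ r in x..y, V r = γ y - γ x := by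
      intro x hx y hy hxy
      refine intervalIntegral.integral_eq_sub_of_hasDerivAt_of_le hxy
        (hγ.mono (Icc_subset_Icc hx.1 hy.2)) (fun t ht => ?_) (hVc.intervalIntegrable _ _)
      have ht' : t ∈ Ioo (0 : ℝ) 1 := ⟨hx.1.trans_lt ht.1, ht.2.trans_le hy.2⟩
      rw [hV]; simp only [hci t (Ioo_subset_Icc_self ht')]
      exact hγv t ht'
    intro x hx y hy
    simp only [hK, hci x hx, hci y hy]
    have := intervalIntegral.smul_integral_comp_add_mul (a := 0) (b := 1) V (y - x) x
    rw [← real_smul, this]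
    simp only [mul_zero, add_zero, mul_one, add_sub_cancel]
    rcases le_total x y with h | h
    · exact main x hx y hy h
    · rw [intervalIntegral.integral_symm, main y hy x hx h, neg_sub]
  have hKd : ∀ x ∈ Icc (0 : ℝ) 1, K (x, x) = v x := by
    intro x hx
    simp [hK, hV, hci x hx]
  -- Off the diagonal because the arc is simple, on it because `v` is an exponential.
  have hK0 : ∀ p, K p ≠ 0 := by
    intro p
    have hp : K p = K (c p.1, c p.2) := by simp only [hK, hci _ (hcm _)]
    rw [hp]
    by_cases h : c p.1 = c p.2
    · rw [h, hKd _ (hcm _), ← hlv _ (hcm _)]; exact exp_ne_zero _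
    · intro h2
      have := hKs _ (hcm p.1) _ (hcm p.2)
      rw [h2, mul_zero] at this
      exact h (hinj (hcm _) (hcm _) (sub_eq_zero.1 this.symm).symm)
  have hsc : IsSimplyConnected (univ : Set (ℝ × ℝ)) := by
    have : ContractibleSpace (univ : Set (ℝ × ℝ)) := convex_univ.contractibleSpace ⟨0, trivial⟩
    exact SimplyConnectedSpace.ofContractible _
  obtain ⟨Lg, hLc, hLe⟩ := exists_continuousOn_eqOn_exp_comp hsc isOpen_univ hKc.continuousOn
    (by rintro ⟨p, -, hp⟩; exact hK0 p hp)
  rw [continuousOn_univ] at hLc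
  have hLe' : ∀ p, exp (Lg p) = K p := fun p => hLe (mem_univ p)
  have hsin : ∀ x ∈ Icc (0 : ℝ) 1, ∀ y ∈ Icc (0 : ℝ) 1, x < y → (γ x).im < (γ y).im →
      0 < Real.sin (Lg (x, y)).im := by
    intro x hx y hy hxy him
    have h3 := congrArg Complex.im (hKs x hx y hy)
    rw [← hLe', Complex.im_ofReal_mul, exp_im, sub_im] at h3
    have h4 : 0 < (y - x) * (Real.exp (Lg (x, y)).re * Real.sin (Lg (x, y)).im) := by
      rw [h3]; linarith
    have h5 := (pos_iff_pos_of_mul_pos h4).1 (by linarith)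
    exact (pos_iff_pos_of_mul_pos h5).1 (Real.exp_pos _)
  obtain ⟨n, hn⟩ : ∃ n : ℤ, (Lg (0, 1)).im ∈ Ioo (n * Real.pi) (n * Real.pi + Real.pi) := by
    have h3 := hsin 0 (by simp) 1 (by simp) one_pos (h0 1 (by simp))
    refine ⟨⌊(Lg (0, 1)).im / Real.pi⌋, ?_, ?_⟩
    · refine lt_of_le_of_ne ?_ ?_
      · rw [← le_div_iff₀ Real.pi_pos]; exact Int.floor_le _
      · intro h; rw [← h, Real.sin_int_mul_pi] at h3; exact lt_irrefl _ h3
    · have := Int.lt_floor_add_one ((Lg (0, 1)).im / Real.pi)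
      rw [div_lt_iff₀ Real.pi_pos] at this
      linarith
  have hLim0 : Continuous fun t : ℝ => (Lg (0, t)).im := by fun_prop
  have hLim1 : Continuous fun t : ℝ => (Lg (t, 1)).im := by fun_prop
  -- Secants from the lowest point, and secants to the highest point, point upwards. Along `(0, t)`
  -- and `(t, 1)` the argument therefore stays in the interval of length `π` that contains its value
  -- at `(0, 1)`; the corners `(0, 0)` and `(1, 1)` are limits.
  have e0 : (Lg (0, 0)).im ∈ Icc (n * Real.pi) (n * Real.pi + Real.pi) := by
    have h3 : ∀ t ∈ Ioc (0 : ℝ) 1, (Lg (0, t)).im ∈ Icc (n * Real.pi) (n * Real.pi + Real.pi) :=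
      fun t ht => Ioo_subset_Icc_self (mem_Ioo_of_sin_pos isPreconnected_Ioc hLim0.continuousOn
        (fun s hs => hsin 0 (by simp) s (Ioc_subset_Icc_self hs) hs.1 (h0 s hs))
        (right_mem_Ioc.2 one_pos) hn ht)
    have h4 : (0 : ℝ) ∈ closure (Ioc (0 : ℝ) 1) := by rw [closure_Ioc (by norm_num)]; simp
    exact (isClosed_Icc.preimage hLim0).closure_subset_iff.2 h3 h4
  have e1 : (Lg (1, 1)).im ∈ Icc (n * Real.pi) (n * Real.pi + Real.pi) := by
    have h3 : ∀ t ∈ Ico (0 : ℝ) 1, (Lg (t, 1)).im ∈ Icc (n * Real.pi) (n * Real.pi + Real.pi) :=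
      fun t ht => Ioo_subset_Icc_self (mem_Ioo_of_sin_pos isPreconnected_Ico hLim1.continuousOn
        (fun s hs => hsin s (Ico_subset_Icc_self hs) 1 (by simp) hs.2 (h1 s hs))
        (left_mem_Ico.2 one_pos) hn ht)
    have h4 : (1 : ℝ) ∈ closure (Ico (0 : ℝ) 1) := by rw [closure_Ico (by norm_num)]; simp
    exact (isClosed_Icc.preimage hLim1).closure_subset_iff.2 h3 h4
  -- On the diagonal `l` and `Lg` are both continuous logarithms of `v`, so they differ by a
  -- constant.
  have hdiff : l 0 - Lg (0, 0) = l 1 - Lg (1, 1) := by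
    refine eq_of_exp_eq_const (l := fun t => l t - Lg (t, t)) (c := 1)
      (hl.sub (by fun_prop)) fun t ht => ?_
    have ht' := Ioo_subset_Icc_self ht
    rw [exp_sub, hlv t ht', hLe', hKd t ht', div_self]
    rw [← hlv t ht']; exact exp_ne_zero _
  have h5 := congrArg Complex.im hdiff
  simp only [sub_im] at h5
  rw [abs_le]
  constructor <;> linarith [e0.1, e0.2, e1.1, e1.2]

/-! ### The periodic logarithm `log (1 - exp (π i s))` -/

/-- `d/ds log (1 - exp (π i s))`. -/
noncomputable def cotTerm (s : ℂ) : ℂ := -(I * Real.pi * exp (I * Real.pi * s)) / (1 - exp (I * Real.pi * s))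

theorem exp_pi_add_two (s : ℂ) : exp (I * Real.pi * (s + 2)) = exp (I * Real.pi * s) := by
  rw [show I * Real.pi * (s + 2) = I * Real.pi * s + 2 * Real.pi * I by ring, exp_periodic]

theorem cotTerm_add_two (s : ℂ) : cotTerm (s + 2) = cotTerm s := by
  simp only [cotTerm, exp_pi_add_two]

theorem exp_pi_eq_one_iff (s : ℂ) : exp (I * Real.pi * s) = 1 ↔ ∃ n : ℤ, s = 2 * n := by
  rw [Complex.exp_eq_one_iff]
  have h : (Real.pi : ℂ) * I ≠ 0 := mul_ne_zero (by exact_mod_cast Real.pi_ne_zero) I_ne_zero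
  refine exists_congr fun n => ⟨fun hn => ?_, fun hn => by rw [hn]; ring⟩
  exact mul_left_cancel₀ h (by linear_combination hn)

theorem norm_exp_pi (s : ℂ) : ‖exp (I * Real.pi * s)‖ = Real.exp (-(Real.pi * s.im)) := by
  rw [norm_exp]; congr 1; simp

/-- `1 - X` has positive real part, so the principal logarithm in `logTerm` can be used up to the
real axis, away from the even integers. -/
theorem one_sub_mem_slitPlane {X : ℂ} (h : ‖X‖ ≤ 1) (h1 : X ≠ 1) : 1 - X ∈ slitPlane := by
  refine Or.inl ?_
  rw [sub_re, one_re, sub_pos]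
  refine lt_of_le_of_ne ((re_le_norm X).trans h) fun h2 => h1 ?_
  have h3 : X.re ^ 2 + X.im ^ 2 ≤ 1 := by
    have := Complex.sq_norm X
    rw [normSq_apply] at this
    nlinarith [norm_nonneg X]
  rw [h2] at h3
  exact Complex.ext h2 (by rw [one_im]; nlinarith)

theorem norm_exp_pi_le {s : ℂ} (hs : 0 ≤ s.im) : ‖exp (I * Real.pi * s)‖ ≤ 1 := by
  rw [norm_exp_pi]
  exact Real.exp_le_one_iff.2 (by have := mul_nonneg Real.pi_pos.le hs; linarith)

theorem norm_exp_pi_lt {s : ℂ} (hs : 0 < s.im) : ‖exp (I * Real.pi * s)‖ < 1 := by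
  rw [norm_exp_pi]
  exact Real.exp_lt_one_iff.2 (by have := mul_pos Real.pi_pos hs; linarith)

theorem hasDerivAt_exp_pi (c s : ℂ) :
    HasDerivAt (fun z => exp (I * Real.pi * (z - c))) (I * Real.pi * exp (I * Real.pi * (s - c))) s := by
  have := (((hasDerivAt_id s).sub_const c).const_mul (I * Real.pi)).cexp
  simpa [mul_comm] using this

theorem hasDerivAt_exp_neg_pi (c s : ℂ) :
    HasDerivAt (fun z => exp (I * Real.pi * -(z - c)))
      (-(I * Real.pi * exp (I * Real.pi * -(s - c)))) s := by
  have := (((hasDerivAt_id s).sub_const c).neg.const_mul (I * Real.pi)).cexp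
  simpa [mul_comm] using this

/-- The primitive of `cotTerm` in the upper half-plane. -/
noncomputable def logTerm (s : ℂ) : ℂ := log (1 - exp (I * Real.pi * s))

theorem logTerm_add_two (s : ℂ) : logTerm (s + 2) = logTerm s := by
  simp only [logTerm, exp_pi_add_two]

theorem logTerm_neg_add_two (s : ℂ) : logTerm (-(s + 2)) = logTerm (-s) := by
  rw [← logTerm_add_two (-(s + 2))]; congr 1; ring

theorem hasDerivAt_logTerm {c s : ℂ} (hs : 0 ≤ (s - c).im) (h1 : exp (I * Real.pi * (s - c)) ≠ 1) :
    HasDerivAt (fun z => logTerm (z - c)) (cotTerm (s - c)) s := by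
  have := ((hasDerivAt_exp_pi c s).const_sub 1).clog
    (one_sub_mem_slitPlane (norm_exp_pi_le hs) h1)
  simpa [logTerm, cotTerm] using this

/-- With `X = exp (π i (s - c))` one has `1 - X = -X (1 - X⁻¹)`, and `|X⁻¹| ≤ 1` on and below the
line through `c`. This is the branch to use there; the linear term comes from the factor `X`. -/
theorem hasDerivAt_logTerm_neg {c s : ℂ} (hs : (s - c).im ≤ 0)
    (h1 : exp (I * Real.pi * (s - c)) ≠ 1) :
    HasDerivAt (fun z => I * Real.pi * (z - c) + logTerm (-(z - c))) (cotTerm (s - c)) s := by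
  have h2 : exp (I * Real.pi * -(s - c)) ≠ 1 := by
    rw [mul_neg, exp_neg]; simpa using h1
  have h3 := ((hasDerivAt_exp_neg_pi c s).const_sub 1).clog
    (one_sub_mem_slitPlane (norm_exp_pi_le (s := -(s - c)) (by rw [neg_im]; linarith)) h2)
  have h4 := (((hasDerivAt_id s).sub_const c).const_mul (I * (Real.pi : ℂ))).add h3
  refine h4.congr_deriv ?_
  have e0 := exp_ne_zero (I * Real.pi * (s - c))
  rw [mul_neg, exp_neg] at h2
  simp only [cotTerm, mul_neg, exp_neg, neg_neg, mul_one]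
  have h5 : 1 - exp (I * Real.pi * (s - c)) ≠ 0 := sub_ne_zero.2 (Ne.symm h1)
  have h6 : 1 - (exp (I * Real.pi * (s - c)))⁻¹ ≠ 0 := sub_ne_zero.2 (Ne.symm h2)
  have h7 : exp (I * Real.pi * (s - c)) - 1 ≠ 0 := sub_ne_zero.2 h1
  field_simp
  ring

theorem analyticAt_cotTerm {c s : ℂ} (h : exp (I * Real.pi * (s - c)) ≠ 1) :
    AnalyticAt ℂ (fun z => cotTerm (z - c)) s := by
  unfold cotTerm
  refine AnalyticAt.div (by fun_prop) (by fun_prop) (sub_ne_zero.2 (Ne.symm h))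

theorem exists_analyticAt_eq_add_mul {f : ℂ → ℂ} {p : ℂ} (hf : AnalyticAt ℂ f p) :
    ∃ g : ℂ → ℂ, AnalyticAt ℂ g p ∧ g p = deriv f p ∧ ∀ z, f z = f p + (z - p) * g z := by
  refine ⟨dslope f p, ?_, dslope_same f p, fun z => ?_⟩
  · obtain ⟨q, hq⟩ := hf
    exact hq.has_fpower_series_dslope_fslope.analyticAt
  · have := sub_smul_dslope f p z
    rw [smul_eq_mul] at this
    rw [this]; ring

/-- Writing `1 - exp (π i (z - p)) = -(z - p) u z` with `u p = π i`, the remaining quotient has the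
value `1` at `p`, which is the residue. -/
theorem cotTerm_pole (p : ℂ) : ∃ g : ℂ → ℂ, AnalyticAt ℂ g p ∧
    ∀ᶠ z in 𝓝[≠] p, cotTerm (z - p) = 1 / (z - p) + g z := by
  have hp : AnalyticAt ℂ (fun z => exp (I * Real.pi * (z - p))) p := by fun_prop
  obtain ⟨u, hu, hup, hue⟩ := exists_analyticAt_eq_add_mul hp
  have hpi : (I * Real.pi : ℂ) ≠ 0 := mul_ne_zero I_ne_zero (by exact_mod_cast Real.pi_ne_zero)
  rw [(hasDerivAt_exp_pi p p).deriv] at hup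
  simp only [sub_self, mul_zero, exp_zero, mul_one] at hup hue
  have hu0 : u p ≠ 0 := by rwa [hup]
  have hm : AnalyticAt ℂ (fun z => I * Real.pi * exp (I * Real.pi * (z - p)) / u z) p :=
    (analyticAt_const.mul hp).div hu hu0
  obtain ⟨g, hg, -, hge⟩ := exists_analyticAt_eq_add_mul hm
  simp only [sub_self, mul_zero, exp_zero, mul_one, hup, div_self hpi] at hge
  refine ⟨g, hg, ?_⟩
  have hune : ∀ᶠ z in 𝓝[≠] p, u z ≠ 0 :=
    (hu.continuousAt.eventually_ne hu0).filter_mono nhdsWithin_le_nhds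
  filter_upwards [hune, self_mem_nhdsWithin] with z hz hzp
  have hzp' : z - p ≠ 0 := sub_ne_zero.2 hzp
  have h1 := hge z
  have h2 := hue z
  rw [div_eq_iff hz] at h1
  unfold cotTerm
  rw [show (1 : ℂ) - exp (I * Real.pi * (z - p)) = -((z - p) * u z) by rw [h2]; ring, neg_div_neg_eq,
    h1]
  field_simp

/-- In fact `cotTerm x = (π/2) (cot (π x / 2) + i)`. The constant imaginary part cancels in a sum
weighted by residues of total `0`. -/
theorem cotTerm_im_ofReal {x : ℝ} (h : exp (I * Real.pi * x) ≠ 1) :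
    (cotTerm x).im = Real.pi / 2 := by
  have hre : (exp (I * Real.pi * x)).re = Real.cos (Real.pi * x) := by
    rw [show I * Real.pi * x = ((Real.pi * x : ℝ) : ℂ) * I by push_cast; ring, exp_ofReal_mul_I_re]
  have him : (exp (I * Real.pi * x)).im = Real.sin (Real.pi * x) := by
    rw [show I * Real.pi * x = ((Real.pi * x : ℝ) : ℂ) * I by push_cast; ring, exp_ofReal_mul_I_im]
  have hsc := Real.sin_sq_add_cos_sq (Real.pi * x)
  have hc : 1 - Real.cos (Real.pi * x) ≠ 0 := by
    intro hc
    refine h (Complex.ext (by rw [hre, one_re]; linarith) ?_)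
    rw [him, one_im]; nlinarith
  set e := exp (I * Real.pi * x)
  have : cotTerm x * (1 - e) = -(I * Real.pi * e) := div_mul_cancel₀ _ (sub_ne_zero.2 (Ne.symm h))
  have h1 := congrArg Complex.re this
  have h2 := congrArg Complex.im this
  simp [hre, him] at h1 h2
  set c := Real.cos (Real.pi * x)
  set s := Real.sin (Real.pi * x)
  set A := (cotTerm x).re
  set B := (cotTerm x).im
  have : (1 - c) * (2 * B) = (1 - c) * Real.pi := by
    linear_combination s * h1 + (1 - c) * h2 - B * hsc + Real.pi * hsc
  linarith [mul_left_cancel₀ hc this]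

/-- A periodic primitive of `logTerm` in the upper half-plane. -/
theorem exists_primitive_logTerm : ∃ J : ℂ → ℂ, ∀ X ∈ Metric.ball (0 : ℂ) 1,
    ∃ J' : ℂ, HasDerivAt J J' X ∧ I * Real.pi * X * J' = log (1 - X) := by
  have hd : DifferentiableOn ℂ (fun X : ℂ => log (1 - X)) (Metric.ball 0 1) := by
    intro X hX
    rw [mem_ball_zero_iff] at hX
    have h1 : X ≠ 1 := by rintro rfl; simp at hX
    exact ((differentiableAt_const _).sub differentiableAt_id).clog
      (one_sub_mem_slitPlane hX.le h1) |>.differentiableWithinAt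
  -- `log (1 - X)` vanishes at `X = 0`, so `log (1 - X) / X` is holomorphic in the disc. With `X =
  -- exp (π i s)` and `d/ds = π i X d/dX` its primitive becomes a primitive of `logTerm` of period
  -- `2`: the mean of `logTerm` over a period is zero.
  have hds := (Complex.differentiableOn_dslope (Metric.ball_mem_nhds 0 one_pos)).2 hd
  obtain ⟨J, hJ⟩ := (hds.const_mul ((I * Real.pi : ℂ)⁻¹)).isExactOn_ball
  refine ⟨J, fun X hX => ⟨_, hJ X hX, ?_⟩⟩
  have hpi : (I * Real.pi : ℂ) ≠ 0 := mul_ne_zero I_ne_zero (by exact_mod_cast Real.pi_ne_zero)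
  have := sub_smul_dslope (fun X : ℂ => log (1 - X)) 0 X
  simp at this
  rw [← this]
  field_simp

/-! ### Integrating a logarithmic derivative on the strip -/

/-- `h` has period `2` and half period `1 + T i`, and in the strip `|Im s| < T` its only
singularities are simple poles at the real points `p i + 2 n`, with residues `ρ i`. -/
structure HasStripPoles {ι : Type*} (T : ℝ) (p ρ : ι → ℝ) (h : ℂ → ℂ) : Prop where
  add_two : ∀ s, h (s + 2) = h s
  add_half : ∀ s, h (s + (1 + T * I)) = h s
  analytic : ∀ s : ℂ, |s.im| < T → (∀ (i : ι) (n : ℤ), s ≠ p i + 2 * n) → AnalyticAt ℂ h s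
  pole : ∀ i, ∃ g : ℂ → ℂ, AnalyticAt ℂ g (p i) ∧ ∀ᶠ z in 𝓝[≠] (p i : ℂ), h z = ρ i / (z - p i) + g z

/-- The horizontal strip `α < Im s < β`. -/
def strip (α β : ℝ) : Set ℂ := {s | α < s.im ∧ s.im < β}

theorem convex_strip (α β : ℝ) : Convex ℝ (strip α β) :=
  (convex_halfSpace_im_gt α).inter (convex_halfSpace_im_lt β)

theorem isOpen_strip (α β : ℝ) : IsOpen (strip α β) :=
  (isOpen_lt continuous_const continuous_im).inter (isOpen_lt continuous_im continuous_const)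

theorem add_two_int_of_add_two {h : ℂ → ℂ} (h2 : ∀ s, h (s + 2) = h s) (n : ℤ) (s : ℂ) :
    h (s + 2 * n) = h s := by
  have := (show Function.Periodic h 2 from h2).int_mul n s
  rwa [mul_comm] at this

theorem add_two_mem_strip {α β : ℝ} {s : ℂ} (hs : s ∈ strip α β) : s + 2 ∈ strip α β := by
  simpa [strip] using hs

section
variable {ι : Type*} {T : ℝ} {p ρ : ι → ℝ} {h : ℂ → ℂ}

theorem exp_pi_sub_ne_one {s : ℂ} (hs : ∀ (i : ι) (n : ℤ), s ≠ p i + 2 * n) (i : ι) :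
    exp (I * Real.pi * (s - p i)) ≠ 1 := by
  rw [Ne, exp_pi_eq_one_iff]
  rintro ⟨n, hn⟩
  exact hs i n (by linear_combination hn)

theorem ne_of_im_ne_zero {s : ℂ} (hs : s.im ≠ 0) (i : ι) (n : ℤ) : s ≠ p i + 2 * n := by
  rintro rfl; simp at hs

variable [Fintype ι]

/-- The sum of the `ρ i * cotTerm (s - p i)` has the same principal parts as `h`, so the difference
has only removable singularities. By `hp` the poles are inequivalent modulo `2`, so at each of them
only one summand is singular. -/
theorem HasStripPoles.exists_regular (hh : HasStripPoles T p ρ h)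
    (hp : ∀ i j (n : ℤ), p i = p j + 2 * n → i = j) :
    ∃ R : ℂ → ℂ, (∀ s ∈ strip (-T) T, AnalyticAt ℂ R s) ∧
      (∀ s ∈ strip (-T) T, R (s + 2) = R s) ∧
      ∀ s ∈ strip (-T) T, (∀ (i : ι) (n : ℤ), s ≠ p i + 2 * n) →
        h s = R s + ∑ i, ρ i * cotTerm (s - p i) := by
  classical
  set f : ℂ → ℂ := fun z => h z - ∑ i, ρ i * cotTerm (z - p i) with hf
  have hf2 : ∀ z, f (z + 2) = f z := fun z => by
    simp only [hf, hh.add_two]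
    congr 1
    exact Finset.sum_congr rfl fun i _ => by
      rw [show z + 2 - (p i : ℂ) = z - p i + 2 by ring, cotTerm_add_two]
  have hreg : ∀ s ∈ strip (-T) T, (∀ (i : ι) (n : ℤ), s ≠ p i + 2 * n) → AnalyticAt ℂ f s := by
    intro s hs hsp
    refine (hh.analytic s (abs_lt.2 hs) hsp).sub ?_
    refine Finset.analyticAt_fun_sum _ fun i _ => analyticAt_const.mul ?_
    exact analyticAt_cotTerm (exp_pi_sub_ne_one hsp i)
  have hpole : ∀ i, ∃ g : ℂ → ℂ, AnalyticAt ℂ g (p i) ∧ f =ᶠ[𝓝[≠] (p i : ℂ)] g := by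
    intro i
    obtain ⟨g₁, hg₁, he₁⟩ := hh.pole i
    obtain ⟨g₂, hg₂, he₂⟩ := cotTerm_pole (p i : ℂ)
    refine ⟨fun z => g₁ z - ρ i * g₂ z - ∑ j ∈ Finset.univ.erase i, ρ j * cotTerm (z - p j),
      ?_, ?_⟩
    · refine (hg₁.sub (analyticAt_const.mul hg₂)).sub ?_
      refine Finset.analyticAt_fun_sum _ fun j hj => analyticAt_const.mul (analyticAt_cotTerm ?_)
      rw [Ne, exp_pi_eq_one_iff]
      rintro ⟨n, hn⟩
      have : (p i : ℂ) = p j + 2 * n := by linear_combination hn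
      exact (Finset.ne_of_mem_erase hj) (hp i j n (by exact_mod_cast this)).symm
    · filter_upwards [he₁, he₂] with z h1 h2
      simp only [hf]
      rw [← Finset.add_sum_erase _ _ (Finset.mem_univ i), h1, h2]
      ring
  have hloc : ∀ s ∈ strip (-T) T, ∃ g : ℂ → ℂ, AnalyticAt ℂ g s ∧ f =ᶠ[𝓝[≠] s] g := by
    intro s hs
    by_cases hsp : ∀ (i : ι) (n : ℤ), s ≠ p i + 2 * n
    · exact ⟨f, hreg s hs hsp, EventuallyEq.rfl⟩
    · push Not at hsp
      obtain ⟨i, n, rfl⟩ := hsp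
      obtain ⟨g, hg, he⟩ := hpole i
      -- The other poles are translates of the `p i` by the period of `f`.
      have ht : Tendsto (fun z : ℂ => z - 2 * n) (𝓝[≠] (p i + 2 * n : ℂ)) (𝓝[≠] (p i : ℂ)) := by
        refine tendsto_nhdsWithin_iff.2 ⟨?_, ?_⟩
        · have : Continuous fun z : ℂ => z - 2 * n := by fun_prop
          have := this.tendsto (p i + 2 * n : ℂ)
          rw [add_sub_cancel_right] at this
          exact this.mono_left nhdsWithin_le_nhds
        · filter_upwards [self_mem_nhdsWithin] with z hz hz2
          exact hz (by rw [mem_singleton_iff] at hz2 ⊢; linear_combination hz2)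
      refine ⟨fun z => g (z - 2 * n), ?_, ?_⟩
      · refine AnalyticAt.fun_comp (g := g) ?_ (by fun_prop)
        rwa [add_sub_cancel_right]
      · filter_upwards [ht.eventually he] with z hz
        rw [← hz, ← add_two_int_of_add_two hf2 n (z - 2 * n), sub_add_cancel]
  obtain ⟨R, hR⟩ := exists_analytic_extension hloc
  refine ⟨R, fun s hs => (hR s hs).1, fun s hs => ?_, fun s hs hsp => ?_⟩
  · have hs2 := add_two_mem_strip hs
    have h1 : Tendsto f (𝓝[≠] s) (𝓝 (R s)) :=
      Tendsto.congr' (hR s hs).2.symm ((hR s hs).1.continuousAt.tendsto.mono_left nhdsWithin_le_nhds)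
    have h2 : Tendsto f (𝓝[≠] (s + 2)) (𝓝 (R (s + 2))) :=
      Tendsto.congr' (hR _ hs2).2.symm
        ((hR _ hs2).1.continuousAt.tendsto.mono_left nhdsWithin_le_nhds)
    have ht : Tendsto (fun z : ℂ => z + 2) (𝓝[≠] s) (𝓝[≠] (s + 2)) := by
      refine tendsto_nhdsWithin_iff.2 ⟨?_, ?_⟩
      · have : Continuous fun z : ℂ => z + 2 := by fun_prop
        exact (this.tendsto s).mono_left nhdsWithin_le_nhds
      · filter_upwards [self_mem_nhdsWithin] with z hz hz2
        exact hz (add_right_cancel (mem_singleton_iff.1 hz2))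
    have h3 := h2.comp ht
    simp only [Function.comp_def, hf2] at h3
    exact tendsto_nhds_unique h3 h1
  · have h1 : f =ᶠ[𝓝 s] R := ((hreg s hs hsp).frequently_eq_iff_eventually_eq (hR s hs).1).1
      (hR s hs).2.frequently
    have := h1.self_of_nhds
    simp only [hf] at this
    rw [← this]; ring

end

section
variable {ι : Type*} {T : ℝ} {p ρ : ι → ℝ} {h : ℂ → ℂ} [Fintype ι]

theorem hasDerivAt_add_sum_logTerm {R R₀ : ℂ → ℂ} {s : ℂ} (hR : HasDerivAt R₀ (R s) s)
    (hs : 0 < s.im) :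
    HasDerivAt (fun z => R₀ z + ∑ i, ρ i * logTerm (z - p i))
      (R s + ∑ i, ρ i * cotTerm (s - p i)) s := by
  refine hR.add (HasDerivAt.fun_sum fun i _ => (hasDerivAt_logTerm (by simpa using hs.le) ?_).const_mul _)
  exact exp_pi_sub_ne_one (fun i n => ne_of_im_ne_zero hs.ne' i n) i

theorem hasDerivAt_add_sum_logTerm_neg {R R₀ : ℂ → ℂ} {s : ℂ} (hR : HasDerivAt R₀ (R s) s)
    (hs : s.im < 0) :
    HasDerivAt (fun z => R₀ z + ∑ i, ρ i * (I * Real.pi * (z - p i) + logTerm (-(z - p i))))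
      (R s + ∑ i, ρ i * cotTerm (s - p i)) s := by
  refine hR.add (HasDerivAt.fun_sum fun i _ =>
    (hasDerivAt_logTerm_neg (by simpa using hs.le) ?_).const_mul _)
  exact exp_pi_sub_ne_one (fun i n => ne_of_im_ne_zero hs.ne i n) i

/-- A function that is analytic on a strip about the real axis and real on a real interval is
real on the real axis. -/
theorem im_eq_zero_of_strip (hT : 0 < T) {R : ℂ → ℂ} (hR : ∀ s ∈ strip (-T) T, AnalyticAt ℂ R s)
    {α β : ℝ} (hαβ : α < β) (hre : ∀ x ∈ Ioo α β, (R x).im = 0) (x : ℝ) : (R x).im = 0 := by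
  -- The Schwarz reflection of `R`: it agrees with `R` on a real interval, hence on the whole strip
  -- by the identity theorem.
  set R' : ℂ → ℂ := fun s => (starRingEnd ℂ) (R ((starRingEnd ℂ) s)) with hR'
  have hconj : ∀ s ∈ strip (-T) T, (starRingEnd ℂ) s ∈ strip (-T) T := fun s hs => by
    simp only [strip, mem_ofPred_eq, conj_im] at hs ⊢
    constructor <;> linarith [hs.1, hs.2]
  have hR'd : DifferentiableOn ℂ R' (strip (-T) T) := fun s hs => by
    have := (hR _ (hconj s hs)).differentiableAt.hasDerivAt.conj_conj.differentiableAt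
    rw [Complex.conj_conj] at this
    exact this.differentiableWithinAt
  have hreal : ∀ x : ℝ, (x : ℂ) ∈ strip (-T) T := fun x => by simp [strip, hT]
  obtain ⟨m, hm⟩ := exists_between hαβ
  have key : EqOn R R' (strip (-T) T) := by
    refine AnalyticOnNhd.eqOn_of_preconnected_of_frequently_eq (z₀ := (m : ℂ)) (fun s hs => hR s hs)
      (hR'd.analyticOnNhd (isOpen_strip _ _)) (convex_strip _ _).isPreconnected (hreal m) ?_
    have ht : Tendsto (fun x : ℝ => (x : ℂ)) (𝓝[≠] m) (𝓝[≠] (m : ℂ)) := by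
      refine tendsto_nhdsWithin_iff.2 ⟨(continuous_ofReal.tendsto m).mono_left nhdsWithin_le_nhds, ?_⟩
      filter_upwards [self_mem_nhdsWithin] with y hy
      simpa using hy
    refine ht.frequently (Eventually.frequently ?_)
    filter_upwards [mem_nhdsWithin_of_mem_nhds (isOpen_Ioo.mem_nhds hm)] with y hy
    simp only [hR', conj_ofReal]
    exact (conj_eq_iff_im.2 (hre y hy)).symm
  have := key (hreal x)
  simp only [hR', conj_ofReal] at this
  exact conj_eq_iff_im.1 this.symm

/-- `P` is a primitive of `h` above the real axis and `M` one below it. The translate of `P` by the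
half period `1 + T i` is another primitive below the axis, so it differs from `M` by a constant. The
increment of both over the period `2` gives the residue theorem. The last conclusion, without any
additive constant, is the point: it fixes the argument of `F` on the upper edge relative to the
lower one. -/
theorem HasStripPoles.exists_log (hT : 0 < T) (hh : HasStripPoles T p ρ h)
    (hp : ∀ i j (n : ℤ), p i = p j + 2 * n → i = j)
    {α β : ℝ} (hαβ : α < β) (hreal : ∀ x ∈ Ioo α β, (∀ (i : ι) (n : ℤ), (x : ℂ) ≠ p i + 2 * n) ∧
      (h x).im = 0)
    {F : ℂ → ℂ} (hF : ∀ s ∈ strip 0 T, HasDerivAt F (h s * F s) s)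
    (hF0 : ∀ s ∈ strip 0 T, F s ≠ 0) (hF2 : ∀ s ∈ strip 0 T, F (s + 2) = F s) :
    ∑ i, ρ i = 0 ∧ ∃ (R₀ : ℂ → ℂ) (c : ℂ), c ≠ 0 ∧ (∀ s ∈ strip (-T) T, ContinuousAt R₀ s) ∧
      (∀ x : ℝ, (R₀ x).im = (R₀ 0).im) ∧ (∀ s ∈ strip (-T) T, R₀ (s + 2) = R₀ s) ∧
      (∀ s ∈ strip 0 T, F s = c * exp (R₀ s + ∑ i, ρ i * logTerm (s - p i))) ∧
      ∀ s ∈ strip (-T) 0, R₀ (s + (1 + T * I)) + ∑ i, ρ i * logTerm (s + (1 + T * I) - p i) =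
        R₀ s + ∑ i, ρ i * logTerm (-(s - p i)) := by
  obtain ⟨R, hRa, hR2, hRh⟩ := hh.exists_regular hp
  have hsub1 : strip 0 T ⊆ strip (-T) T := fun s hs => ⟨by linarith [hs.1], hs.2⟩
  have hsub2 : strip (-T) 0 ⊆ strip (-T) T := fun s hs => ⟨hs.1, by linarith [hs.2]⟩
  have hshift : ∀ s ∈ strip (-T) 0, s + (1 + T * I) ∈ strip 0 T := fun s hs => by
    simp only [strip, mem_ofPred_eq] at hs ⊢
    simp
    constructor <;> linarith [hs.1, hs.2]
  obtain ⟨R₀, hR₀⟩ := exists_primitive (convex_strip (-T) T) (isOpen_strip _ _) hRa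
  set P : ℂ → ℂ := fun z => R₀ z + ∑ i, ρ i * logTerm (z - p i) with hP
  set M : ℂ → ℂ := fun z => R₀ z + ∑ i, ρ i * (I * Real.pi * (z - p i) + logTerm (-(z - p i)))
    with hM
  have hPd : ∀ s ∈ strip 0 T, HasDerivAt P (h s) s := fun s hs => by
    rw [hRh s (hsub1 hs) (fun i n => ne_of_im_ne_zero hs.1.ne' i n)]
    exact hasDerivAt_add_sum_logTerm (hR₀ s (hsub1 hs)) hs.1
  have hMd : ∀ s ∈ strip (-T) 0, HasDerivAt M (h s) s := fun s hs => by
    rw [hRh s (hsub2 hs) (fun i n => ne_of_im_ne_zero hs.2.ne i n)]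
    exact hasDerivAt_add_sum_logTerm_neg (hR₀ s (hsub2 hs)) hs.2
  have hPsd : ∀ s ∈ strip (-T) 0, HasDerivAt (fun z => P (z + (1 + T * I))) (h s) s := fun s hs => by
    have := (hPd _ (hshift s hs)).comp_add_const s (1 + T * I)
    rwa [hh.add_half] at this
  -- the constant `R₀ (s + 2) - R₀ s`
  have h0mem : (0 : ℂ) ∈ strip (-T) T := by simp [strip, hT]
  set m : ℂ := R₀ 2 - R₀ 0 with hm
  have hR₀2 : ∀ s ∈ strip (-T) T, R₀ (s + 2) = R₀ s + m := by
    intro s hs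
    have h1 : ∀ s ∈ strip (-T) T, HasDerivAt (fun z => R₀ (z + 2)) (R s) s := fun s hs => by
      have := (hR₀ _ (add_two_mem_strip hs)).comp_add_const s 2
      rwa [hR2 s hs] at this
    have h2 := eq_of_hasDerivAt_eq (convex_strip (-T) T) h1 hR₀ hs h0mem
    simp only [zero_add] at h2
    rw [hm]; linear_combination h2
  have hsq : ∀ z : ℂ, ∑ i, (ρ i : ℂ) * logTerm (z + 2 - p i) = ∑ i, (ρ i : ℂ) * logTerm (z - p i) :=
    fun z => Finset.sum_congr rfl fun i _ => by
      rw [show z + 2 - (p i : ℂ) = z - p i + 2 by ring, logTerm_add_two]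
  have hsqn : ∀ z : ℂ, ∑ i, (ρ i : ℂ) * logTerm (-(z + 2 - p i)) =
      ∑ i, (ρ i : ℂ) * logTerm (-(z - p i)) :=
    fun z => Finset.sum_congr rfl fun i _ => by
      rw [show z + 2 - (p i : ℂ) = z - p i + 2 by ring, logTerm_neg_add_two]
  have hpi : (I * Real.pi : ℂ) ≠ 0 := mul_ne_zero I_ne_zero (by exact_mod_cast Real.pi_ne_zero)
  set s₁ : ℂ := -(T / 2 : ℝ) * I with hs₁
  have hs₁m : s₁ ∈ strip (-T) 0 := by
    simpa [hs₁, strip] using hT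
  have hMe : ∀ z, M z = R₀ z + ∑ i, ρ i * logTerm (-(z - p i)) + I * Real.pi * z * (∑ i, ρ i : ℝ) -
      I * Real.pi * ∑ i, (ρ i * p i : ℂ) := by
    intro z
    simp only [hM, mul_add, Finset.sum_add_distrib]
    have : ∑ i, (ρ i : ℂ) * (I * Real.pi * (z - p i)) =
      I * Real.pi * z * (∑ i, ρ i : ℝ) - I * Real.pi * ∑ i, (ρ i * p i : ℂ) := by
      push_cast
      rw [Finset.mul_sum, Finset.mul_sum, ← Finset.sum_sub_distrib]
      exact Finset.sum_congr rfl fun i _ => by ring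
    rw [this]; ring
  -- Advancing by `2` adds `m` to the translate of `P`, but `m + 2 π i ∑ ρ i` to `M`.
  have hsum : ∑ i, ρ i = 0 := by
    have h1 := eq_of_hasDerivAt_eq (convex_strip (-T) 0) hPsd hMd (add_two_mem_strip hs₁m) hs₁m
    have e1 : P (s₁ + 2 + (1 + T * I)) = P (s₁ + (1 + T * I)) + m := by
      simp only [hP]
      rw [show s₁ + 2 + (1 + T * I) = s₁ + (1 + T * I) + 2 by ring,
        hR₀2 _ (hsub1 (hshift s₁ hs₁m)), hsq]
      ring
    rw [e1, hMe, hMe, hsqn, hR₀2 _ (hsub2 hs₁m)] at h1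
    have h2 : I * Real.pi * 2 * ((∑ i, ρ i : ℝ) : ℂ) = 0 := by linear_combination -h1
    have h3 := (mul_eq_zero.1 h2).resolve_left (mul_ne_zero hpi two_ne_zero)
    exact_mod_cast h3
  refine ⟨hsum, ?_⟩
  -- On the given interval `h` is real, and the `cotTerm` sum has imaginary part `(π/2) ∑ ρ i = 0`.
  have hRreal : ∀ x : ℝ, (R x).im = 0 := by
    refine im_eq_zero_of_strip hT hRa hαβ fun x hx => ?_
    obtain ⟨h1, h2⟩ := hreal x hx
    rw [hRh x (by simp [strip, hT]) h1, add_im, im_sum] at h2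
    have h3 : ∑ i, ((ρ i : ℂ) * cotTerm (x - p i)).im = 0 := by
      have : ∀ i, ((ρ i : ℂ) * cotTerm (x - p i)).im = ρ i * (Real.pi / 2) := fun i => by
        have h4 := exp_pi_sub_ne_one h1 i
        rw [← ofReal_sub] at h4 ⊢
        rw [im_ofReal_mul, cotTerm_im_ofReal h4]
      simp only [this, ← Finset.sum_mul, hsum, zero_mul]
    linarith
  have hR₀im : ∀ x : ℝ, (R₀ x).im = (R₀ 0).im := by
    have h1 : ∀ x : ℝ, HasDerivAt (fun x : ℝ => (R₀ x).im) 0 x := fun x => by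
      have h2 := (hR₀ x (by simp [strip, hT])).comp_ofReal
      have h3 := (imCLM.hasFDerivAt (x := R₀ x)).comp_hasDerivAt x h2
      simpa [Function.comp_def, hRreal x] using h3
    intro x
    have := is_const_of_deriv_eq_zero (fun x => (h1 x).differentiableAt) (fun x => (h1 x).deriv) x 0
    simpa using this
  -- `F` is a multiple of `exp P`
  obtain ⟨c, hc⟩ : ∃ c, ∀ s ∈ strip 0 T, F s * exp (-P s) = c := by
    refine ⟨F (s₁ + (1 + T * I)) * exp (-P (s₁ + (1 + T * I))), fun s hs => ?_⟩
    have h1 : ∀ s ∈ strip 0 T, HasDerivAt (fun z => F z * exp (-P z)) 0 s := fun s hs => by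
      refine ((hF s hs).mul (hPd s hs).neg.cexp).congr_deriv ?_
      ring
    have := eq_of_hasDerivAt_eq (g := fun _ => 0) (convex_strip 0 T) h1
      (fun s _ => hasDerivAt_const s 0) hs (hshift s₁ hs₁m)
    simpa using this
  have hFe : ∀ s ∈ strip 0 T, F s = c * exp (P s) := fun s hs => by
    rw [← hc s hs, mul_assoc, ← exp_add]; simp
  have hc0 : c ≠ 0 := by
    rintro rfl
    exact hF0 _ (hshift s₁ hs₁m) (by rw [hFe _ (hshift s₁ hs₁m), zero_mul])
  -- `F` has period `2`, so `exp m = 1`; as `R₀` has constant imaginary part on the real axis, `m`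
  -- is real, hence zero.
  have hm0 : m = 0 := by
    have hs := hshift s₁ hs₁m
    set s := s₁ + (1 + T * I)
    have h1 := hF2 s hs
    rw [hFe s hs, hFe _ (add_two_mem_strip hs)] at h1
    have h2 := mul_left_cancel₀ hc0 h1
    have h3 : P (s + 2) = P s + m := by
      simp only [hP]; rw [hR₀2 _ (hsub1 hs), hsq]; ring
    rw [h3, exp_add] at h2
    have h4 : exp m = 1 := mul_left_cancel₀ (exp_ne_zero (P s)) (by rw [h2, mul_one])
    have h5 : m.im = 0 := by
      have := hR₀im 2
      rw [hm, sub_im]; push_cast at this; linarith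
    have h6 : m = (m.re : ℂ) := Complex.ext rfl (by simpa using h5)
    rw [h6, ← ofReal_exp] at h4
    have h7 : Real.exp m.re = 1 := by exact_mod_cast h4
    rw [h6, (Real.exp_eq_one_iff _).1 h7, ofReal_zero]
  have hR₀2' : ∀ s ∈ strip (-T) T, R₀ (s + 2) = R₀ s := fun s hs => by
    rw [hR₀2 s hs, hm0, add_zero]
  refine ⟨R₀, c, hc0, fun s hs => (hR₀ s hs).continuousAt, hR₀im, hR₀2', hFe, ?_⟩
  -- the two primitives differ by a constant, which is compared by means of second primitives
  set N : ℂ → ℂ := fun z => R₀ z + ∑ i, ρ i * logTerm (-(z - p i)) with hN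
  have hMN : ∀ z, M z = N z - I * Real.pi * ∑ i, (ρ i * p i : ℂ) := fun z => by
    rw [hMe, hsum]; simp [hN]
  obtain ⟨D, hD⟩ : ∃ D, ∀ s ∈ strip (-T) 0, P (s + (1 + T * I)) = N s + D := by
    refine ⟨P (s₁ + (1 + T * I)) - N s₁, fun s hs => ?_⟩
    have := eq_of_hasDerivAt_eq (convex_strip (-T) 0) hPsd hMd hs hs₁m
    rw [hMN, hMN] at this
    linear_combination this
  suffices D = 0 by
    intro s hs
    have h3 := hD s hs
    rw [this, add_zero] at h3
    exact h3
  obtain ⟨G, hG⟩ := exists_primitive (convex_strip (-T) T) (isOpen_strip _ _) (f := R₀)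
    (fun s hs => (DifferentiableOn.analyticOnNhd (s := strip (-T) T)
      (fun z hz => (hR₀ z hz).differentiableAt.differentiableWithinAt) (isOpen_strip _ _)) s hs)
  obtain ⟨J, hJ⟩ := exists_primitive_logTerm
  have hJup : ∀ (c s : ℂ), 0 < (s - c).im →
      HasDerivAt (fun z => J (exp (I * Real.pi * (z - c)))) (logTerm (s - c)) s := by
    intro c s hs
    obtain ⟨J', hJ', he⟩ := hJ _ (mem_ball_zero_iff.2 (norm_exp_pi_lt hs))
    refine (HasDerivAt.comp s hJ' (hasDerivAt_exp_pi c s)).congr_deriv ?_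
    rw [logTerm, ← he]; ring
  have hJdn : ∀ (c s : ℂ), (s - c).im < 0 →
      HasDerivAt (fun z => -J (exp (I * Real.pi * -(z - c)))) (logTerm (-(s - c))) s := by
    intro c s hs
    obtain ⟨J', hJ', he⟩ := hJ _ (mem_ball_zero_iff.2 (norm_exp_pi_lt (s := -(s - c))
      (by rw [neg_im]; linarith)))
    refine (HasDerivAt.comp s hJ' (hasDerivAt_exp_neg_pi c s)).neg.congr_deriv ?_
    rw [logTerm, ← he]; ring
  set A : ℂ → ℂ := fun z => G z + ∑ i, ρ i * J (exp (I * Real.pi * (z - p i))) with hA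
  set B : ℂ → ℂ := fun z => G z + ∑ i, ρ i * -J (exp (I * Real.pi * -(z - p i))) with hB
  have hAd : ∀ s ∈ strip 0 T, HasDerivAt A (P s) s := fun s hs =>
    (hG s (hsub1 hs)).add (HasDerivAt.fun_sum fun i _ =>
      (hJup (p i) s (by simpa using hs.1)).const_mul _)
  have hBd : ∀ s ∈ strip (-T) 0, HasDerivAt B (N s) s := fun s hs =>
    (hG s (hsub2 hs)).add (HasDerivAt.fun_sum fun i _ =>
      (hJdn (p i) s (by simpa using hs.2)).const_mul _)
  have hG2 : ∀ s ∈ strip (-T) T, G (s + 2) = G s + (G 2 - G 0) := by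
    intro s hs
    have h1 : ∀ s ∈ strip (-T) T, HasDerivAt (fun z => G (z + 2)) (R₀ s) s := fun s hs => by
      have := (hG _ (add_two_mem_strip hs)).comp_add_const s 2
      rwa [hR₀2' s hs] at this
    have h2 := eq_of_hasDerivAt_eq (convex_strip (-T) T) h1 hG hs h0mem
    simp only [zero_add] at h2
    linear_combination h2
  have h1 : ∀ s ∈ strip (-T) 0, HasDerivAt (fun z => A (z + (1 + T * I)) - D * z) (N s) s := by
    intro s hs
    have h2 := (hAd _ (hshift s hs)).comp_add_const s (1 + T * I)
    refine (h2.sub ((hasDerivAt_id s).const_mul D)).congr_deriv ?_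
    rw [hD s hs]; simp
  -- The `J` terms are periodic, so `A` and `B` both grow by `G 2 - G 0` over a period. The linear
  -- term `D z` cannot grow, which leaves `2 D = 0`.
  have h2 := eq_of_hasDerivAt_eq (convex_strip (-T) 0) h1 hBd (add_two_mem_strip hs₁m) hs₁m
  have eA : A (s₁ + 2 + (1 + T * I)) = A (s₁ + (1 + T * I)) + (G 2 - G 0) := by
    simp only [hA]
    rw [show s₁ + 2 + (1 + T * I) = s₁ + (1 + T * I) + 2 by ring,
      hG2 _ (hsub1 (hshift s₁ hs₁m))]
    have : ∀ z : ℂ, ∑ i, (ρ i : ℂ) * J (exp (I * Real.pi * (z + 2 - p i))) =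
        ∑ i, (ρ i : ℂ) * J (exp (I * Real.pi * (z - p i))) := fun z =>
      Finset.sum_congr rfl fun i _ => by
        rw [show z + 2 - (p i : ℂ) = z - p i + 2 by ring, exp_pi_add_two]
    rw [this]; ring
  have eB : B (s₁ + 2) = B s₁ + (G 2 - G 0) := by
    simp only [hB]
    rw [hG2 _ (hsub2 hs₁m)]
    have : ∀ z : ℂ, ∑ i, (ρ i : ℂ) * -J (exp (I * Real.pi * -(z + 2 - p i))) =
        ∑ i, (ρ i : ℂ) * -J (exp (I * Real.pi * -(z - p i))) := fun z =>
      Finset.sum_congr rfl fun i _ => by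
        rw [← exp_pi_add_two (-(z + 2 - p i)), show -(z + 2 - (p i : ℂ)) + 2 = -(z - p i) by ring]
    rw [this]; ring
  rw [eA, eB] at h2
  have : 2 * D = 0 := by linear_combination -h2
  simpa using this

end

/-! ### The relation between `a`, `b` and `k` -/

/-- `1 - exp (π i x) = 2 sin (π x / 2) exp (π i (x - 1) / 2)`, where the sine is positive and the
angle lies in the principal range. -/
theorem logTerm_im_of_mem_Ioo {x : ℝ} (h0 : 0 < x) (h2 : x < 2) :
    (logTerm x).im = Real.pi * (x - 1) / 2 := by
  have hpi := Real.pi_pos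
  have key : 1 - exp (I * Real.pi * x) = ((2 * Real.sin (Real.pi * x / 2) : ℝ) : ℂ) *
      (Complex.cos ((Real.pi * (x - 1) / 2 : ℝ) : ℂ) +
        Complex.sin ((Real.pi * (x - 1) / 2 : ℝ) : ℂ) * I) := by
    have e1 : I * Real.pi * x = ((2 * (Real.pi * x / 2) : ℝ) : ℂ) * I := by push_cast; ring
    have e2 : Real.pi * (x - 1) / 2 = Real.pi * x / 2 - Real.pi / 2 := by ring
    rw [e1, exp_mul_I, ← ofReal_cos, ← ofReal_sin, ← ofReal_cos, ← ofReal_sin, e2,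
      Real.cos_sub_pi_div_two, Real.sin_sub_pi_div_two, Real.cos_two_mul, Real.sin_two_mul]
    have := Real.sin_sq_add_cos_sq (Real.pi * x / 2)
    set S := Real.sin (Real.pi * x / 2)
    set C := Real.cos (Real.pi * x / 2)
    have h3 : (S : ℂ) ^ 2 + (C : ℂ) ^ 2 = 1 := by exact_mod_cast this
    push_cast
    linear_combination (-2) * h3
  have hs : 0 < Real.sin (Real.pi * x / 2) :=
    Real.sin_pos_of_pos_of_lt_pi (by positivity) (by nlinarith)
  rw [logTerm, log_im, key, arg_mul_cos_add_sin_mul_I (by positivity)]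
  constructor <;> nlinarith

theorem logTerm_im_of_mem_Ioo_neg {x : ℝ} (h0 : -2 < x) (h2 : x < 0) :
    (logTerm x).im = Real.pi * (x + 1) / 2 := by
  rw [← logTerm_add_two]
  have := logTerm_im_of_mem_Ioo (x := x + 2) (by linarith) (by linarith)
  push_cast at this
  rw [this]; ring

theorem continuousAt_logTerm {s : ℂ} (hs : 0 ≤ s.im) (h1 : exp (I * Real.pi * s) ≠ 1) :
    ContinuousAt logTerm s := by
  have := hasDerivAt_logTerm (c := 0) (s := s) (by simpa) (by simpa)
  simpa using this.continuousAt

theorem exp_pi_ofReal_ne_one {x : ℝ} (h0 : x ≠ 0) (h1 : -2 < x) (h2 : x < 2) :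
    exp (I * Real.pi * x) ≠ 1 := by
  rw [Ne, exp_pi_eq_one_iff]
  rintro ⟨n, hn⟩
  have hn' : x = 2 * n := by exact_mod_cast hn
  have h3 : (-1 : ℝ) < n := by linarith
  have h4 : (n : ℝ) < 1 := by linarith
  have h5 : -1 < n := by exact_mod_cast h3
  have h6 : n < 1 := by exact_mod_cast h4
  have : n = 0 := by omega
  subst this; simp at hn'; exact h0 hn'

/-- The main relation, from an arc that joins the two sides of the strip. -/
theorem HasStripPoles.relation_of_arc {T k a b r x₀ x₁ : ℝ} {h F : ℂ → ℂ} (hT : 0 < T) (hb : b < 1)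
    (h0 : -b < x₀) (h0a : x₀ < a) (ha1 : a < x₁) (h1 : x₁ < b)
    (hh : HasStripPoles T ![-b, a, b] ![-(k + 1), r, k - 1] h)
    (hreal : ∀ x ∈ Ioo (-b) a, (h x).im = 0)
    (hF : ∀ s ∈ strip 0 T, HasDerivAt F (h s * F s) s)
    (hF0 : ∀ s ∈ strip 0 T, F s ≠ 0) (hF2 : ∀ s ∈ strip 0 T, F (s + 2) = F s)
    {γ v : ℝ → ℂ} {n : ℤ} {c' : ℂ} {q : ℝ} (hγ : ContinuousOn γ (Icc 0 1)) (hγ0 : γ 0 = x₀)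
    (hγ1 : γ 1 = x₁ + 2 * n + (1 + T * I)) (hγm : ∀ t ∈ Ioo (0 : ℝ) 1, γ t ∈ strip 0 T)
    (hγi : InjOn γ (Icc 0 1)) (hv : ContinuousOn v (Icc 0 1))
    (hγv : ∀ t ∈ Ioo (0 : ℝ) 1, HasDerivAt γ (v t) t) (hc' : c' ≠ 0)
    (hvF : ∀ t ∈ Ioo (0 : ℝ) 1, v t * F (γ t) = c') (hq : 0 < q) (hv1 : v 1 = q * v 0) :
    a + k * b = k := by
  have hp : ∀ i j (n : ℤ), (![-b, a, b] : Fin 3 → ℝ) i = (![-b, a, b] : Fin 3 → ℝ) j + 2 * n →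
      i = j := by
    have key : ∀ x y : ℝ, -1 < x → x < 1 → -1 < y → y < 1 → ∀ n : ℤ, x = y + 2 * n → x = y := by
      intro x y hx hx' hy hy' n hn
      have h3 : (-1 : ℝ) < n := by linarith
      have h4 : (n : ℝ) < 1 := by linarith
      have h5 : -1 < n := by exact_mod_cast h3
      have h6 : n < 1 := by exact_mod_cast h4
      have : n = 0 := by omega
      subst this; simpa using hn
    intro i j n hn
    have hm : ∀ i : Fin 3, -1 < (![-b, a, b] : Fin 3 → ℝ) i ∧ (![-b, a, b] : Fin 3 → ℝ) i < 1 := by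
      intro i; fin_cases i <;> simp <;> constructor <;> linarith
    have := key _ _ (hm i).1 (hm i).2 (hm j).1 (hm j).2 n hn
    fin_cases i <;> fin_cases j <;> simp at this ⊢ <;> linarith
  obtain ⟨hsum, R₀, c, hc, hR₀c, hR₀im, hR₀2, hFe, hPN⟩ := hh.exists_log hT hp (h0.trans h0a)
    (fun x hx => ⟨fun i m hm => by
      have hm' : x = (![-b, a, b] : Fin 3 → ℝ) i + 2 * m := by exact_mod_cast hm
      have hx1 := hx.1
      have hx2 := hx.2
      have h3 : (-1 : ℝ) < m ∧ (m : ℝ) < 1 ∧ (![-b, a, b] : Fin 3 → ℝ) i ≠ x := by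
        fin_cases i <;> simp at hm' ⊢ <;> refine ⟨?_, ?_, ?_⟩ <;> linarith
      have h5 : -1 < m := by exact_mod_cast h3.1
      have h6 : m < 1 := by exact_mod_cast h3.2.1
      have : m = 0 := by omega
      subst this
      exact h3.2.2 (by simpa using hm'.symm), hreal x hx⟩) hF hF0 hF2
  simp only [Fin.sum_univ_three, Matrix.cons_val_zero, Matrix.cons_val_one, Matrix.cons_val_two,
    Matrix.head_cons, Matrix.tail_cons] at hsum hFe hPN
  -- The residues `-(k+1)`, `r`, `k-1` add up to zero.
  have hr : r = 2 := by linarith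
  subst hr
  set A : ℂ → ℂ := fun s => R₀ s + ((-(k + 1) : ℝ) * logTerm (s - (-b : ℝ)) +
    (2 : ℝ) * logTerm (s - a) + (k - 1 : ℝ) * logTerm (s - b)) with hA
  set N : ℂ → ℂ := fun s => R₀ s + ((-(k + 1) : ℝ) * logTerm (-(s - (-b : ℝ))) +
    (2 : ℝ) * logTerm (-(s - a)) + (k - 1 : ℝ) * logTerm (-(s - b))) with hN
  have hAper : ∀ s ∈ strip (-T) T, ∀ n : ℤ, A (s + 2 * n) = A s := by
    intro s hs n
    -- `R₀` is known to be periodic only in the strip; the indicator makes the period global so that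
    -- integer multiples of it can be used.
    have h1 := add_two_int_of_add_two (h := (strip (-T) T).indicator A) (fun s => by
      by_cases hs : s ∈ strip (-T) T
      · rw [indicator_of_mem hs, indicator_of_mem (add_two_mem_strip hs)]
        simp only [hA, hR₀2 s hs]
        simp only [add_sub_right_comm, logTerm_add_two]
      · have hs' : s + 2 ∉ strip (-T) T := by
          intro h; apply hs; simpa [strip] using h
        rw [indicator_of_notMem hs, indicator_of_notMem hs']) n s
    have hs' : s + 2 * n ∈ strip (-T) T := by simpa [strip] using hs
    rwa [indicator_of_mem hs, indicator_of_mem hs'] at h1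
  -- A continuous logarithm of `F / c` along the arc. The endpoint lies on the line `Im s = T`,
  -- where nothing is known of `R₀`; there the value is taken from the lower side by means of `hPN`,
  -- after translation by the lattice vector `2 n + (1 + T i)`.
  set pt : ℝ → ℂ := fun t => if t = 1 then N x₁ else A (γ t) with hpt
  have hAc : ∀ s ∈ strip (-T) T, 0 ≤ s.im → (∀ y : ℝ, y = -b ∨ y = a ∨ y = b →
      exp (I * Real.pi * (s - y)) ≠ 1) → ContinuousAt A s := by
    intro s hs hs0 hne
    have hl : ∀ y : ℝ, y = -b ∨ y = a ∨ y = b → ContinuousAt (fun s => logTerm (s - y)) s :=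
      fun y hy => (hasDerivAt_logTerm (by simpa using hs0) (hne y hy)).continuousAt
    exact (hR₀c s hs).add (((continuousAt_const.mul (hl _ (by simp))).add
      (continuousAt_const.mul (hl _ (by simp)))).add (continuousAt_const.mul (hl _ (by simp))))
  have hx₀c : ContinuousAt A x₀ := by
    refine hAc _ (by simp [strip, hT]) (by simp) ?_
    intro y hy
    rw [← ofReal_sub]
    rcases hy with rfl | rfl | rfl <;>
      exact exp_pi_ofReal_ne_one (by intro; linarith) (by linarith) (by linarith)
  have hx₁c : ContinuousAt N x₁ := by
    have hl : ∀ y : ℝ, y = -b ∨ y = a ∨ y = b →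
        ContinuousAt (fun s : ℂ => logTerm (-(s - y))) x₁ := by
      intro y hy
      have h3 : ContinuousAt logTerm (-((x₁ : ℂ) - y)) := by
        have : -((x₁ : ℂ) - y) = ((y - x₁ : ℝ) : ℂ) := by push_cast; ring
        rw [this]
        refine continuousAt_logTerm (by simp) ?_
        rcases hy with rfl | rfl | rfl <;>
          exact exp_pi_ofReal_ne_one (by intro; linarith) (by linarith) (by linarith)
      exact ContinuousAt.comp (g := logTerm) (f := fun s : ℂ => -(s - y)) h3 (by fun_prop)
    exact (hR₀c _ (by simp [strip, hT])).add (((continuousAt_const.mul (hl _ (by simp))).add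
      (continuousAt_const.mul (hl _ (by simp)))).add (continuousAt_const.mul (hl _ (by simp))))
  have hptc : ContinuousOn pt (Icc 0 1) := by
    intro t ht
    rcases eq_or_lt_of_le ht.2 with rfl | ht1
    · have hend : (x₁ : ℂ) + 2 * n + (1 + T * I) - 2 * n - (1 + T * I) = x₁ := by ring
      have hsh : ContinuousWithinAt (fun t => γ t - 2 * n - (1 + T * I)) (Icc 0 1) 1 :=
        ((hγ 1 ht).sub continuousWithinAt_const).sub continuousWithinAt_const
      have h3 : ContinuousWithinAt (fun t => N (γ t - 2 * n - (1 + T * I))) (Icc 0 1) 1 := by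
        refine ContinuousAt.comp_continuousWithinAt (g := N) ?_ hsh
        rw [hγ1, hend]; exact hx₁c
      refine h3.congr_of_eventuallyEq ?_ (by simp only [hpt, hγ1, hend, if_true])
      have h4 : ∀ᶠ t in 𝓝[Icc 0 1] (1 : ℝ), 0 < t :=
        mem_nhdsWithin_of_mem_nhds (lt_mem_nhds one_pos)
      filter_upwards [self_mem_nhdsWithin, h4] with t ht ht0
      rcases eq_or_lt_of_le ht.2 with rfl | ht1
      · simp only [hpt, hγ1, hend, if_true]
      · have hm := hγm t ⟨ht0, ht1⟩
        have hm2 : γ t - 2 * n - (1 + T * I) ∈ strip (-T) 0 := by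
          simp only [strip, mem_ofPred_eq] at hm ⊢
          simp
          constructor <;> linarith [hm.1, hm.2]
        have e1 := hPN _ hm2
        have e2 : γ t - 2 * n - (1 + T * I) + (1 + T * I) = γ t + 2 * ((-n : ℤ) : ℂ) := by
          push_cast; ring
        rw [e2] at e1
        have e3 := hAper (γ t) ⟨by linarith [hm.1], hm.2⟩ (-n)
        simp only [hpt, ht1.ne, if_false]
        rw [← e3]
        exact e1
    · have h3 : ContinuousAt A (γ t) := by
        rcases eq_or_lt_of_le ht.1 with rfl | ht0
        · rw [hγ0]; exact hx₀c
        · have hm := hγm t ⟨ht0, ht1⟩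
          refine hAc _ ⟨by linarith [hm.1], hm.2⟩ hm.1.le fun y _ => ?_
          exact exp_pi_sub_ne_one (p := fun _ : Unit => y)
            (fun i n => ne_of_im_ne_zero (p := fun _ : Unit => y) hm.1.ne' i n) ()
      refine (h3.comp_continuousWithinAt (hγ t ht)).congr_of_eventuallyEq ?_ (by simp [hpt, ht1.ne])
      filter_upwards [mem_nhdsWithin_of_mem_nhds (gt_mem_nhds ht1)] with u hu
      simp [hpt, hu.ne]
  -- Since `v * F ∘ γ = c'`, a logarithm of `F` along the arc gives one of the velocity.
  set l : ℝ → ℂ := fun t => log (c' / c) - pt t with hl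
  have hlc : ContinuousOn l (Icc 0 1) := continuousOn_const.sub hptc
  have hlv : ∀ t ∈ Icc (0 : ℝ) 1, exp (l t) = v t := by
    have h3 : EqOn (fun t => exp (l t)) v (Ioo 0 1) := by
      intro t ht
      have hm := hγm t ht
      have e1 := hvF t ht
      have e2 := hFe _ hm
      have e3 : pt t = A (γ t) := by simp [hpt, ht.2.ne]
      simp only [hl, exp_sub, exp_log (div_ne_zero hc' hc), e3]
      rw [div_eq_iff (exp_ne_zero _), div_eq_iff hc, ← e1, e2]
      simp only [hA]; ring
    exact h3.of_subset_closure hlc.cexp hv Ioo_subset_Icc_self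
      (by rw [closure_Ioo (by norm_num)])
  have hlow : ∀ t ∈ Ioc (0 : ℝ) 1, (γ 0).im < (γ t).im := by
    intro t ht
    rw [hγ0, ofReal_im]
    rcases eq_or_lt_of_le ht.2 with rfl | ht1
    · rw [hγ1]; simpa using hT
    · exact (hγm t ⟨ht.1, ht1⟩).1
  have hhigh : ∀ t ∈ Ico (0 : ℝ) 1, (γ t).im < (γ 1).im := by
    intro t ht
    have e : (γ 1).im = T := by rw [hγ1]; simp
    rw [e]
    rcases eq_or_lt_of_le ht.1 with rfl | ht1
    · rw [hγ0]; simpa using hT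
    · exact (hγm t ⟨ht1, ht.2⟩).2
  have hturn := abs_turning_le hγ hv hγv hγi hlow hhigh hlc hlv
  -- The end velocities have a positive ratio, so the turning is a multiple of `2 π`; being at most
  -- `π` in absolute value, it is zero.
  have hdl : (l 1).im - (l 0).im = 0 := by
    have e1 : exp (l 1 - l 0) = q := by
      rw [exp_sub, hlv 1 (by simp), hlv 0 (by simp), hv1, mul_div_assoc, div_self, mul_one]
      rw [← hlv 0 (by simp)]; exact exp_ne_zero _
    have e2 : exp (l 1 - l 0) = exp (Real.log q : ℝ) := by
      rw [e1, ← ofReal_exp, Real.exp_log hq]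
    obtain ⟨m, hm⟩ := exp_eq_exp_iff_exists_int.1 e2
    have e3 := congrArg Complex.im hm
    simp at e3
    rw [e3] at hturn ⊢
    have hpi := Real.pi_pos
    have hm1 : |(m : ℝ)| < 1 := by
      rw [abs_mul, abs_of_pos (by positivity : (0 : ℝ) < 2 * Real.pi)] at hturn
      by_contra hcon
      nlinarith [not_lt.1 hcon]
    have : m = 0 := by
      have : |m| < 1 := by exact_mod_cast hm1
      exact Int.abs_lt_one_iff.1 this
    simp [this]
  have hp0 : pt 0 = A x₀ := by simp [hpt, hγ0]
  have hp1 : pt 1 = N x₁ := by simp [hpt]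
  have him : (A x₀).im = (N x₁).im := by
    rw [← hp0, ← hp1]
    simp only [hl, sub_im] at hdl
    linarith
  -- The constant imaginary part of `R₀` cancels. What remains are arguments of `1 - exp (π i x)` at
  -- real points, linear in `x`; `x₀` and `x₁` drop out because the residues have sum zero.
  simp only [hA, hN, add_im, im_ofReal_mul, hR₀im] at him
  have ex : ∀ x y : ℝ, (x : ℂ) - y = ((x - y : ℝ) : ℂ) := fun x y => by push_cast; ring
  have ex' : ∀ x y : ℝ, -((x : ℂ) - y) = ((y - x : ℝ) : ℂ) := fun x y => by push_cast; ring
  rw [ex', ex', ex', ex, ex, ex, logTerm_im_of_mem_Ioo (by linarith) (by linarith),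
    logTerm_im_of_mem_Ioo_neg (x := x₀ - a) (by linarith) (by linarith),
    logTerm_im_of_mem_Ioo_neg (x := x₀ - b) (by linarith) (by linarith),
    logTerm_im_of_mem_Ioo_neg (x := -b - x₁) (by linarith) (by linarith),
    logTerm_im_of_mem_Ioo_neg (x := a - x₁) (by linarith) (by linarith),
    logTerm_im_of_mem_Ioo (x := b - x₁) (by linarith) (by linarith)] at him
  have : 2 * Real.pi * (a + k * b - k) = 0 := by linear_combination -him
  have h7 := (mul_eq_zero.1 this).resolve_left (by positivity)
  linarith

/-! ### The slit model: the functions `exp (2 π i ζ)` and `z`, the cut and the charts -/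

section
variable {k d : ℝ}

theorem re_pos_of_im_lt {ζ : ℂ} (hζ : ζ.im < d) : 0 < ((d : ℂ) + I * ζ).re := by
  simp; linarith

theorem base_ne_zero {ζ : ℂ} (hζ : ζ.im < d) : (d : ℂ) + I * ζ ≠ 0 := fun h => by
  have := re_pos_of_im_lt hζ
  rw [h] at this; simp at this

/-- For `Im ζ < d` the base `d + i ζ` lies in the right half-plane. As `k > 1/2`, dividing its
argument by `k` keeps it in `(-π, π)`, so the principal logarithm of the power is the expected
multiple. -/
theorem log_coneCoord (hk : 1 / 2 < k) {ζ : ℂ} (hζ : ζ.im < d) :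
    log (coneCoord k d ζ) = log (d + I * ζ) * (k : ℂ)⁻¹ ∧
      |arg (coneCoord k d ζ)| = |arg (d + I * ζ)| * k⁻¹ ∧ k * |arg (coneCoord k d ζ)| < Real.pi / 2 := by
  have hk0 : (0 : ℝ) < k := by linarith
  have harg := Complex.abs_arg_lt_pi_div_two_iff.2 (Or.inl (re_pos_of_im_lt hζ))
  have him : (log ((d : ℂ) + I * ζ) * (k : ℂ)⁻¹).im = arg ((d : ℂ) + I * ζ) * k⁻¹ := by
    rw [← ofReal_inv, im_mul_ofReal, log_im]
  have hinv0 : 0 < k⁻¹ := inv_pos.2 hk0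
  have hinv : k⁻¹ < 2 := by
    rw [inv_lt_comm₀ hk0 (by norm_num)]; linarith
  have habs : |arg ((d : ℂ) + I * ζ) * k⁻¹| < Real.pi := by
    rw [abs_mul, abs_of_pos hinv0]
    nlinarith [Real.pi_pos, abs_nonneg (arg ((d : ℂ) + I * ζ))]
  have h1 : log (coneCoord k d ζ) = log (d + I * ζ) * (k : ℂ)⁻¹ := by
    rw [coneCoord, cpow_def_of_ne_zero (base_ne_zero hζ),
      log_exp (by rw [him]; exact (abs_lt.1 habs).1) (by rw [him]; exact (abs_lt.1 habs).2.le)]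
  have h2 : |arg (coneCoord k d ζ)| = |arg (d + I * ζ)| * k⁻¹ := by
    rw [← log_im, h1, him, abs_mul, abs_of_pos hinv0]
  refine ⟨h1, h2, ?_⟩
  rw [h2]
  have : k * (|arg (d + I * ζ)| * k⁻¹) = |arg (d + I * ζ)| := by field_simp
  rwa [this]

theorem coneCoord_ne_zero {ζ : ℂ} (hζ : ζ.im < d) : coneCoord k d ζ ≠ 0 := by
  simp [coneCoord, cpow_eq_zero_iff, base_ne_zero hζ]

theorem coneCoord_mem_slitPlane (hk : 1 / 2 < k) {ζ : ℂ} (hζ : ζ.im < d) :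
    coneCoord k d ζ ∈ slitPlane := by
  rw [mem_slitPlane_iff_arg]
  refine ⟨fun h => ?_, coneCoord_ne_zero hζ⟩
  have := (log_coneCoord hk hζ).2.2
  rw [h, abs_of_pos Real.pi_pos] at this
  nlinarith [Real.pi_pos]

theorem coneCoord_mem_lowerSheet_iff (hk : 1 / 2 < k) {ζ : ℂ} (hζ : ζ.im < d) :
    coneCoord k d ζ ∈ lowerSheet k d ↔ ζ.im < 0 := by
  simp only [lowerSheet, mem_ofPred_eq, dev_coneCoord hk hζ, (log_coneCoord hk hζ).2.2, true_and]

theorem coneCoord_dev (hk : 1 / 2 < k) {z : ℂ} (hz : k * |arg z| < Real.pi / 2) :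
    coneCoord k d (dev k d z) = z := by
  have hk0 : (0 : ℝ) < k := by linarith
  have hkc : (k : ℂ) ≠ 0 := by exact_mod_cast hk0.ne'
  have him : (log z * (k : ℂ)).im = arg z * k := by rw [im_mul_ofReal, log_im]
  have hlt : |arg z * k| < Real.pi := by
    rw [abs_mul, abs_of_pos hk0, mul_comm]; linarith [Real.pi_pos]
  have h1 : (d : ℂ) + I * dev k d z = z ^ (k : ℂ) := by
    rw [dev]; linear_combination (d - z ^ (k : ℂ)) * I_mul_I
  rw [coneCoord, h1, ← cpow_mul _ (by rw [him]; exact (abs_lt.1 hlt).1)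
    (by rw [him]; exact (abs_lt.1 hlt).2.le), mul_inv_cancel₀ hkc, cpow_one]

theorem zero_notMem_lowerSheet (hk : 1 / 2 < k) (hd : 0 < d) : (0 : ℂ) ∉ lowerSheet k d := by
  have := zero_mem_upperPiece hk hd
  exact this 0 rfl

theorem dev_zero (hk : 1 / 2 < k) : dev k d 0 = d * I := by
  have hk' : (k : ℂ) ≠ 0 := by
    have : k ≠ 0 := by linarith
    exact_mod_cast this
  simp [dev, zero_cpow hk']

theorem coneCoord_dev_of_mem (hk : 1 / 2 < k) {z : ℂ} (hz : z ∈ lowerSheet k d) :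
    coneCoord k d (dev k d z) = z :=
  coneCoord_dev hk hz.1

theorem slitArc_subset (hk : 1 / 2 < k) (hd : 0 < d) : slitArc k d ⊆ slitPlane := by
  rintro z ⟨x, -, rfl⟩
  exact coneCoord_mem_slitPlane hk (by simpa using hd)

theorem ofReal_notMem_slitPlane {x : ℝ} (hx : x ≤ 0) : (x : ℂ) ∉ slitPlane := by
  rw [ofReal_mem_slitPlane]; exact not_lt.2 hx

theorem notMem_lowerSheet_of_notMem_slitPlane (hk : 1 / 2 < k) (hd : 0 < d) {z : ℂ}
    (hz : z ∉ slitPlane) : z ∉ lowerSheet k d := by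
  intro h
  rw [mem_slitPlane_iff_arg, not_and_or, not_not, not_not] at hz
  rcases hz with hz | rfl
  · have := h.1
    rw [hz, abs_of_pos Real.pi_pos] at this
    nlinarith [Real.pi_pos]
  · exact zero_notMem_lowerSheet hk hd h

theorem notMem_slitPlane_iff {z : ℂ} : z ∉ slitPlane ↔ ∃ x : ℝ, x ≤ 0 ∧ z = x := by
  constructor
  · intro h
    rw [mem_slitPlane_iff, not_or, not_lt, not_not] at h
    exact ⟨z.re, h.1, Complex.ext rfl (by simpa using h.2)⟩
  · rintro ⟨x, hx, rfl⟩
    exact ofReal_notMem_slitPlane hx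

/-- The single valued function `exp (2 π i ζ)` on the slit model. -/
noncomputable def flatExp (hk : 1 / 2 < k) (hd : 0 < d) : SlitTorus k d → ℂ :=
  Quot.lift (Sum.elim (fun p => p.1.elim 0 fun z => exp (2 * Real.pi * I * dev k d z))
    (fun p => p.1.elim 0 fun ζ => exp (2 * Real.pi * I * ζ))) (by
      rintro _ _ (_ | ⟨x, y, hxy, hx, hy⟩)
      · rfl
      · change exp (2 * Real.pi * I * dev k d (coneCoord k d x)) = exp (2 * Real.pi * I * y)
        rw [dev_coneCoord hk (by simpa using hd)]
        rcases hxy with ⟨_, rfl⟩ | ⟨_, _, rfl⟩ | ⟨_, _, rfl⟩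
        · rfl
        · rw [exp_eq_exp_iff_exists_int]; exact ⟨-1, by push_cast; ring⟩
        · rw [exp_eq_exp_iff_exists_int]; exact ⟨1, by push_cast; ring⟩)

open Classical in
/-- The coordinate `z` on the slit model, with the slit collapsed to a point. -/
noncomputable def coneVal (k d : ℝ) : SlitTorus k d → OnePoint ℂ :=
  Quot.lift (Sum.elim
    (fun p => p.1.elim OnePoint.infty fun z => ((if z ∈ slitArc k d then coneCoord k d 0 else z : ℂ)))
    (fun p => p.1.elim OnePoint.infty fun ζ =>
      ((if coneCoord k d ζ ∈ slitArc k d then coneCoord k d 0 else coneCoord k d ζ : ℂ)))) (by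
      rintro _ _ (_ | ⟨x, y, hxy, hx, hy⟩)
      · rfl
      · change ((if coneCoord k d x ∈ slitArc k d then coneCoord k d 0 else coneCoord k d x : ℂ) : OnePoint ℂ) =
          ((if coneCoord k d y ∈ slitArc k d then coneCoord k d 0 else coneCoord k d y : ℂ) : OnePoint ℂ)
        rcases hxy with ⟨_, rfl⟩ | ⟨h1, h2, rfl⟩ | ⟨h1, h2, rfl⟩
        · rfl
        · rw [if_pos ⟨x, abs_le.2 ⟨by linarith, by linarith⟩, rfl⟩,
            if_pos ⟨x + 1, abs_le.2 ⟨by linarith, by linarith⟩, rfl⟩]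
        · rw [if_pos ⟨x, abs_le.2 ⟨by linarith, by linarith⟩, rfl⟩,
            if_pos ⟨x - 1, abs_le.2 ⟨by linarith, by linarith⟩, rfl⟩])

section
variable (hk : 1 / 2 < k) (hd : 0 < d)

theorem flatExp_upper {z : ℂ} (h : (z : OnePoint ℂ) ∈ UpperPiece k d) :
    flatExp hk hd (upper _ h) = exp (2 * Real.pi * I * dev k d z) := rfl

theorem flatExp_lower {ζ : ℂ} (h : (ζ : OnePoint ℂ) ∈ LowerPiece) :
    flatExp hk hd (lower k d _ h) = exp (2 * Real.pi * I * ζ) := rfl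

theorem flatExp_coneChart (z : ℂ) :
    flatExp hk hd (coneChart k d z) = exp (2 * Real.pi * I * dev k d z) := by
  unfold coneChart
  split_ifs with h
  · rfl
  · rfl

theorem flatExp_edgeChart (n : ℤ) (ξ : ℂ) (hξ : ξ.im < d) :
    flatExp hk hd (edgeChart hk n ξ hξ) = exp (2 * Real.pi * I * ξ) := by
  unfold edgeChart
  split_ifs with h
  · rw [flatExp_upper, dev_coneCoord hk hξ]
  · rw [flatExp_lower, exp_eq_exp_iff_exists_int]
    exact ⟨n, by push_cast; ring⟩

theorem coneVal_e₁ : coneVal k d (e₁ k d) = OnePoint.infty := rfl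

open Classical in
theorem coneVal_upper {z : ℂ} (h : (z : OnePoint ℂ) ∈ UpperPiece k d) :
    coneVal k d (upper _ h) = (if z ∈ slitArc k d then coneCoord k d 0 else z : ℂ) := rfl

open Classical in
theorem coneVal_lower {ζ : ℂ} (h : (ζ : OnePoint ℂ) ∈ LowerPiece) :
    coneVal k d (lower k d _ h) =
      (if coneCoord k d ζ ∈ slitArc k d then coneCoord k d 0 else coneCoord k d ζ : ℂ) := rfl

include hk in
theorem coneVal_coneChart {z : ℂ} (hz : z ∉ slitArc k d) :
    coneVal k d (coneChart k d z) = z := by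
  unfold coneChart
  split_ifs with h
  · rw [coneVal_lower, coneCoord_dev_of_mem hk h, if_neg hz]
  · rw [coneVal_upper, if_neg hz]

theorem lower_infty : lower k d _ infty_mem_lowerPiece = e₁ k d :=
  (Quot.sound (Glue.infty)).symm

theorem glue_eq {x y : ℝ} (hxy : SlitMatch x y) :
    upper (coneCoord k d x : OnePoint ℂ) (coneCoord_mem_upperPiece hk (by simp) (by simpa using hd)) =
      lower k d ((y : ℂ) : OnePoint ℂ) (mem_lowerPiece (by simp)) :=
  Quot.sound (Glue.real x y hxy _ _)

@[elab_as_elim]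
theorem slitTorus_cases {motive : SlitTorus k d → Prop} (p : SlitTorus k d)
    (infty : motive (e₁ k d))
    (upper : ∀ (z : ℂ) (h : (z : OnePoint ℂ) ∈ UpperPiece k d), motive (upper _ h))
    (lower : ∀ (ζ : ℂ) (h : (ζ : OnePoint ℂ) ∈ LowerPiece), motive (lower k d _ h)) : motive p := by
  induction p using Quot.ind with
  | mk p =>
    rcases p with ⟨p, hp⟩ | ⟨p, hp⟩
    · induction p with
      | infty => exact infty
      | coe z => exact upper z hp
    · induction p with
      | infty => rw [← lower_infty] at infty; exact infty
      | coe z => exact lower z hp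

theorem im_le_of_mem_lowerPiece {ζ : ℂ} (h : (ζ : OnePoint ℂ) ∈ LowerPiece) : ζ.im ≤ 0 := h ζ rfl

include hk hd in
-- `coneVal` respects the gluing, so it detects the cut on any representative. The slit and the
-- lower half-plane have `z` in `slitPlane`, so collapsing the slit creates no confusion with the
-- cut.
theorem mem_cutRay_iff (p : SlitTorus k d) : p ∈ cutRay k d ↔
    coneVal k d p = OnePoint.infty ∨ ∃ x : ℝ, x ≤ 0 ∧ coneVal k d p = (x : ℂ) := by
  constructor
  · rintro (rfl | ⟨x, h, hx, rfl⟩)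
    · exact Or.inl rfl
    · refine Or.inr ⟨x, hx, ?_⟩
      rw [coneVal_upper, if_neg]
      exact fun h => ofReal_notMem_slitPlane hx (slitArc_subset hk hd h)
  · induction p using slitTorus_cases with
    | infty => exact fun _ => Or.inl rfl
    | upper z h =>
      rw [coneVal_upper]
      rintro (h1 | ⟨x, hx, h1⟩)
      · exact absurd h1 (OnePoint.coe_ne_infty _)
      · have h2 := OnePoint.coe_injective h1
        split_ifs at h2 with h3
        · exact absurd (h2 ▸ coneCoord_mem_slitPlane hk (ζ := 0) (by simpa using hd))
            (ofReal_notMem_slitPlane hx)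
        · subst h2
          exact Or.inr ⟨x, h, hx, rfl⟩
    | lower ζ h =>
      rw [coneVal_lower]
      have hζ := im_le_of_mem_lowerPiece h
      rintro (h1 | ⟨x, hx, h1⟩)
      · exact absurd h1 (OnePoint.coe_ne_infty _)
      · have h2 := OnePoint.coe_injective h1
        split_ifs at h2 with h3
        · exact absurd (h2 ▸ coneCoord_mem_slitPlane hk (ζ := 0) (by simpa using hd))
            (ofReal_notMem_slitPlane hx)
        · exact absurd (h2 ▸ coneCoord_mem_slitPlane hk (ζ := ζ) (by linarith))
            (ofReal_notMem_slitPlane hx)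

include hk hd in
theorem upper_mem_cutRay_iff {z : ℂ} (h : (z : OnePoint ℂ) ∈ UpperPiece k d) :
    upper _ h ∈ cutRay k d ↔ z ∉ slitPlane := by
  constructor
  · intro hc
    rcases (mem_cutRay_iff hk hd _).1 hc with h1 | ⟨x, hx, h1⟩
    · exact absurd h1 (OnePoint.coe_ne_infty _)
    · rw [coneVal_upper] at h1
      have h2 := OnePoint.coe_injective h1
      split_ifs at h2 with h3
      · exact absurd (h2 ▸ coneCoord_mem_slitPlane hk (ζ := 0) (by simpa using hd))
            (ofReal_notMem_slitPlane hx)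
      · rw [h2]; exact ofReal_notMem_slitPlane hx
  · intro hz
    obtain ⟨x, hx, rfl⟩ := notMem_slitPlane_iff.1 hz
    exact Or.inr ⟨x, h, hx, rfl⟩

include hk hd in
theorem lower_notMem_cutRay {ζ : ℂ} (h : (ζ : OnePoint ℂ) ∈ LowerPiece) :
    lower k d _ h ∉ cutRay k d := by
  intro hc
  have hζ := im_le_of_mem_lowerPiece h
  rcases (mem_cutRay_iff hk hd _).1 hc with h1 | ⟨x, hx, h1⟩
  · exact absurd h1 (OnePoint.coe_ne_infty _)
  · rw [coneVal_lower] at h1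
    have h2 := OnePoint.coe_injective h1
    split_ifs at h2 with h3
    · exact absurd (h2 ▸ coneCoord_mem_slitPlane hk (ζ := 0) (by simpa using hd))
          (ofReal_notMem_slitPlane hx)
    · exact absurd (h2 ▸ coneCoord_mem_slitPlane hk (ζ := ζ) (by linarith))
            (ofReal_notMem_slitPlane hx)

include hk hd in
theorem coneChart_mem_cutRay_iff (z : ℂ) : coneChart k d z ∈ cutRay k d ↔ z ∉ slitPlane := by
  unfold coneChart
  split_ifs with h
  · refine iff_of_false (lower_notMem_cutRay hk hd _) fun hz => ?_
    exact notMem_lowerSheet_of_notMem_slitPlane hk hd hz h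
  · exact upper_mem_cutRay_iff hk hd _

include hd in
theorem edgeChart_notMem_cutRay (c : ℝ) (ξ : ℂ) (hξ : ξ.im < d) :
    edgeChart hk c ξ hξ ∉ cutRay k d := by
  unfold edgeChart
  split_ifs with h
  · rw [upper_mem_cutRay_iff hk hd, not_not]
    exact coneCoord_mem_slitPlane hk hξ
  · exact lower_notMem_cutRay hk hd _

theorem v₂_notMem_cutRay : v₂ hk hd ∉ cutRay k d := by
  rw [v₂, upper_mem_cutRay_iff hk hd, not_not]
  exact coneCoord_mem_slitPlane hk (by simpa using hd)

/-- The two sides of `0` are not glued directly but through a chain: lower `0`, upper `1`, lower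
`1`, upper `0`. -/
theorem lower_zero : lower k d ((0 : ℂ) : OnePoint ℂ) (mem_lowerPiece (by simp)) = v₂ hk hd := by
  have h1 := glue_eq hk hd (x := 1) (y := 0) (Or.inr (Or.inr ⟨by norm_num, by norm_num, by norm_num⟩))
  have h2 := glue_eq hk hd (x := 1) (y := 1) (Or.inl ⟨by norm_num, rfl⟩)
  have h3 := glue_eq hk hd (x := 0) (y := 1) (Or.inr (Or.inl ⟨by norm_num, by norm_num, by norm_num⟩))
  simp only [ofReal_zero] at h1 h3
  rw [← h1, h2, ← h3]
  rfl

theorem upper_slit_eq_v₂ {x : ℝ} (hx : x = -1 ∨ x = 0 ∨ x = 1) :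
    upper (coneCoord k d x : OnePoint ℂ) (coneCoord_mem_upperPiece hk (by simp) (by simpa using hd)) =
      v₂ hk hd := by
  rcases hx with rfl | rfl | rfl
  · have := glue_eq hk hd (x := -1) (y := 0) (Or.inr (Or.inl ⟨by norm_num, by norm_num, by norm_num⟩))
    simp only [ofReal_zero] at this
    rw [this, lower_zero hk hd]
  · simp only [ofReal_zero]; rfl
  · have := glue_eq hk hd (x := 1) (y := 0) (Or.inr (Or.inr ⟨by norm_num, by norm_num, by norm_num⟩))
    simp only [ofReal_zero] at this
    rw [this, lower_zero hk hd]

/-- The coordinate charts cover the slit model minus `e₁` and `v₂`. -/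
theorem chart_cases (p : SlitTorus k d) : p = e₁ k d ∨ p = v₂ hk hd ∨
    (∃ z, z ∉ slitArc k d ∧ p = coneChart k d z) ∨
    (∃ x : ℝ, ∃ h : (x : ℂ).im < d, -1 < x ∧ x < 0 ∧ p = edgeChart hk 1 x h) ∨
    (∃ x : ℝ, ∃ h : (x : ℂ).im < d, 0 < x ∧ x < 1 ∧ p = edgeChart hk (-1) x h) := by
  have hup : ∀ (z : ℂ) (h : (z : OnePoint ℂ) ∈ UpperPiece k d), upper _ h = v₂ hk hd ∨
      (∃ w, w ∉ slitArc k d ∧ upper _ h = coneChart k d w) ∨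
      (∃ x : ℝ, ∃ h' : (x : ℂ).im < d, -1 < x ∧ x < 0 ∧ upper _ h = edgeChart hk 1 x h') ∨
      (∃ x : ℝ, ∃ h' : (x : ℂ).im < d, 0 < x ∧ x < 1 ∧ upper _ h = edgeChart hk (-1) x h') := by
    intro z h
    by_cases hz : z ∈ slitArc k d
    · obtain ⟨x, hx, rfl⟩ := hz
      have hxd : (x : ℂ).im < d := by simpa using hd
      rw [abs_le] at hx
      rcases eq_or_lt_of_le hx.1 with h1 | h1
      · exact Or.inl (upper_slit_eq_v₂ hk hd (Or.inl h1.symm))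
      rcases eq_or_lt_of_le hx.2 with h2 | h2
      · exact Or.inl (upper_slit_eq_v₂ hk hd (Or.inr (Or.inr h2)))
      rcases lt_trichotomy x 0 with h3 | h3 | h3
      · exact Or.inr (Or.inr (Or.inl ⟨x, hxd, h1, h3, by rw [edgeChart, dif_pos (by simp)]⟩))
      · exact Or.inl (upper_slit_eq_v₂ hk hd (Or.inr (Or.inl h3)))
      · exact Or.inr (Or.inr (Or.inr ⟨x, hxd, h3, h2, by rw [edgeChart, dif_pos (by simp)]⟩))
    · exact Or.inr (Or.inl ⟨z, hz, by rw [coneChart, dif_neg (h z rfl)]⟩)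
  induction p using slitTorus_cases with
  | infty => exact Or.inl rfl
  | upper z h => exact Or.inr (hup z h)
  | lower ζ h =>
    refine Or.inr ?_
    have hζ := im_le_of_mem_lowerPiece h
    rcases eq_or_lt_of_le hζ with h0 | h0
    · obtain ⟨y, rfl⟩ : ∃ y : ℝ, ζ = y := ⟨ζ.re, Complex.ext rfl (by simpa using h0)⟩
      obtain ⟨x, hxy⟩ : ∃ x, SlitMatch x y := by
        rcases le_total 1 |y| with h1 | h1
        · exact ⟨y, Or.inl ⟨h1, rfl⟩⟩
        · rw [abs_le] at h1
          rcases le_total 0 y with h2 | h2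
          · exact ⟨y - 1, Or.inr (Or.inl ⟨by linarith, by linarith, by ring⟩)⟩
          · exact ⟨y + 1, Or.inr (Or.inr ⟨by linarith, by linarith, by ring⟩)⟩
      rw [← glue_eq hk hd hxy]
      exact hup _ _
    · refine Or.inr (Or.inl ⟨coneCoord k d ζ, ?_, ?_⟩)
      · rintro ⟨x, -, hx⟩
        have h1 := congrArg (dev k d) hx
        rw [dev_coneCoord hk (by linarith), dev_coneCoord hk (by simpa using hd)] at h1
        rw [h1] at h0; simp at h0
      · rw [coneChart, dif_pos ((coneCoord_mem_lowerSheet_iff hk (by linarith)).2 h0)]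
        simp only [dev_coneCoord hk (show ζ.im < d by linarith)]

include hd in
/-- Points of the imaginary axis off the cut are determined by the imaginary part of `ζ`. -/
theorem exists_of_mem_imaginaryAxis {p : SlitTorus k d} (hp : p ∈ imaginaryAxis k d)
    (hc : p ∉ cutRay k d) : ∃ η : ℝ, ∃ h : ((η : ℂ) * I).im < d, p = edgeChart hk 0 (η * I) h := by
  rcases hp with (rfl | ⟨x, h, rfl⟩) | ⟨η, h, rfl⟩
  · exact absurd (Or.inl rfl) hc
  · rw [upper_mem_cutRay_iff hk hd, not_not, ofReal_mem_slitPlane] at hc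
    have harg : arg (x : ℂ) = 0 := arg_ofReal_of_nonneg hc.le
    have hdev : dev k d x = ((d - x ^ k : ℝ) : ℂ) * I := by
      rw [dev, ← ofReal_cpow hc.le]; push_cast; ring
    have hco := coneCoord_dev (d := d) hk (by rw [harg]; simp; positivity)
    rw [hdev] at hco
    have h1 : (((d - x ^ k : ℝ) : ℂ) * I).im < d := by
      have := Real.rpow_pos_of_pos hc k
      simp; linarith
    refine ⟨d - x ^ k, h1, ?_⟩
    have h2 : 0 ≤ (((d - x ^ k : ℝ) : ℂ) * I).im := by
      by_contra hcon
      refine h x rfl ⟨by rw [harg]; simp; positivity, ?_⟩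
      rw [hdev]; exact not_le.1 hcon
    rw [edgeChart, dif_pos h2]
    simp only [hco]
  · have hη : η ≤ 0 := by simpa using im_le_of_mem_lowerPiece h
    refine ⟨η, by simp; linarith, ?_⟩
    rcases eq_or_lt_of_le hη with rfl | h0
    · rw [edgeChart, dif_pos (by simp)]
      have := lower_zero hk hd
      simp only [ofReal_zero, zero_mul]
      rw [this]; rfl
    · rw [edgeChart, dif_neg (by simpa using h0)]
      simp

theorem mem_imaginaryAxis_edgeChart {η : ℝ} (h : ((η : ℂ) * I).im < d) :
    edgeChart hk 0 (η * I) h ∈ imaginaryAxis k d := by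
  unfold edgeChart
  split_ifs with h0
  · have h1 : (d : ℂ) + I * (η * I) = ((d - η : ℝ) : ℂ) := by
      push_cast; linear_combination (η : ℂ) * I_mul_I
    have h2 : coneCoord k d (η * I) = (((d - η) ^ k⁻¹ : ℝ) : ℂ) := by
      have : η < d := by simpa using h
      rw [coneCoord, h1, ← ofReal_inv, ← ofReal_cpow (by linarith)]
    refine Or.inl (Or.inr ⟨(d - η) ^ k⁻¹, ?_, ?_⟩)
    · rw [← h2]; exact coneCoord_mem_upperPiece hk h0 h
    · simp only [h2]
  · refine Or.inr ⟨η, ?_, ?_⟩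
    · exact mem_lowerPiece (not_le.1 h0).le
    · simp

end

end

/-! ### Topology of the slit model -/

section
variable {k d : ℝ}

theorem isOpen_slitTorus_iff {U : Set (SlitTorus k d)} : IsOpen U ↔
    IsOpen {p : UpperPiece k d | upper p.1 p.2 ∈ U} ∧ IsOpen {p : LowerPiece | lower k d p.1 p.2 ∈ U} := by
  have h1 : IsOpen U ↔ IsOpen ((Quot.mk (Glue k d)) ⁻¹' U) := isOpen_coinduced
  rw [h1, isOpen_sum_iff]
  rfl

theorem continuous_upper : Continuous fun p : UpperPiece k d => upper p.1 p.2 :=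
  (continuous_quot_mk (r := Glue k d)).comp continuous_inl

theorem continuous_lower : Continuous fun p : LowerPiece => lower k d p.1 p.2 :=
  (continuous_quot_mk (r := Glue k d)).comp continuous_inr

theorem continuousOn_dev : ContinuousOn (dev k d) slitPlane := by
  intro z hz
  have : ContinuousAt (fun z : ℂ => z ^ (k : ℂ)) z := continuousAt_id.cpow continuousAt_const hz
  exact (continuousAt_const.sub (continuousAt_const.mul this)).continuousWithinAt

/-- The cut is the branch cut of `z ^ k` together with `∞`, so off it the function is continuous on
each closed piece and hence on the quotient. This includes `v₂`, where no chart is available. -/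
theorem continuousOn_flatExp (hk : 1 / 2 < k) (hd : 0 < d) :
    IsOpen (cutRay k d)ᶜ ∧ ContinuousOn (flatExp hk hd) (cutRay k d)ᶜ := by
  have key : ∀ V : Set ℂ, IsOpen V → IsOpen ((cutRay k d)ᶜ ∩ flatExp hk hd ⁻¹' V) := by
    intro V hV
    rw [isOpen_slitTorus_iff]
    constructor
    · have h1 : IsOpen (slitPlane ∩ (fun z => exp (2 * Real.pi * I * dev k d z)) ⁻¹' V) := by
        refine ContinuousOn.isOpen_inter_preimage ?_ isOpen_slitPlane hV
        exact ((continuousOn_const.mul (continuousOn_dev)).cexp)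
      have h2 := (OnePoint.isOpen_image_coe.2 h1).preimage
        (continuous_subtype_val (p := (· ∈ UpperPiece k d)))
      convert! h2 using 1
      ext ⟨p, hp⟩
      induction p with
      | infty =>
        refine iff_of_false (fun h => h.1 (Or.inl rfl)) ?_
        rintro ⟨z, -, hz⟩
        exact OnePoint.coe_ne_infty _ hz
      | coe z =>
        have e1 := upper_mem_cutRay_iff hk hd hp
        constructor
        · rintro ⟨h3, h4⟩
          exact ⟨z, ⟨not_not.1 (fun h => h3 (e1.2 h)), h4⟩, rfl⟩
        · rintro ⟨w, ⟨h3, h4⟩, h5⟩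
          have h6 := OnePoint.coe_injective h5
          subst h6
          exact ⟨fun h => e1.1 h h3, h4⟩
    · have h1 : IsOpen ((fun z => exp (2 * Real.pi * I * z)) ⁻¹' V) := hV.preimage (by fun_prop)
      have h2 := (OnePoint.isOpen_image_coe.2 h1).preimage
        (continuous_subtype_val (p := (· ∈ LowerPiece)))
      convert! h2 using 1
      ext ⟨p, hp⟩
      induction p with
      | infty =>
        refine iff_of_false (fun h => h.1 ?_) ?_
        · exact Or.inl lower_infty
        · rintro ⟨z, -, hz⟩
          exact OnePoint.coe_ne_infty _ hz
      | coe z =>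
        constructor
        · rintro ⟨h3, h4⟩
          exact ⟨z, h4, rfl⟩
        · rintro ⟨w, h4, h5⟩
          have h6 := OnePoint.coe_injective h5
          subst h6
          exact ⟨lower_notMem_cutRay hk hd _, h4⟩
  have hopen : IsOpen (cutRay k d)ᶜ := by simpa using key univ isOpen_univ
  exact ⟨hopen, (continuousOn_open_iff hopen).2 key⟩

/-- A neighbourhood basis at `e₁`. -/
theorem eventually_coneVal_large (hk : 1 / 2 < k) (M : ℝ) :
    ∀ᶠ p in 𝓝 (e₁ k d), ∀ z : ℂ, coneVal k d p = z → M < ‖z‖ := by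
  have hk0 : (0 : ℝ) < k := by linarith
  obtain ⟨C, hC⟩ : ∃ C : ℝ, ∀ z ∈ slitArc k d, ‖z‖ ≤ C := by
    refine ⟨(|d| + 1) ^ k⁻¹, ?_⟩
    rintro z ⟨x, hx, rfl⟩
    rw [coneCoord, ← ofReal_inv, norm_cpow_real]
    refine Real.rpow_le_rpow (norm_nonneg _) ?_ (inv_nonneg.2 hk0.le)
    refine (norm_add_le _ _).trans ?_
    simpa using hx
  -- Beyond the slit and the point to which it is collapsed, so that all points with `‖z‖ > M'` are
  -- off the slit.
  set M' : ℝ := max (max M C) (max ‖coneCoord k d 0‖ 1) with hM'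
  have hM0 : 0 < M' := lt_of_lt_of_le one_pos ((le_max_right _ _).trans (le_max_right _ _))
  have hMM : M ≤ M' := (le_max_left _ _).trans (le_max_left _ _)
  have hMC : C ≤ M' := (le_max_right _ _).trans (le_max_left _ _)
  have hM1 : ‖coneCoord k d 0‖ ≤ M' := (le_max_left _ _).trans (le_max_right _ _)
  set U : Set (SlitTorus k d) := {p | ∀ z : ℂ, coneVal k d p = z → M' < ‖z‖} with hU
  suffices hUo : IsOpen U by
    filter_upwards [hUo.mem_nhds (show e₁ k d ∈ U from fun z hz => absurd hz (OnePoint.infty_ne_coe z))]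
      with p hp z hz
    exact hMM.trans_lt (hp z hz)
  rw [isOpen_slitTorus_iff]
  constructor
  · have h2 := (OnePoint.isOpen_compl_image_coe.2 ⟨Metric.isClosed_closedBall (x := (0 : ℂ)) (ε := M'),
      isCompact_closedBall _ _⟩).preimage (continuous_subtype_val (p := (· ∈ UpperPiece k d)))
    convert! h2 using 1
    ext ⟨p, hp⟩
    induction p with
    | infty =>
      refine iff_of_true (fun z hz => absurd hz (OnePoint.infty_ne_coe z)) ?_
      rintro ⟨z, -, hz⟩
      exact OnePoint.coe_ne_infty _ hz
    | coe z =>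
      have e1 : upper _ hp ∈ U ↔ M' < ‖z‖ := by
        simp only [hU, mem_ofPred_eq, coneVal_upper]
        split_ifs with h
        · refine iff_of_false (fun h1 => ?_) (not_lt.2 ((hC z h).trans hMC))
          exact not_lt.2 hM1 (h1 _ rfl)
        · exact ⟨fun h1 => h1 z rfl, fun h1 w hw => by rwa [← OnePoint.coe_injective hw]⟩
      refine e1.trans ?_
      constructor
      · rintro h1 ⟨w, hw, h5⟩
        have h6 := OnePoint.coe_injective h5
        subst h6
        rw [mem_closedBall_zero_iff] at hw
        linarith
      · intro h1
        by_contra hcon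
        exact h1 ⟨z, mem_closedBall_zero_iff.2 (not_lt.1 hcon), rfl⟩
  · have h2 := (OnePoint.isOpen_compl_image_coe.2
      ⟨Metric.isClosed_closedBall (x := (I * d : ℂ)) (ε := M' ^ k),
      isCompact_closedBall _ _⟩).preimage (continuous_subtype_val (p := (· ∈ LowerPiece)))
    convert! h2 using 1
    ext ⟨p, hp⟩
    induction p with
    | infty =>
      refine iff_of_true ?_ ?_
      · intro z hz
        have : lower k d _ hp = e₁ k d := lower_infty
        rw [this] at hz
        exact absurd hz (OnePoint.infty_ne_coe z)
      · rintro ⟨z, -, hz⟩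
        exact OnePoint.coe_ne_infty _ hz
    | coe ζ =>
      -- Since `|z| ^ k = |ζ - d i|`, the condition on `z` describes the outside of a disc about `d
      -- i`.
      have hnorm : M' < ‖coneCoord k d ζ‖ ↔ ζ ∉ Metric.closedBall (I * d : ℂ) (M' ^ k) := by
        rw [coneCoord, ← ofReal_inv, norm_cpow_real, mem_closedBall_iff_norm, not_le]
        have : ‖(d : ℂ) + I * ζ‖ = ‖ζ - I * d‖ := by
          rw [show (d : ℂ) + I * ζ = I * (ζ - I * d) by linear_combination d * I_mul_I, norm_mul,
            norm_I, one_mul]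
        rw [this, Real.lt_rpow_inv_iff_of_pos hM0.le (norm_nonneg _) hk0]
      have e1 : lower k d _ hp ∈ U ↔ M' < ‖coneCoord k d ζ‖ := by
        simp only [hU, mem_ofPred_eq, coneVal_lower]
        split_ifs with h
        · refine iff_of_false (fun h1 => ?_) (not_lt.2 ((hC _ h).trans hMC))
          exact not_lt.2 hM1 (h1 _ rfl)
        · exact ⟨fun h1 => h1 _ rfl, fun h1 w hw => by rwa [← OnePoint.coe_injective hw]⟩
      refine (e1.trans hnorm).trans ?_
      constructor
      · rintro h1 ⟨w, hw, h5⟩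
        have h6 := OnePoint.coe_injective h5
        subst h6
        exact h1 hw
      · intro h1 h2
        exact h1 ⟨ζ, h2, rfl⟩

/-- The straight arc in the flat coordinate from the lower imaginary axis through the slit to the
upper imaginary axis. -/
noncomputable def arcCoord (d : ℝ) (t : ℝ) : ℂ := (1 - t : ℝ) + ((2 * t - 1) * (d / 2) : ℝ) * I

theorem arcCoord_im_lt (hd : 0 < d) {t : ℝ} (ht : t ∈ Icc (0 : ℝ) 1) : (arcCoord d t).im < d := by
  simp [arcCoord]
  nlinarith [ht.1, ht.2]

theorem continuous_arcCoord : Continuous (arcCoord d) := by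
  unfold arcCoord; fun_prop

theorem continuous_arc (hk : 1 / 2 < k) (hd : 0 < d) :
    Continuous fun t : Icc (0 : ℝ) 1 => edgeChart hk (-1) (arcCoord d t) (arcCoord_im_lt hd t.2) := by
  set f : Icc (0 : ℝ) 1 → SlitTorus k d :=
    fun t => edgeChart hk (-1) (arcCoord d t) (arcCoord_im_lt hd t.2) with hf
  have hup : ∀ t : Icc (0 : ℝ) 1, (1 / 2 : ℝ) ≤ t → 0 ≤ (arcCoord d t).im := fun t ht => by
    simp only [arcCoord, add_im, ofReal_im, mul_im, ofReal_re, I_im, I_re]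
    nlinarith
  have hdn : ∀ t : Icc (0 : ℝ) 1, (t : ℝ) ≤ 1 / 2 → (arcCoord d t).im ≤ 0 := fun t ht => by
    simp only [arcCoord, add_im, ofReal_im, mul_im, ofReal_re, I_im, I_re]
    nlinarith
  have hA : ContinuousOn f {t | (1 / 2 : ℝ) ≤ t} := by
    rw [continuousOn_iff_continuous_domRestrict]
    have h1 : Continuous fun t : {t : Icc (0 : ℝ) 1 | (1 / 2 : ℝ) ≤ t} =>
        (⟨(coneCoord k d (arcCoord d t.1) : OnePoint ℂ),
          coneCoord_mem_upperPiece hk (hup t.1 t.2) (arcCoord_im_lt hd t.1.2)⟩ : UpperPiece k d) := by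
      refine Continuous.subtype_mk (OnePoint.continuous_coe.comp ?_) _
      rw [continuous_iff_continuousAt]
      intro t
      refine ContinuousAt.cpow ?_ continuousAt_const ?_
      · exact (continuous_const.add (continuous_const.mul (continuous_arcCoord.comp
          (continuous_subtype_val.comp continuous_subtype_val)))).continuousAt
      · exact Or.inl (re_pos_of_im_lt (arcCoord_im_lt hd t.1.2))
    refine (continuous_upper.comp h1).congr fun t => ?_
    simp only [Function.comp_apply, domRestrict_apply, hf]
    rw [edgeChart, dif_pos (hup t.1 t.2)]
  have hB : ContinuousOn f {t | (t : ℝ) ≤ 1 / 2} := by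
    rw [continuousOn_iff_continuous_domRestrict]
    have hm : ∀ t : {t : Icc (0 : ℝ) 1 | (t : ℝ) ≤ 1 / 2},
        (arcCoord d t.1 + (-1 : ℝ)).im ≤ 0 := fun t => by simpa using hdn t.1 t.2
    have h1 : Continuous fun t : {t : Icc (0 : ℝ) 1 | (t : ℝ) ≤ 1 / 2} =>
        (⟨((arcCoord d t.1 + (-1 : ℝ) : ℂ) : OnePoint ℂ), mem_lowerPiece (hm t)⟩ : LowerPiece) := by
      refine Continuous.subtype_mk (OnePoint.continuous_coe.comp ?_) _
      exact (continuous_arcCoord.comp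
          (continuous_subtype_val.comp continuous_subtype_val)).add continuous_const
    refine (continuous_lower.comp h1).congr fun t => ?_
    simp only [Function.comp_apply, domRestrict_apply, hf]
    unfold edgeChart
    split_ifs with h
    · have h3 : t.1.1 = 1 / 2 := by
        have := t.2
        refine le_antisymm this ?_
        by_contra hcon
        simp only [arcCoord, add_im, ofReal_im, mul_im, ofReal_re, I_im, I_re] at h
        nlinarith [not_le.1 hcon]
      -- The arc crosses the slit at `ξ = 1/2`, where the upper edge is glued to the lower edge at
      -- `-1/2`.
      have h4 : arcCoord d t.1.1 = ((1 / 2 : ℝ) : ℂ) := by rw [h3]; simp [arcCoord]; norm_num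
      have h5 := glue_eq hk hd (x := 1 / 2) (y := 1 / 2 - 1)
        (Or.inr (Or.inr ⟨by norm_num, by norm_num, rfl⟩))
      simp only [h4, h5]
      congr 2
      push_cast; ring
    · rfl
  have hC := hA.union_of_isClosed hB (isClosed_le continuous_const continuous_subtype_val)
    (isClosed_le continuous_subtype_val continuous_const)
  rw [← continuousOn_univ]
  refine hC.mono fun t _ => ?_
  exact (le_total (1 / 2 : ℝ) t)

end

/-! ### The rhombic torus in the coordinate `s` -/

/-- The point of the torus with coordinate `s`, where `w = (1 + τ) / 2 + s (1 - τ) / 2`. -/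
noncomputable def pr (τ s : ℂ) : Torus τ := (((1 + τ) / 2 + s * ((1 - τ) / 2) : ℂ) : Torus τ)

theorem diag_eq_pr (τ : ℂ) (t : ℝ) : diag τ t = pr τ t := rfl

/-- The height of the fundamental strip. -/
noncomputable def stripHeight (τ : ℂ) : ℝ := |((1 + τ) / (1 - τ)).im|

section
variable {τ : ℂ} (h1 : ‖τ‖ = 1) (him : τ.im ≠ 0)

include him in
theorem one_sub_ne_zero_of_im : 1 - τ ≠ 0 := fun h => him (by
  have := congrArg Complex.im h
  simpa using this)

include h1 him in
-- The diagonals of a rhombus are perpendicular, so `(1 + τ) / (1 - τ)` is purely imaginary.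
theorem one_add_eq : 1 + τ = ((1 + τ) / (1 - τ)).im * I * (1 - τ) := by
  have h0 := one_sub_ne_zero_of_im him
  have hre : ((1 + τ) / (1 - τ)).re = 0 := by
    have h2 : τ.re * τ.re + τ.im * τ.im = 1 := by
      rw [← normSq_apply, normSq_eq_norm_sq, h1]; norm_num
    rw [div_re, ← add_div, div_eq_zero_iff]
    left
    simp; nlinarith
  have h3 : (1 + τ) / (1 - τ) = ((1 + τ) / (1 - τ)).im * I := Complex.ext (by simpa using hre) (by simp)
  rw [← h3, div_mul_cancel₀ _ h0]

include h1 him in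
theorem stripHeight_pos : 0 < stripHeight τ := by
  rw [stripHeight, abs_pos]
  intro h
  have := one_add_eq h1 him
  rw [h] at this
  have h2 := congrArg Complex.im this
  simp at h2
  exact him h2

include h1 him in
-- With `c = (1 + τ) / (1 - τ)` the generators `1`, `τ` are `1 + c`, `-1 + c` in the coordinate `s`.
-- Here `c = ± stripHeight τ * I`, and the sign is absorbed by exchanging `(m, n)` with `(-n, -m)`.
theorem pr_eq_iff {s s' : ℂ} : pr τ s = pr τ s' ↔
    ∃ m n : ℤ, s = s' + ((m - n : ℤ) : ℂ) + ((m + n : ℤ) : ℂ) * (stripHeight τ * I) := by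
  have h0 := one_sub_ne_zero_of_im him
  have key : pr τ s = pr τ s' ↔ ∃ m n : ℤ,
      s = s' + ((m - n : ℤ) : ℂ) + ((m + n : ℤ) : ℂ) * (((1 + τ) / (1 - τ)).im * I) := by
    rw [pr, pr, eq_comm, QuotientAddGroup.eq, AddSubgroup.mem_closure_pair]
    refine exists_congr fun m => exists_congr fun n => ?_
    have e := one_add_eq h1 him
    generalize (((1 + τ) / (1 - τ)).im * I : ℂ) = c at e ⊢
    simp only [zsmul_eq_mul, mul_one]
    push_cast
    constructor
    · intro h
      refine mul_right_cancel₀ (div_ne_zero h0 two_ne_zero) ?_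
      linear_combination -h + ((m + n : ℂ) / 2) * e
    · rintro rfl
      linear_combination ((m + n : ℂ) / 2) * e
  rw [key, stripHeight]
  rcases abs_choice ((1 + τ) / (1 - τ)).im with h | h
  · rw [h]
  · rw [h]
    constructor
    · rintro ⟨m, n, h⟩
      exact ⟨-n, -m, by rw [h]; push_cast; ring⟩
    · rintro ⟨m, n, h⟩
      exact ⟨-n, -m, by rw [h]; push_cast; ring⟩

include h1 him in
theorem pr_add_two (s : ℂ) : pr τ (s + 2) = pr τ s :=
  (pr_eq_iff h1 him).2 ⟨1, -1, by push_cast; ring⟩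

include h1 him in
theorem pr_add_half (s : ℂ) : pr τ (s + (1 + stripHeight τ * I)) = pr τ s :=
  (pr_eq_iff h1 him).2 ⟨1, 0, by push_cast; ring⟩

include h1 him in
theorem pr_add_int_half (s : ℂ) (n : ℤ) : pr τ (s + n * (1 + stripHeight τ * I)) = pr τ s :=
  (pr_eq_iff h1 him).2 ⟨n, 0, by push_cast; ring⟩

include h1 him in
theorem eq_add_two_of_pr_eq {s s' : ℂ} (h : pr τ s = pr τ s') (hs : |s.im - s'.im| < stripHeight τ) :
    ∃ n : ℤ, s = s' + 2 * n := by
  obtain ⟨m, n, rfl⟩ := (pr_eq_iff h1 him).1 h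
  have hT := stripHeight_pos h1 him
  have h2 : |((m + n : ℤ) : ℝ)| < 1 := by
    have e : (s' + ((m - n : ℤ) : ℂ) + ((m + n : ℤ) : ℂ) * (stripHeight τ * I)).im - s'.im =
      ((m + n : ℤ) : ℝ) * stripHeight τ := by
      simp only [add_im, intCast_im, mul_im, intCast_re, ofReal_im, ofReal_re, mul_re, I_re, I_im]
      ring
    rw [e, abs_mul, abs_of_pos hT] at hs
    by_contra hcon
    nlinarith [not_lt.1 hcon]
  have h3 : m + n = 0 := by
    rw [← Int.abs_lt_one_iff]; exact_mod_cast h2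
  have h4 : n = -m := by omega
  subst h4
  exact ⟨m, by push_cast; ring⟩

include h1 him in
theorem eq_of_pr_eq {s s' : ℂ} (h : pr τ s = pr τ s') (hs : |s.im - s'.im| < stripHeight τ)
    (hr : |s.re - s'.re| < 2) : s = s' := by
  obtain ⟨n, rfl⟩ := eq_add_two_of_pr_eq h1 him h hs
  have h2 : |(n : ℝ)| < 1 := by
    have e : (s' + 2 * n).re - s'.re = 2 * n := by simp
    rw [e, abs_mul, abs_of_pos (by norm_num : (0 : ℝ) < 2)] at hr
    linarith
  have h3 : n = 0 := by
    rw [← Int.abs_lt_one_iff]; exact_mod_cast h2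
  simp [h3]

include h1 him in
theorem exists_nhds_injOn_pr (s₀ : ℂ) : ∃ V ∈ 𝓝 s₀, InjOn (pr τ) V := by
  have hT := stripHeight_pos h1 him
  refine ⟨{s | |s.im - s₀.im| < stripHeight τ / 2} ∩ {s | |s.re - s₀.re| < 1}, ?_, ?_⟩
  · refine inter_mem ?_ ?_
    · refine (isOpen_lt (by fun_prop) (by fun_prop)).mem_nhds ?_
      simp [hT]
    · refine (isOpen_lt (by fun_prop) (by fun_prop)).mem_nhds ?_
      simp
  · intro s hs s' hs' h
    have a1 := abs_lt.1 (show |s.im - s₀.im| < stripHeight τ / 2 from hs.1)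
    have a2 := abs_lt.1 (show |s.re - s₀.re| < 1 from hs.2)
    have a3 := abs_lt.1 (show |s'.im - s₀.im| < stripHeight τ / 2 from hs'.1)
    have a4 := abs_lt.1 (show |s'.re - s₀.re| < 1 from hs'.2)
    refine eq_of_pr_eq h1 him h (abs_lt.2 ?_) (abs_lt.2 ?_) <;> constructor <;> linarith

theorem continuous_pr : Continuous (pr τ) := by
  unfold pr
  exact (continuous_quotient_mk' (s := QuotientAddGroup.leftRel (lattice τ))).comp (by fun_prop)

include him in
theorem isDiscrete_lattice : IsDiscrete (lattice τ : Set ℂ) := by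
  constructor
  suffices h : DiscreteTopology (lattice τ) from h
  refine discreteTopology_of_isOpen_singleton_zero ?_
  have hε : 0 < min 1 |τ.im| := lt_min one_pos (abs_pos.2 him)
  have hU := (Metric.isOpen_ball (x := (0 : ℂ)) (ε := min 1 |τ.im|)).preimage
    (continuous_subtype_val (p := (· ∈ lattice τ)))
  convert! hU using 1
  ext ⟨z, hz⟩
  simp only [mem_singleton_iff, mem_preimage, mem_ball_zero_iff, Subtype.ext_iff,
    ZeroMemClass.coe_zero]
  constructor
  · rintro rfl; simpa using hε
  · intro hlt
    obtain ⟨m, n, rfl⟩ := AddSubgroup.mem_closure_pair.1 hz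
    simp only [zsmul_eq_mul, mul_one] at hlt ⊢
    have hi := (abs_im_le_norm _).trans_lt (hlt.trans_le (min_le_right _ _))
    have hr := (abs_re_le_norm _).trans_lt (hlt.trans_le (min_le_left _ _))
    have hn : n = 0 := by
      have e : ((m : ℂ) + n * τ).im = n * τ.im := by simp
      rw [e, abs_mul] at hi
      have : |(n : ℝ)| < 1 := by
        by_contra hcon
        nlinarith [not_lt.1 hcon, abs_pos.2 him]
      rw [← Int.abs_lt_one_iff]; exact_mod_cast this
    subst hn
    have hm : m = 0 := by
      simp at hr
      rw [← Int.abs_lt_one_iff]; exact_mod_cast hr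
    simp [hm]

include him in
theorem exists_lift_pr (c : C(unitInterval, Torus τ)) {s₀ : ℂ} (h0 : pr τ s₀ = c 0) :
    ∃ γ : C(unitInterval, ℂ), γ 0 = s₀ ∧ ∀ t, pr τ (γ t) = c t := by
  have hne := one_sub_ne_zero_of_im him
  have cov := ((lattice τ).isAddQuotientCoveringMap_of_comm (isDiscrete_lattice him)).isCoveringMap
  obtain ⟨Γ, hΓ, hΓ0⟩ := cov.exists_path_lifts c ((1 + τ) / 2 + s₀ * ((1 - τ) / 2)) h0.symm
  refine ⟨⟨fun t => (Γ t - (1 + τ) / 2) / ((1 - τ) / 2), by fun_prop⟩, ?_, fun t => ?_⟩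
  · simp only [ContinuousMap.coe_mk, hΓ0]
    field_simp
    ring
  · rw [← congr_fun hΓ t]
    simp only [pr, ContinuousMap.coe_mk, Function.comp_apply]
    congr 1
    field_simp
    ring

include him in
/-- A holomorphic injective map to the torus has local inverses. -/
theorem exists_local_coord {U : Set ℂ} {f : ∀ ξ ∈ U, Torus τ} (hU : IsOpen U)
    (hf : IsHolomorphicOn U f) {ξ₀ : ℂ} (hξ : ξ₀ ∈ U) {V : Set ℂ} (hV : V ∈ 𝓝 ξ₀)
    (hinj : ∀ ξ ∈ V, ∀ ξ' ∈ V, ∀ h h', f ξ h = f ξ' h' → ξ = ξ') {s₀ : ℂ}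
    (hs : pr τ s₀ = f ξ₀ hξ) :
    ∃ i : ℂ → ℂ, AnalyticAt ℂ i s₀ ∧ i s₀ = ξ₀ ∧ deriv i s₀ ≠ 0 ∧
      ∀ᶠ s in 𝓝 s₀, ∃ h : i s ∈ U, pr τ s = f (i s) h := by
  have hne := one_sub_ne_zero_of_im him
  obtain ⟨g₀, hg₀, he⟩ := hf ξ₀ hξ
  -- The local lift of `f`, read in the coordinate `s` and translated so that it passes through
  -- `s₀`.
  set g : ℂ → ℂ := fun ξ => (g₀ ξ - g₀ ξ₀) / ((1 - τ) / 2) + s₀ with hg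
  have hga : AnalyticAt ℂ g ξ₀ :=
    ((hg₀.sub analyticAt_const).div analyticAt_const (by simpa using hne)).add analyticAt_const
  have hg0 : g ξ₀ = s₀ := by simp [hg]
  have hprg : ∀ ξ, pr τ (g ξ) = (g₀ ξ : Torus τ) := by
    intro ξ
    have e1 : pr τ s₀ = (g₀ ξ₀ : Torus τ) := by rw [hs]; exact he.self_of_nhds hξ
    have e2 : pr τ (g ξ) = pr τ s₀ + ((g₀ ξ - g₀ ξ₀ : ℂ) : Torus τ) := by
      rw [pr, pr, ← QuotientAddGroup.mk_add]
      congr 1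
      simp only [hg]
      field_simp
      ring
    rw [e2, e1, ← QuotientAddGroup.mk_add]
    congr 1
    ring
  have hgd : deriv g ξ₀ ≠ 0 := by
    refine deriv_ne_zero_of_injOn_nhds hga (U := V ∩ (U ∩ {ξ | ∀ h : ξ ∈ U, f ξ h = (g₀ ξ : Torus τ)}))
      (inter_mem hV (inter_mem (hU.mem_nhds hξ) he)) ?_
    intro ξ h ξ' h' hgg
    refine hinj ξ h.1 ξ' h'.1 h.2.1 h'.2.1 ?_
    rw [h.2.2, h'.2.2, ← hprg, ← hprg, hgg]
  set i := hga.hasStrictDerivAt.localInverse g _ _ hgd with hi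
  have hia : AnalyticAt ℂ i s₀ := by rw [← hg0]; exact hga.analyticAt_localInverse hgd
  have hi0 : i s₀ = ξ₀ := by
    rw [← hg0]; exact HasStrictFDerivAt.localInverse_apply_image _
  have hright : ∀ᶠ s in 𝓝 s₀, g (i s) = s := by
    rw [← hg0]; exact HasStrictDerivAt.eventually_right_inverse _ hgd
  refine ⟨i, hia, hi0, ?_, ?_⟩
  · have h3 : HasDerivAt i (deriv g ξ₀)⁻¹ s₀ := by
      rw [← hg0]; exact (hga.hasStrictDerivAt.to_localInverse hgd).hasDerivAt
    rw [h3.deriv]; exact inv_ne_zero hgd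
  · have hcont : Tendsto i (𝓝 s₀) (𝓝 ξ₀) := by rw [← hi0]; exact hia.continuousAt
    filter_upwards [hright, hcont.eventually (hU.mem_nhds hξ), hcont.eventually he] with s h3 h4 h5
    refine ⟨h4, ?_⟩
    rw [h5 h4, ← hprg, h3]
end

/-! ### The flat structure on the rhombic torus -/

section
variable {k d : ℝ}

theorem isOpen_edge (α β : ℝ) : IsOpen {ξ : ℂ | α < ξ.re ∧ ξ.re < β ∧ ξ.im < d} :=
  (isOpen_lt (by fun_prop) (by fun_prop)).and ((isOpen_lt (by fun_prop) (by fun_prop)).and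
    (isOpen_lt (by fun_prop) (by fun_prop)))

theorem hasDerivAt_dev {z : ℂ} (hz : z ∈ slitPlane) :
    HasDerivAt (dev k d) (-(I * (k * z ^ ((k : ℂ) - 1)))) z := by
  have h1 : HasDerivAt (fun z : ℂ => z ^ (k : ℂ)) (k * z ^ ((k : ℂ) - 1) * 1) z :=
    (hasDerivAt_id z).cpow_const hz
  have h2 := (h1.const_mul I).const_sub (d * I)
  rw [mul_one] at h2
  exact h2

theorem analyticAt_dev {z : ℂ} (hz : z ∈ slitPlane) : AnalyticAt ℂ (dev k d) z :=
  analyticAt_const.sub (analyticAt_const.mul (analyticAt_id.cpow analyticAt_const hz))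

variable (hk : 1 / 2 < k) (hd : 0 < d)

include hd in
theorem isCompact_slitArc : IsCompact (slitArc k d) := by
  have h : slitArc k d = (fun x : ℝ => coneCoord k d x) '' Icc (-1) 1 := by
    ext z
    constructor
    · rintro ⟨x, hx, rfl⟩; exact ⟨x, abs_le.1 hx, rfl⟩
    · rintro ⟨x, hx, rfl⟩; exact ⟨x, abs_le.2 hx, rfl⟩
  rw [h]
  refine isCompact_Icc.image (continuous_iff_continuousAt.2 fun x => ?_)
  refine ContinuousAt.cpow (by fun_prop) continuousAt_const ?_
  exact Or.inl (re_pos_of_im_lt (by simpa using hd))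

include hd in
theorem isOpen_compl_slitArc : IsOpen (slitArc k d)ᶜ :=
  (isCompact_slitArc hd).isClosed.isOpen_compl

theorem flatExp_ne_zero {p : SlitTorus k d} (hp : p ≠ e₁ k d) : flatExp hk hd p ≠ 0 := by
  induction p using slitTorus_cases with
  | infty => exact absurd rfl hp
  | upper z h => rw [flatExp_upper]; exact exp_ne_zero _
  | lower ζ h => rw [flatExp_lower]; exact exp_ne_zero _

theorem coneVal_edgeChart {x : ℝ} (c : ℝ) (hx : |x| ≤ 1) (h : (x : ℂ).im < d) :
    coneVal k d (edgeChart hk c x h) = coneCoord k d 0 := by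
  rw [edgeChart, dif_pos (by simp), coneVal_upper, if_pos ⟨x, hx, rfl⟩]

theorem zero_mem_slitArc : coneCoord k d 0 ∈ slitArc k d := ⟨0, by simp, by simp⟩

theorem coneVal_v₂ : coneVal k d (v₂ hk hd) = coneCoord k d 0 := by
  rw [v₂, coneVal_upper, if_pos zero_mem_slitArc]

include hk hd in
theorem eq_e₁_or_coneChart_or (p : SlitTorus k d) : p = e₁ k d ∨
    coneVal k d p = coneCoord k d 0 ∨ ∃ z, z ∉ slitArc k d ∧ p = coneChart k d z := by
  rcases chart_cases hk hd p with h | rfl | h | ⟨x, h, h1, h2, rfl⟩ | ⟨x, h, h1, h2, rfl⟩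
  · exact Or.inl h
  · exact Or.inr (Or.inl (coneVal_v₂ hk hd))
  · exact Or.inr (Or.inr h)
  · exact Or.inr (Or.inl (coneVal_edgeChart hk _ (abs_le.2 ⟨by linarith, by linarith⟩) h))
  · exact Or.inr (Or.inl (coneVal_edgeChart hk _ (abs_le.2 ⟨by linarith, by linarith⟩) h))

variable {τ : ℂ} (φ : Torus τ ≃ₜ SlitTorus k d)

/-- The function `exp (2 π i ζ)` in the coordinate of the rhombic torus. -/
noncomputable def flatExpOn (s : ℂ) : ℂ := flatExp hk hd (φ (pr τ s))

/-- The cone coordinate `z` in the coordinate of the rhombic torus. -/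
noncomputable def coneOn (s : ℂ) : ℂ := (coneVal k d (φ (pr τ s))).elim 0 id

/-- The derivative of the flat coordinate `ζ` with respect to the coordinate of the rhombic
torus. -/
noncomputable def flatDeriv (s : ℂ) : ℂ :=
  deriv (flatExpOn hk hd φ) s / (2 * Real.pi * I * flatExpOn hk hd φ s)

/-- The preimage of the complement of the cut. -/
def offCut : Set ℂ := {s | φ (pr τ s) ∉ cutRay k d}

open Classical in
/-- The logarithmic derivative of `dζ/ds`, in the cone coordinate on the cut. -/
noncomputable def flatLogDeriv (s : ℂ) : ℂ :=
  if s ∈ offCut φ then deriv (flatDeriv hk hd φ) s / flatDeriv hk hd φ s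
  else (k - 1) * (deriv (coneOn φ) s / coneOn φ s) +
    deriv (deriv (coneOn φ)) s / deriv (coneOn φ) s

theorem coneOn_eq {s z : ℂ} (hz : z ∉ slitArc k d) (hs : φ (pr τ s) = coneChart k d z) (hk : 1 / 2 < k) :
    coneOn φ s = z := by
  rw [coneOn, hs, coneVal_coneChart hk hz]; rfl

include hk hd in
theorem isOpen_offCut : IsOpen (offCut φ) :=
  (continuousOn_flatExp hk hd).1.preimage (φ.continuous.comp continuous_pr)

include hk hd in
theorem mem_offCut_iff_of_coneChart {s z : ℂ} (hs : φ (pr τ s) = coneChart k d z) :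
    s ∈ offCut φ ↔ z ∈ slitPlane := by
  change φ (pr τ s) ∉ cutRay k d ↔ _
  rw [hs, coneChart_mem_cutRay_iff hk hd, not_not]

theorem flatExpOn_ne_zero {s : ℂ} (hs : s ∈ offCut φ) : flatExpOn hk hd φ s ≠ 0 :=
  flatExp_ne_zero hk hd fun h => hs (by rw [h]; exact Or.inl rfl)

variable {φ} (hφ : IsRhombicModel hk hd φ)

include hφ

/-- The cone coordinate is a local holomorphic coordinate off the slit. -/
theorem coneOn_local {s₀ z₀ : ℂ} (hz : z₀ ∉ slitArc k d) (hs : φ (pr τ s₀) = coneChart k d z₀) :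
    AnalyticAt ℂ (coneOn φ) s₀ ∧ deriv (coneOn φ) s₀ ≠ 0 ∧
      ∀ᶠ s in 𝓝 s₀, coneOn φ s ∉ slitArc k d ∧ φ (pr τ s) = coneChart k d (coneOn φ s) := by
  obtain ⟨i, hi, hi0, hid, hev⟩ := exists_local_coord hφ.im_ne (isOpen_compl_slitArc hd)
    hφ.conformal.cone hz univ_mem (by
      intro ξ _ ξ' _ h h' he
      have := congrArg (coneVal k d) (φ.symm.injective he)
      rw [coneVal_coneChart hk h, coneVal_coneChart hk h'] at this
      exact OnePoint.coe_injective this) (s₀ := s₀) (by rw [← hs]; simp)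
  have hev' : ∀ᶠ s in 𝓝 s₀, i s ∉ slitArc k d ∧ φ (pr τ s) = coneChart k d (i s) := by
    filter_upwards [hev] with s ⟨h, h2⟩
    exact ⟨h, by rw [h2]; simp⟩
  have heq : coneOn φ =ᶠ[𝓝 s₀] i := by
    filter_upwards [hev'] with s h
    exact coneOn_eq φ h.1 h.2 hk
  refine ⟨hi.congr heq.symm, by rwa [heq.deriv_eq], ?_⟩
  filter_upwards [hev', heq] with s h h2
  rwa [h2]

/-- `exp (2 π i ζ)` determines a point of an edge chart up to an integer, so the chart is injective
on a vertical band of width `1`. This supplies a local inverse. -/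
theorem edge_local (n : ℤ) {U : Set ℂ} (hU : IsOpen U) (hUd : ∀ ξ ∈ U, ξ.im < d)
    (hol : IsHolomorphicOn U fun ξ h => φ.symm (edgeChart hk n ξ (hUd ξ h))) {s₀ ξ₀ : ℂ} (hξ : ξ₀ ∈ U)
    (hs : φ (pr τ s₀) = edgeChart hk n ξ₀ (hUd _ hξ)) :
    ∃ i : ℂ → ℂ, AnalyticAt ℂ i s₀ ∧ deriv i s₀ ≠ 0 ∧
      ∀ᶠ s in 𝓝 s₀, flatExpOn hk hd φ s = exp (2 * Real.pi * I * i s) := by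
  obtain ⟨i, hi, -, hid, hev⟩ := exists_local_coord hφ.im_ne hU hol hξ
    (V := {ξ | |ξ.re - ξ₀.re| < 1 / 2}) (by
      refine (isOpen_lt (by fun_prop) (by fun_prop)).mem_nhds ?_
      simp) (by
      intro ξ h1 ξ' h1' h h' he
      have := congrArg (flatExp hk hd) (φ.symm.injective he)
      rw [flatExp_edgeChart, flatExp_edgeChart, exp_eq_exp_iff_exists_int] at this
      obtain ⟨m, hm⟩ := this
      have hm' : ξ = ξ' + m :=
        mul_left_cancel₀ two_pi_I_ne_zero (by linear_combination hm)
      have a1 := abs_lt.1 (show |ξ.re - ξ₀.re| < 1 / 2 from h1)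
      have a2 := abs_lt.1 (show |ξ'.re - ξ₀.re| < 1 / 2 from h1')
      have hre : ξ.re = ξ'.re + m := by rw [hm']; simp
      have : m = 0 := by
        rw [← Int.abs_lt_one_iff]
        have : |(m : ℝ)| < 1 := abs_lt.2 ⟨by linarith, by linarith⟩
        exact_mod_cast this
      rw [hm', this]; simp) (s₀ := s₀) (by rw [← hs]; simp)
  refine ⟨i, hi, hid, ?_⟩
  filter_upwards [hev] with s ⟨h, h2⟩
  rw [flatExpOn, h2, Homeomorph.apply_symm_apply, flatExp_edgeChart]

omit hφ in
theorem analytic_of_eq_exp {Y i : ℂ → ℂ} {s₀ : ℂ} (hi : AnalyticAt ℂ i s₀) (hd : deriv i s₀ ≠ 0)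
    (h : ∀ᶠ s in 𝓝 s₀, Y s = exp (2 * Real.pi * I * i s)) : AnalyticAt ℂ Y s₀ ∧ deriv Y s₀ ≠ 0 := by
  have h1 : AnalyticAt ℂ (fun s => exp (2 * Real.pi * I * i s)) s₀ := (analyticAt_const.mul hi).cexp
  refine ⟨h1.congr (h.mono fun _ h => h.symm), ?_⟩
  have h2 : Y =ᶠ[𝓝 s₀] fun s => exp (2 * Real.pi * I * i s) := h
  rw [h2.deriv_eq, ((hi.differentiableAt.hasDerivAt.const_mul _).cexp).deriv]
  exact mul_ne_zero (exp_ne_zero _) (mul_ne_zero two_pi_I_ne_zero hd)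

theorem flatExpOn_eventuallyEq_dev {s₀ z₀ : ℂ} (hz : z₀ ∉ slitArc k d)
    (hs : φ (pr τ s₀) = coneChart k d z₀) :
    ∀ᶠ s in 𝓝 s₀, flatExpOn hk hd φ s = exp (2 * Real.pi * I * dev k d (coneOn φ s)) := by
  filter_upwards [(coneOn_local hk hd hφ hz hs).2.2] with s h
  rw [flatExpOn, h.2, flatExp_coneChart, coneOn_eq φ h.1 h.2 hk]

theorem flatExpOn_local {s₀ : ℂ} (hs : s₀ ∈ offCut φ) (hv : φ (pr τ s₀) ≠ v₂ hk hd) :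
    AnalyticAt ℂ (flatExpOn hk hd φ) s₀ ∧ deriv (flatExpOn hk hd φ) s₀ ≠ 0 := by
  rcases chart_cases hk hd (φ (pr τ s₀)) with h | h | ⟨z, hz, h⟩ | ⟨x, h, h1, h2, h3⟩ | ⟨x, h, h1, h2, h3⟩
  · exact absurd (h ▸ Or.inl rfl) hs
  · exact absurd h hv
  · have hzs := (mem_offCut_iff_of_coneChart hk hd φ h).1 hs
    obtain ⟨hZ, hZd, -⟩ := coneOn_local hk hd hφ hz h
    have hZ0 := coneOn_eq φ hz h hk
    rw [← hZ0] at hzs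
    refine analytic_of_eq_exp ((analyticAt_dev hzs).fun_comp hZ) ?_
      (flatExpOn_eventuallyEq_dev hk hd hφ hz h)
    have hd1 := (hasDerivAt_dev (k := k) (d := d) hzs).comp s₀ hZ.differentiableAt.hasDerivAt
    have hk0 : (k : ℂ) ≠ 0 := by
      have : k ≠ 0 := by linarith
      exact_mod_cast this
    have hne : coneOn φ s₀ ≠ 0 := slitPlane_ne_zero hzs
    have e : deriv (fun s => dev k d (coneOn φ s)) s₀ = _ := hd1.deriv
    rw [e]
    refine mul_ne_zero (neg_ne_zero.2 (mul_ne_zero I_ne_zero (mul_ne_zero hk0 ?_))) hZd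
    simp [cpow_eq_zero_iff, hne]
  · obtain ⟨i, hi, hid, he⟩ := edge_local hk hd hφ 1 (U := {ξ | -1 < ξ.re ∧ ξ.re < 0 ∧ ξ.im < d})
      (isOpen_edge _ _) (fun ξ h => h.2.2)
      (by simpa using hφ.conformal.left_edge) (s₀ := s₀) (ξ₀ := x) ⟨by simpa, by simpa, h⟩ (by simpa using h3)
    exact analytic_of_eq_exp hi hid he
  · obtain ⟨i, hi, hid, he⟩ := edge_local hk hd hφ (-1) (U := {ξ | 0 < ξ.re ∧ ξ.re < 1 ∧ ξ.im < d})
      (isOpen_edge _ _) (fun ξ h => h.2.2)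
      (by simpa using hφ.conformal.right_edge) (s₀ := s₀) (ξ₀ := x) ⟨by simpa, by simpa, h⟩ (by simpa using h3)
    exact analytic_of_eq_exp hi hid he

/-- Punctured neighbourhoods of a preimage of a point avoid the other preimages. -/
theorem eventually_ne_of_eq {s₀ : ℂ} {p : SlitTorus k d} (hs : φ (pr τ s₀) = p) :
    ∀ᶠ s in 𝓝[≠] s₀, φ (pr τ s) ≠ p := by
  obtain ⟨V, hV, hinj⟩ := exists_nhds_injOn_pr hφ.norm_eq hφ.im_ne s₀
  filter_upwards [mem_nhdsWithin_of_mem_nhds hV, self_mem_nhdsWithin] with s h1 h2 h3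
  exact h2 (hinj h1 (mem_of_mem_nhds hV) (φ.injective (h3.trans hs.symm)))

/-- At `v₂`, where no chart is given, the function is continuous and holomorphic on a punctured
neighbourhood, so the singularity is removable. -/
theorem analyticAt_flatExpOn {s₀ : ℂ} (hs : s₀ ∈ offCut φ) :
    AnalyticAt ℂ (flatExpOn hk hd φ) s₀ := by
  by_cases hv : φ (pr τ s₀) = v₂ hk hd
  · refine analyticAt_of_differentiable_on_punctured_nhds_of_continuousAt ?_ ?_
    · filter_upwards [eventually_ne_of_eq hk hd hφ hv,
        mem_nhdsWithin_of_mem_nhds ((isOpen_offCut hk hd φ).mem_nhds hs)] with s h1 h2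
      exact (flatExpOn_local hk hd hφ h2 h1).1.differentiableAt
    · have h := continuousOn_flatExp hk hd
      exact ContinuousAt.comp (f := fun s => φ (pr τ s)) (h.2.continuousAt (h.1.mem_nhds hs))
        (φ.continuous.comp continuous_pr).continuousAt
  · exact (flatExpOn_local hk hd hφ hs hv).1

theorem analyticAt_flatDeriv {s₀ : ℂ} (hs : s₀ ∈ offCut φ) :
    AnalyticAt ℂ (flatDeriv hk hd φ) s₀ :=
  (analyticAt_flatExpOn hk hd hφ hs).deriv.fun_div
    (analyticAt_const.mul (analyticAt_flatExpOn hk hd hφ hs))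
    (mul_ne_zero two_pi_I_ne_zero (flatExpOn_ne_zero hk hd φ hs))

theorem flatDeriv_ne_zero {s₀ : ℂ} (hs : s₀ ∈ offCut φ) (hv : φ (pr τ s₀) ≠ v₂ hk hd) :
    flatDeriv hk hd φ s₀ ≠ 0 :=
  div_ne_zero (flatExpOn_local hk hd hφ hs hv).2
    (mul_ne_zero two_pi_I_ne_zero (flatExpOn_ne_zero hk hd φ hs))

omit hφ in
theorem flatLogDeriv_eventuallyEq {s₀ : ℂ} (hs : s₀ ∈ offCut φ) :
    flatLogDeriv hk hd φ =ᶠ[𝓝 s₀] fun s => deriv (flatDeriv hk hd φ) s / flatDeriv hk hd φ s := by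
  filter_upwards [(isOpen_offCut hk hd φ).mem_nhds hs] with s h
  rw [flatLogDeriv, if_pos h]

theorem analyticAt_flatLogDeriv {s₀ : ℂ} (hs : s₀ ∈ offCut φ) (hv : φ (pr τ s₀) ≠ v₂ hk hd) :
    AnalyticAt ℂ (flatLogDeriv hk hd φ) s₀ :=
  ((analyticAt_flatDeriv hk hd hφ hs).deriv.fun_div (analyticAt_flatDeriv hk hd hφ hs)
    (flatDeriv_ne_zero hk hd hφ hs hv)).congr (flatLogDeriv_eventuallyEq hk hd hs).symm

theorem flatDeriv_eq_of_coneChart {s₀ z₀ : ℂ} (hz : z₀ ∉ slitArc k d)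
    (hs : φ (pr τ s₀) = coneChart k d z₀) (hzs : z₀ ∈ slitPlane) :
    flatDeriv hk hd φ s₀ =
      -(I * (k * coneOn φ s₀ ^ ((k : ℂ) - 1))) * deriv (coneOn φ) s₀ := by
  obtain ⟨hZ, -, -⟩ := coneOn_local hk hd hφ hz hs
  have he : flatExpOn hk hd φ =ᶠ[𝓝 s₀] _ := flatExpOn_eventuallyEq_dev hk hd hφ hz hs
  rw [← coneOn_eq φ hz hs hk] at hzs
  have h1 := (((hasDerivAt_dev (k := k) (d := d) hzs).comp s₀
    hZ.differentiableAt.hasDerivAt).const_mul (2 * Real.pi * I)).cexp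
  rw [flatDeriv, he.deriv_eq, he.eq_of_nhds]
  simp only [Function.comp_def] at h1
  rw [h1.deriv]
  have := exp_ne_zero (2 * Real.pi * I * dev k d (coneOn φ s₀))
  have h2 := two_pi_I_ne_zero
  rw [div_eq_iff (mul_ne_zero h2 this)]
  ring

/-- From `ζ = d i - i z ^ k` one gets `dζ/ds = -i k z ^ (k-1) z'`, whose logarithmic derivative no
longer involves a branch of the power. So the two cases of the definition fit together, and
`flatLogDeriv` is holomorphic across the cut. -/
theorem flatLogDeriv_of_coneChart {s₀ z₀ : ℂ} (hz : z₀ ∉ slitArc k d)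
    (hs : φ (pr τ s₀) = coneChart k d z₀) :
    flatLogDeriv hk hd φ s₀ = (k - 1) * (deriv (coneOn φ) s₀ / coneOn φ s₀) +
      deriv (deriv (coneOn φ)) s₀ / deriv (coneOn φ) s₀ := by
  by_cases hc : s₀ ∈ offCut φ
  swap
  · rw [flatLogDeriv, if_neg hc]
  rw [flatLogDeriv, if_pos hc]
  have hzs := (mem_offCut_iff_of_coneChart hk hd φ hs).1 hc
  obtain ⟨hZ, hZd, hev⟩ := coneOn_local hk hd hφ hz hs
  have hF := flatDeriv_eq_of_coneChart hk hd hφ hz hs hzs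
  have hFe : flatDeriv hk hd φ =ᶠ[𝓝 s₀]
      fun s => -(I * (k * coneOn φ s ^ ((k : ℂ) - 1))) * deriv (coneOn φ) s := by
    filter_upwards [hev, (isOpen_offCut hk hd φ).mem_nhds hc] with s h1 h2
    exact flatDeriv_eq_of_coneChart hk hd hφ h1.1 h1.2 ((mem_offCut_iff_of_coneChart hk hd φ h1.2).1 h2)
  rw [← coneOn_eq φ hz hs hk] at hzs
  have hne : coneOn φ s₀ ≠ 0 := slitPlane_ne_zero hzs
  have h1 : HasDerivAt (fun s => coneOn φ s ^ ((k : ℂ) - 1))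
    (((k : ℂ) - 1) * coneOn φ s₀ ^ ((k : ℂ) - 1 - 1) * deriv (coneOn φ) s₀) s₀ :=
    hZ.differentiableAt.hasDerivAt.cpow_const hzs
  have h2 := ((((h1.const_mul (k : ℂ)).const_mul I).neg).mul hZ.deriv.differentiableAt.hasDerivAt)
  have hFd : deriv (flatDeriv hk hd φ) s₀ = _ := hFe.deriv_eq.trans h2.deriv
  simp only [Pi.neg_apply] at hFd
  rw [hFd, hF, cpow_sub _ 1 hne, cpow_one]
  have hp : coneOn φ s₀ ^ ((k : ℂ) - 1) ≠ 0 := by simp [cpow_eq_zero_iff, hne]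
  have hk0 : (k : ℂ) ≠ 0 := by
    have : k ≠ 0 := by linarith
    exact_mod_cast this
  generalize coneOn φ s₀ ^ ((k : ℂ) - 1) = P at hp ⊢
  have hI := I_ne_zero
  field_simp
  ring

end

/-! ### The poles of the logarithmic derivative and their residues -/

theorem exists_logDeriv_pole {W u : ℂ → ℂ} {p : ℂ} {n : ℕ} (hu : AnalyticAt ℂ u p) (hu0 : u p ≠ 0)
    (hW : ∀ᶠ z in 𝓝 p, W z = (z - p) ^ n * u z) :
    ∃ g, AnalyticAt ℂ g p ∧ ∀ᶠ z in 𝓝[≠] p, deriv W z / W z = n / (z - p) + g z := by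
  refine ⟨fun z => deriv u z / u z, hu.deriv.fun_div hu hu0, ?_⟩
  filter_upwards [mem_nhdsWithin_of_mem_nhds hW.eventually_nhds,
    mem_nhdsWithin_of_mem_nhds hu.eventually_analyticAt,
    mem_nhdsWithin_of_mem_nhds (hu.continuousAt.eventually_ne hu0), self_mem_nhdsWithin]
    with z h1 h2 h3 h4
  have hz : z - p ≠ 0 := sub_ne_zero.2 h4
  have hd : HasDerivAt (fun z => (z - p) ^ n * u z)
      ((n * (z - p) ^ (n - 1) * 1) * u z + (z - p) ^ n * deriv u z) z :=
    (((hasDerivAt_id z).sub_const p).fun_pow n).fun_mul h2.differentiableAt.hasDerivAt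
  have he : W =ᶠ[𝓝 z] fun z => (z - p) ^ n * u z := h1
  rw [he.deriv_eq, hd.deriv, he.eq_of_nhds]
  -- The case `n = 0` is separate because of the truncated exponent `n - 1`.
  rcases n with _ | n
  · field_simp; simp
  · simp only [Nat.add_sub_cancel]
    field_simp
    ring

theorem exists_logDeriv_simple_pole {W : ℂ → ℂ} {p : ℂ} (hW : AnalyticAt ℂ W p) (h0 : W p = 0)
    (hd : deriv W p ≠ 0) :
    ∃ g, AnalyticAt ℂ g p ∧ ∀ᶠ z in 𝓝[≠] p, deriv W z / W z = 1 / (z - p) + g z := by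
  obtain ⟨u, hu, hu0, h⟩ := exists_analyticAt_eq_add_mul hW
  obtain ⟨g, hg, h'⟩ := exists_logDeriv_pole (W := W) (n := 1) hu (by rwa [hu0])
    (Eventually.of_forall fun z => by rw [h z, h0, zero_add, pow_one])
  exact ⟨g, hg, by simpa using h'⟩

section
variable {k d : ℝ} (hk : 1 / 2 < k) (hd : 0 < d)

theorem e₂_eq_coneChart : e₂ hk hd = coneChart k d 0 := by
  rw [coneChart, dif_neg (zero_notMem_lowerSheet hk hd)]; rfl

include hk hd in
theorem zero_notMem_slitArc : (0 : ℂ) ∉ slitArc k d := fun h =>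
  slitPlane_ne_zero (slitArc_subset hk hd h) rfl

variable {τ : ℂ} {φ : Torus τ ≃ₜ SlitTorus k d} (hφ : IsRhombicModel hk hd φ)

include hφ

theorem flatLogDeriv_eventuallyEq_cone {s₀ z₀ : ℂ} (hz : z₀ ∉ slitArc k d)
    (hs : φ (pr τ s₀) = coneChart k d z₀) :
    flatLogDeriv hk hd φ =ᶠ[𝓝 s₀] fun s => (k - 1) * (deriv (coneOn φ) s / coneOn φ s) +
      deriv (deriv (coneOn φ)) s / deriv (coneOn φ) s := by
  filter_upwards [(coneOn_local hk hd hφ hz hs).2.2] with s h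
  exact flatLogDeriv_of_coneChart hk hd hφ h.1 h.2

theorem analyticAt_flatLogDeriv_of_ne {s₀ : ℂ} (h1 : φ (pr τ s₀) ≠ e₁ k d)
    (h2 : φ (pr τ s₀) ≠ e₂ hk hd) (hv : φ (pr τ s₀) ≠ v₂ hk hd) :
    AnalyticAt ℂ (flatLogDeriv hk hd φ) s₀ := by
  rcases chart_cases hk hd (φ (pr τ s₀)) with h | h | ⟨z, hz, h⟩ | ⟨x, h, -, -, h3⟩ | ⟨x, h, -, -, h3⟩
  · exact absurd h h1
  · exact absurd h hv
  · obtain ⟨hZ, hZd, -⟩ := coneOn_local hk hd hφ hz h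
    have hne : coneOn φ s₀ ≠ 0 := by
      rw [coneOn_eq φ hz h hk]
      rintro rfl
      exact h2 (h.trans (e₂_eq_coneChart hk hd).symm)
    exact ((analyticAt_const.mul (hZ.deriv.fun_div hZ hne)).add
      (hZ.deriv.deriv.fun_div hZ.deriv hZd)).congr
        (flatLogDeriv_eventuallyEq_cone hk hd hφ hz h).symm
  · exact analyticAt_flatLogDeriv hk hd hφ (by
      change _ ∉ _; rw [h3]; exact edgeChart_notMem_cutRay hk hd _ _ h) hv
  · exact analyticAt_flatLogDeriv hk hd hφ (by
      change _ ∉ _; rw [h3]; exact edgeChart_notMem_cutRay hk hd _ _ h) hv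

/-- `z` is a local coordinate that vanishes at `e₂`, so `(k - 1) z'/z` has residue `k - 1` and
`z''/z'` is regular. -/
theorem pole_e₂ {s₀ : ℂ} (hs : φ (pr τ s₀) = e₂ hk hd) :
    ∃ g, AnalyticAt ℂ g s₀ ∧
      ∀ᶠ z in 𝓝[≠] s₀, flatLogDeriv hk hd φ z = ((k - 1 : ℝ) : ℂ) / (z - s₀) + g z := by
  rw [e₂_eq_coneChart] at hs
  have hz := zero_notMem_slitArc hk hd
  obtain ⟨hZ, hZd, -⟩ := coneOn_local hk hd hφ hz hs
  obtain ⟨g, hg, he⟩ := exists_logDeriv_simple_pole hZ (coneOn_eq φ hz hs hk) hZd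
  refine ⟨fun z => (k - 1) * g z + deriv (deriv (coneOn φ)) z / deriv (coneOn φ) z,
    (analyticAt_const.mul hg).add (hZ.deriv.deriv.fun_div hZ.deriv hZd), ?_⟩
  filter_upwards [he, mem_nhdsWithin_of_mem_nhds (flatLogDeriv_eventuallyEq_cone hk hd hφ hz hs)]
    with z h1 h2
  rw [h2, h1]
  push_cast
  ring

/-- The residue is the order of the zero of `dζ`, which is not computed here: its value follows
later from the sum of the residues. -/
theorem pole_v₂ {s₀ : ℂ} (hs : φ (pr τ s₀) = v₂ hk hd) :
    ∃ r : ℝ, ∃ g, AnalyticAt ℂ g s₀ ∧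
      ∀ᶠ z in 𝓝[≠] s₀, flatLogDeriv hk hd φ z = r / (z - s₀) + g z := by
  have hc : s₀ ∈ offCut φ := by
    change _ ∉ _; rw [hs]; exact v₂_notMem_cutRay hk hd
  have hF := analyticAt_flatDeriv hk hd hφ hc
  have hne : ∀ᶠ s in 𝓝[≠] s₀, flatDeriv hk hd φ s ≠ 0 := by
    filter_upwards [eventually_ne_of_eq hk hd hφ hs,
      mem_nhdsWithin_of_mem_nhds ((isOpen_offCut hk hd φ).mem_nhds hc)] with s h1 h2
    exact flatDeriv_ne_zero hk hd hφ h2 h1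
  have hnz : ¬ ∀ᶠ s in 𝓝 s₀, flatDeriv hk hd φ s = 0 := fun h => by
    obtain ⟨s, h1, h2⟩ := (hne.and (h.filter_mono nhdsWithin_le_nhds)).exists
    exact h1 h2
  obtain ⟨n, u, hu, hu0, hev⟩ := hF.exists_eventuallyEq_pow_smul_nonzero_iff.2 hnz
  obtain ⟨g, hg, h⟩ := exists_logDeriv_pole (n := n) hu hu0 hev
  refine ⟨n, g, hg, ?_⟩
  filter_upwards [h, mem_nhdsWithin_of_mem_nhds (flatLogDeriv_eventuallyEq hk hd hc)] with z h1 h2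
  rw [h2, h1]
  simp

/-- `V = 1/z` is a local coordinate at `e₁`. As `z'/z = -V'/V` and `z''/z' = V''/V' - 2 V'/V`, the
residue is `-(k - 1) - 2`. -/
theorem pole_e₁ {s₀ : ℂ} (hs : φ (pr τ s₀) = e₁ k d) :
    ∃ g, AnalyticAt ℂ g s₀ ∧
      ∀ᶠ z in 𝓝[≠] s₀, flatLogDeriv hk hd φ z = ((-(k + 1) : ℝ) : ℂ) / (z - s₀) + g z := by
  obtain ⟨C, hC⟩ := (isCompact_slitArc (k := k) hd).isBounded.exists_norm_le
  have hcont : Tendsto (fun s => φ (pr τ s)) (𝓝 s₀) (𝓝 (e₁ k d)) := by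
    rw [← hs]; exact (φ.continuous.comp continuous_pr).continuousAt
  have hcone : ∀ M : ℝ, ∀ᶠ s in 𝓝 s₀, φ (pr τ s) ≠ e₁ k d → M < ‖coneOn φ s‖ ∧
      coneOn φ s ∉ slitArc k d ∧ φ (pr τ s) = coneChart k d (coneOn φ s) := by
    intro M
    filter_upwards [hcont.eventually (eventually_coneVal_large hk (max M C))] with s h hne
    rcases eq_e₁_or_coneChart_or hk hd (φ (pr τ s)) with h1 | h1 | ⟨z, hz, h1⟩
    · exact absurd h1 hne
    · have := hC _ (zero_mem_slitArc (k := k) (d := d))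
      have h2 := h _ h1
      exact absurd this (not_le.2 ((le_max_right _ _).trans_lt h2))
    · have h2 := coneOn_eq φ hz h1 hk
      have h3 := h z (by rw [h1, coneVal_coneChart hk hz])
      rw [h2]
      exact ⟨(le_max_left _ _).trans_lt h3, hz, h1⟩
  have hpun := eventually_ne_of_eq hk hd hφ hs
  -- The default value of `coneOn` at infinity is `0`, and `0⁻¹ = 0`, so `V` has at `s₀` the value
  -- that makes it continuous.
  have hZ0 : coneOn φ s₀ = 0 := by rw [coneOn, hs, coneVal_e₁]; rfl
  set V : ℂ → ℂ := fun s => (coneOn φ s)⁻¹ with hV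
  have hV0 : V s₀ = 0 := by simp [hV, hZ0]
  have hgood : ∀ᶠ s in 𝓝[≠] s₀, coneOn φ s ≠ 0 ∧ coneOn φ s ∉ slitArc k d ∧
      φ (pr τ s) = coneChart k d (coneOn φ s) := by
    filter_upwards [hpun, mem_nhdsWithin_of_mem_nhds (hcone 0)] with s h1 h2
    exact ⟨norm_pos_iff.1 (h2 h1).1, (h2 h1).2⟩
  have hVa : AnalyticAt ℂ V s₀ := by
    refine analyticAt_of_differentiable_on_punctured_nhds_of_continuousAt ?_ ?_
    · filter_upwards [hgood] with s h
      exact ((coneOn_local hk hd hφ h.2.1 h.2.2).1.fun_inv h.1).differentiableAt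
    · rw [ContinuousAt, hV0, Metric.tendsto_nhds]
      intro ε hε
      filter_upwards [hcone ε⁻¹] with s h
      rw [dist_zero_right, hV, norm_inv]
      by_cases h1 : φ (pr τ s) = e₁ k d
      · rw [coneOn, h1, coneVal_e₁]; simpa using hε
      · exact inv_lt_of_inv_lt₀ hε (h h1).1
  -- `V` is injective near `s₀`, since `z` determines the point off the slit.
  have hVd : deriv V s₀ ≠ 0 := by
    obtain ⟨U, hU, hinj⟩ := exists_nhds_injOn_pr hφ.norm_eq hφ.im_ne s₀
    refine deriv_ne_zero_of_injOn_nhds hVa (inter_mem hU (eventually_nhdsWithin_iff.1 hgood)) ?_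
    intro s hs1 s' hs1' he
    have he' : coneOn φ s = coneOn φ s' := inv_injective he
    by_cases h1 : s = s₀
    · by_cases h2 : s' = s₀
      · rw [h1, h2]
      · rw [h1, hZ0] at he'
        exact absurd he'.symm (hs1'.2 h2).1
    · by_cases h2 : s' = s₀
      · rw [h2, hZ0] at he'
        exact absurd he' (hs1.2 h1).1
      · refine hinj hs1.1 hs1'.1 (φ.injective ?_)
        rw [(hs1.2 h1).2.2, (hs1'.2 h2).2.2, he']
  obtain ⟨g, hg, he⟩ := exists_logDeriv_simple_pole hVa hV0 hVd
  refine ⟨fun z => -(k + 1) * g z + deriv (deriv V) z / deriv V z,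
    (analyticAt_const.mul hg).add (hVa.deriv.deriv.fun_div hVa.deriv hVd), ?_⟩
  filter_upwards [he, hgood, mem_nhdsWithin_of_mem_nhds hVa.eventually_analyticAt,
    mem_nhdsWithin_of_mem_nhds (hVa.deriv.continuousAt.eventually_ne hVd)] with z h1 h2 h3 h4
  have hVz : V z ≠ 0 := inv_ne_zero h2.1
  have hZV : coneOn φ = fun s => (V s)⁻¹ := by funext s; simp [hV]
  have hZ1 : deriv (coneOn φ) =ᶠ[𝓝 z] fun s => -deriv V s / V s ^ 2 := by
    filter_upwards [h3.eventually_analyticAt, h3.continuousAt.eventually_ne hVz] with s h5 h6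
    rw [hZV]
    exact (h5.differentiableAt.hasDerivAt.fun_inv h6).deriv
  have hZ2 := ((h3.deriv.differentiableAt.hasDerivAt.fun_neg).fun_div
    (h3.differentiableAt.hasDerivAt.fun_pow 2) (pow_ne_zero 2 hVz)).deriv
  rw [flatLogDeriv_of_coneChart hk hd hφ h2.2.1 h2.2.2, hZ1.deriv_eq, hZ1.eq_of_nhds, hZ2,
    show coneOn φ z = (V z)⁻¹ by rw [hZV]]
  push_cast
  have e1 : (↑k - 1) * (-deriv V z / V z ^ 2 / (V z)⁻¹) = -(k - 1) * (1 / (z - s₀) + g z) := by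
    rw [← h1]; field_simp
  have e2 : (-deriv (deriv V) z * V z ^ 2 - -deriv V z * (2 * V z ^ (2 - 1) * deriv V z)) / (V z ^ 2) ^ 2 /
      (-deriv V z / V z ^ 2) = deriv (deriv V) z / deriv V z - 2 * (1 / (z - s₀) + g z) := by
    rw [← h1]; simp only [show 2 - 1 = 1 from rfl, pow_one]; field_simp; ring
  rw [e1, e2]
  ring

end

/-! ### Behaviour on the real axis between the two ends -/

section
variable {k d : ℝ} (hk : 1 / 2 < k) (hd : 0 < d)
variable {τ : ℂ} {φ : Torus τ ≃ₜ SlitTorus k d}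

/-- The positions of the ends and of the cut on the horizontal diagonal. -/
structure HasEnds (φ : Torus τ ≃ₜ SlitTorus k d) (b : ℝ) : Prop where
  pos : 0 < b
  lt_one : b < 1
  left : φ (pr τ ((-b : ℝ) : ℂ)) = e₁ k d
  right : φ (pr τ b) = e₂ hk hd
  cut : φ '' (diag τ '' Icc b (2 - b)) = cutRay k d

theorem IsRhombicModel.exists_hasEnds (hφ : IsRhombicModel hk hd φ) :
    ∃ b, HasEnds hk hd φ b := by
  obtain ⟨b, h0, h1, h2, h3, h4⟩ := hφ.ends
  exact ⟨b, h0, h1, by rw [← diag_eq_pr, ← h2]; simp, by rw [← diag_eq_pr, ← h3]; simp, h4⟩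

theorem v₂_eq_edgeChart : v₂ hk hd = edgeChart hk 0 ((0 : ℝ) * I) (by simpa using hd) := by
  rw [edgeChart, dif_pos (by simp)]
  simp only [ofReal_zero, zero_mul]
  rfl

theorem deriv_periodic {G : ℂ → ℂ} {c : ℂ} (h : ∀ s, G (s + c) = G s) (s : ℂ) :
    deriv G (s + c) = deriv G s := by
  rw [← deriv_comp_add_const]
  congr 1
  exact funext h

theorem periodic_flatDeriv {c : ℂ} (hc : ∀ s, pr τ (s + c) = pr τ s) (s : ℂ) :
    flatDeriv hk hd φ (s + c) = flatDeriv hk hd φ s := by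
  have h : ∀ s, flatExpOn hk hd φ (s + c) = flatExpOn hk hd φ s := fun s => by
    rw [flatExpOn, hc, flatExpOn]
  rw [flatDeriv, h, deriv_periodic h, flatDeriv]

theorem periodic_flatLogDeriv {c : ℂ} (hc : ∀ s, pr τ (s + c) = pr τ s) (s : ℂ) :
    flatLogDeriv hk hd φ (s + c) = flatLogDeriv hk hd φ s := by
  have h1 : s + c ∈ offCut φ ↔ s ∈ offCut φ := by simp only [offCut, mem_ofPred_eq, hc]
  have h2 : ∀ s, coneOn φ (s + c) = coneOn φ s := fun s => by rw [coneOn, hc, coneOn]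
  rw [flatLogDeriv, flatLogDeriv]
  simp only [h1, h2, periodic_flatDeriv hk hd hc, deriv_periodic (periodic_flatDeriv hk hd hc),
    deriv_periodic h2, deriv_periodic (deriv_periodic h2)]
  by_cases h : s ∈ offCut φ
  · rw [if_pos (h1.2 h), if_pos h]
  · rw [if_neg (mt h1.1 h), if_neg h]

variable {hk hd} {b : ℝ} (hφ : IsRhombicModel hk hd φ) (he : HasEnds hk hd φ b)

include hφ

theorem hasDerivAt_flatDeriv {s : ℂ} (hs : s ∈ offCut φ) (hv : φ (pr τ s) ≠ v₂ hk hd) :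
    HasDerivAt (flatDeriv hk hd φ) (flatLogDeriv hk hd φ s * flatDeriv hk hd φ s) s := by
  have h := (analyticAt_flatDeriv hk hd hφ hs).differentiableAt.hasDerivAt
  rwa [flatLogDeriv, if_pos hs, div_mul_cancel₀ _ (flatDeriv_ne_zero hk hd hφ hs hv)]

/-- Off the real axis the strip covers no point of the horizontal diagonal. -/
theorem pr_ne_pr_ofReal {s : ℂ} (hs : s ∈ strip 0 (stripHeight τ)) (x : ℝ) : pr τ s ≠ pr τ x := by
  intro h
  obtain ⟨n, hn⟩ := eq_add_two_of_pr_eq hφ.norm_eq hφ.im_ne h (by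
    rw [ofReal_im, sub_zero, abs_of_pos hs.1]; exact hs.2)
  have := hs.1
  rw [hn] at this
  simp at this

include he

omit hφ in
theorem exists_real_of_mem_cutRay {s : ℂ} (h : φ (pr τ s) ∈ cutRay k d) :
    ∃ t ∈ Icc b (2 - b), pr τ s = pr τ (t : ℝ) := by
  rw [← he.cut] at h
  obtain ⟨_, ⟨t, ht, rfl⟩, h⟩ := h
  exact ⟨t, ht, φ.injective h.symm⟩

theorem ofReal_mem_offCut {x : ℝ} (hx : x ∈ Ioo (-b) b) : (x : ℂ) ∈ offCut φ := by
  intro h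
  obtain ⟨t, ht, h2⟩ := exists_real_of_mem_cutRay he h
  obtain ⟨n, hn⟩ := eq_add_two_of_pr_eq hφ.norm_eq hφ.im_ne h2
    (by simpa using stripHeight_pos hφ.norm_eq hφ.im_ne)
  have hn' : x = t + 2 * n := by exact_mod_cast hn
  have h3 : -1 < (n : ℝ) := by linarith [hx.1, ht.2]
  have h4 : (n : ℝ) < 0 := by linarith [hx.2, ht.1]
  have h3' : -1 < n := by exact_mod_cast h3
  have h4' : n < 0 := by exact_mod_cast h4
  omega

theorem strip_subset_offCut : strip 0 (stripHeight τ) ⊆ offCut φ := by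
  intro s hs h
  obtain ⟨t, -, h2⟩ := exists_real_of_mem_cutRay he h
  exact pr_ne_pr_ofReal hφ hs t h2

theorem exists_real_of_height {η : ℝ} (h : ((η : ℂ) * I).im < d) :
    ∃ x ∈ Ioo (-b) b, φ (pr τ (x : ℝ)) = edgeChart hk 0 (η * I) h := by
  have h1 := mem_imaginaryAxis_edgeChart hk h
  have h2 := edgeChart_notMem_cutRay hk hd 0 _ h
  rw [← hφ.image_diag] at h1
  obtain ⟨_, ⟨t, ht, rfl⟩, h1⟩ := h1
  rw [diag_eq_pr] at h1
  refine ⟨t, ⟨?_, ?_⟩, h1⟩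
  · by_contra hcon
    refine h2 ?_
    rw [← h1, ← he.cut]
    -- A parameter in `[-1, -b]` lies on the cut: the period `2` moves it into `[b, 2 - b]`.
    refine mem_image_of_mem _ ⟨t + 2, ⟨by linarith [ht.1, he.lt_one], by linarith [not_lt.1 hcon]⟩, ?_⟩
    rw [diag_eq_pr, ofReal_add, ofReal_ofNat, pr_add_two hφ.norm_eq hφ.im_ne]
  · by_contra hcon
    refine h2 ?_
    rw [← h1, ← he.cut]
    exact mem_image_of_mem _ ⟨t, ⟨not_lt.1 hcon, by linarith [ht.2, he.lt_one]⟩, rfl⟩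

theorem exists_height_of_real {x : ℝ} (hx : x ∈ Ioo (-b) b) :
    ∃ η : ℝ, ∃ h : ((η : ℂ) * I).im < d, φ (pr τ x) = edgeChart hk 0 (η * I) h := by
  refine exists_of_mem_imaginaryAxis hk hd ?_ (ofReal_mem_offCut hφ he hx)
  rw [← hφ.image_diag]
  exact mem_image_of_mem _ ⟨x, ⟨by linarith [hx.1, he.lt_one], by linarith [hx.2, he.lt_one]⟩, rfl⟩

omit hφ he in
theorem flatExpOn_of_height {x η : ℝ} {h : ((η : ℂ) * I).im < d}
    (hx : φ (pr τ x) = edgeChart hk 0 (η * I) h) :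
    flatExpOn hk hd φ x = (Real.exp (-(2 * Real.pi * η)) : ℝ) := by
  rw [flatExpOn, hx, ← Int.cast_zero, flatExp_edgeChart hk hd 0]
  push_cast
  congr 1
  linear_combination (2 * Real.pi * η : ℂ) * I_mul_I

theorem flatExpOn_real {x : ℝ} (hx : x ∈ Ioo (-b) b) :
    flatExpOn hk hd φ x = ((flatExpOn hk hd φ x).re : ℝ) ∧
      Real.exp (-(2 * Real.pi * d)) < (flatExpOn hk hd φ x).re := by
  obtain ⟨η, h, hx⟩ := exists_height_of_real hφ he hx
  rw [flatExpOn_of_height hx, ofReal_re]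
  refine ⟨rfl, Real.exp_lt_exp.2 (neg_lt_neg ?_)⟩
  exact mul_lt_mul_of_pos_left (by simpa using h) (by positivity)

theorem hasDerivAt_flatExpOn_re {x : ℝ} (hx : x ∈ Ioo (-b) b) :
    HasDerivAt (fun x : ℝ => (flatExpOn hk hd φ x).re) (deriv (flatExpOn hk hd φ) x).re x :=
  (analyticAt_flatExpOn hk hd hφ
    (ofReal_mem_offCut hφ he hx)).differentiableAt.hasDerivAt.real_of_complex

/-- `e₂` lies on the cut, but `z ^ k` is continuous at its branch point `0`. The limit decides the
direction in which the axis is traversed. -/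
theorem tendsto_flatExpOn_right :
    Tendsto (fun x : ℝ => (flatExpOn hk hd φ x).re) (𝓝 b) (𝓝 (Real.exp (-(2 * Real.pi * d)))) := by
  have hz := zero_notMem_slitArc hk hd
  have hs : φ (pr τ (b : ℂ)) = coneChart k d 0 := by rw [he.right, e₂_eq_coneChart]
  have hZ := (coneOn_local hk hd hφ hz hs).1.continuousAt
  have hdev : ContinuousAt (dev k d) 0 := by
    refine continuousAt_const.sub (continuousAt_const.mul ?_)
    exact continuousAt_cpow_const_of_re_pos (Or.inl le_rfl) (by rw [ofReal_re]; linarith)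
  have h0 := coneOn_eq φ hz hs hk
  have h1 : Tendsto (fun s => exp (2 * Real.pi * I * dev k d (coneOn φ s))) (𝓝 (b : ℂ))
      (𝓝 (exp (2 * Real.pi * I * dev k d 0))) := by
    rw [ContinuousAt, h0] at hZ
    exact ((hdev.tendsto.comp hZ).const_mul _).cexp
  have h2 := h1.congr' ((flatExpOn_eventuallyEq_dev hk hd hφ hz hs).mono fun _ h => h.symm)
  have h3 : exp (2 * Real.pi * I * dev k d 0) = (Real.exp (-(2 * Real.pi * d)) : ℝ) := by
    rw [dev_zero hk]
    push_cast
    congr 1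
    linear_combination (2 * Real.pi * d : ℂ) * I_mul_I
  rw [h3] at h2
  have h4 := (continuous_re.tendsto _).comp (h2.comp (continuous_ofReal.tendsto b))
  rwa [ofReal_re] at h4

/-- A point at height `η < d` has the value `exp (-2 π η)`, and this determines the point. So the
function is continuous and injective, hence strictly monotone. Towards `e₂`, at the right end, it
tends to `exp (-2 π d)`, a strict lower bound, so it decreases: the height grows from left to right.
-/
theorem strictAntiOn_flatExpOn :
    StrictAntiOn (fun x : ℝ => (flatExpOn hk hd φ x).re) (Ioo (-b) b) := by
  have hb := he.pos
  have hc : ContinuousOn (fun x : ℝ => (flatExpOn hk hd φ x).re) (Ioo (-b) b) := fun x hx =>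
    (hasDerivAt_flatExpOn_re hφ he hx).continuousAt.continuousWithinAt
  have hinj : InjOn (fun x : ℝ => (flatExpOn hk hd φ x).re) (Ioo (-b) b) := by
    intro x hx x' hx' h
    obtain ⟨η, h1, h2⟩ := exists_height_of_real hφ he hx
    obtain ⟨η', h1', h2'⟩ := exists_height_of_real hφ he hx'
    simp only [flatExpOn_of_height h2, flatExpOn_of_height h2', ofReal_re] at h
    have h3 := Real.exp_injective h
    have h4 : η = η' := mul_left_cancel₀ (by positivity : (2 * Real.pi) ≠ 0) (neg_injective h3)
    subst h4
    have h5 : pr τ (x : ℂ) = pr τ (x' : ℂ) := φ.injective (h2.trans h2'.symm)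
    refine ofReal_injective (eq_of_pr_eq hφ.norm_eq hφ.im_ne h5
      (by simpa using stripHeight_pos hφ.norm_eq hφ.im_ne) ?_)
    have := he.lt_one
    exact abs_lt.2 ⟨by simp; linarith [hx.1, hx'.2], by simp; linarith [hx.2, hx'.1]⟩
  refine (hc.strictMonoOn_of_injOn_Ioo (by linarith) hinj).resolve_left fun hm => ?_
  have h0 : (0 : ℝ) ∈ Ioo (-b) b := ⟨by linarith, hb⟩
  have h1 := (flatExpOn_real hφ he h0).2
  have h2 : ∀ᶠ x in 𝓝[<] b, (flatExpOn hk hd φ (0 : ℝ)).re ≤ (flatExpOn hk hd φ (x : ℝ)).re := by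
    filter_upwards [Ioo_mem_nhdsLT hb] with x hx
    exact (hm h0 ⟨by linarith [hx.1], hx.2⟩ hx.1).le
  exact absurd (ge_of_tendsto ((tendsto_flatExpOn_right hφ he).mono_left nhdsWithin_le_nhds) h2)
    (not_le.2 h1)

/-- On the real axis between the ends, `dζ/ds` is a nonnegative multiple of `i`. -/
theorem exists_flatDeriv_real {x : ℝ} (hx : x ∈ Ioo (-b) b) :
    ∃ f : ℝ, 0 ≤ f ∧ flatDeriv hk hd φ x = f * I := by
  have hd1 := hasDerivAt_flatExpOn_re hφ he hx
  have hle : (deriv (flatExpOn hk hd φ) x).re ≤ 0 := by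
    have := (strictAntiOn_flatExpOn hφ he).antitoneOn.derivWithin_nonpos (x := x)
    rwa [derivWithin_of_isOpen isOpen_Ioo hx, hd1.deriv] at this
  have hy := flatExpOn_real hφ he hx
  have hpos := (Real.exp_pos _).trans hy.2
  have him : (deriv (flatExpOn hk hd φ) x).im = 0 := by
    have h1 := (analyticAt_flatExpOn hk hd hφ
      (ofReal_mem_offCut hφ he hx)).differentiableAt.hasDerivAt.comp_ofReal
    have h2 := imCLM.hasFDerivAt.comp_hasDerivAt x h1
    have h3 : (imCLM ∘ fun y : ℝ => flatExpOn hk hd φ y) =ᶠ[𝓝 x] fun _ => (0 : ℝ) := by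
      filter_upwards [isOpen_Ioo.mem_nhds hx] with y hy
      rw [Function.comp_apply, (flatExpOn_real hφ he hy).1]
      simp
    exact (h2.unique ((hasDerivAt_const x (0 : ℝ)).congr_of_eventuallyEq h3))
  refine ⟨-(deriv (flatExpOn hk hd φ) x).re / (2 * Real.pi * (flatExpOn hk hd φ x).re),
    div_nonneg (by linarith) (by positivity), ?_⟩
  rw [flatDeriv, show deriv (flatExpOn hk hd φ) x = ((deriv (flatExpOn hk hd φ) x).re : ℝ) from
    Complex.ext rfl (by simpa using him), hy.1]
  simp only [ofReal_re]
  have h1 : ((flatExpOn hk hd φ x).re : ℂ) ≠ 0 := by exact_mod_cast hpos.ne'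
  have h2 : (Real.pi : ℂ) ≠ 0 := by exact_mod_cast Real.pi_ne_zero
  push_cast
  field_simp
  rw [I_sq]; ring

theorem exists_flatDeriv_pos {x : ℝ} (hx : x ∈ Ioo (-b) b) (hv : φ (pr τ x) ≠ v₂ hk hd) :
    ∃ f : ℝ, 0 < f ∧ flatDeriv hk hd φ x = f * I := by
  obtain ⟨f, h0, h⟩ := exists_flatDeriv_real hφ he hx
  refine ⟨f, lt_of_le_of_ne h0 ?_, h⟩
  rintro rfl
  exact flatDeriv_ne_zero hk hd hφ (ofReal_mem_offCut hφ he hx) hv (by rw [h]; simp)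

/-- On this interval `F` is `i` times a real function, so `F'/F` is real. -/
theorem flatLogDeriv_real {x : ℝ} (hx : x ∈ Ioo (-b) b) (hv : φ (pr τ x) ≠ v₂ hk hd) :
    (flatLogDeriv hk hd φ x).im = 0 := by
  have hc := ofReal_mem_offCut hφ he hx
  obtain ⟨f, hf0, hf⟩ := exists_flatDeriv_pos hφ he hx hv
  have h1 := (analyticAt_flatDeriv hk hd hφ hc).differentiableAt.hasDerivAt.real_of_complex
  have h3 : (fun y : ℝ => (flatDeriv hk hd φ y).re) =ᶠ[𝓝 x] fun _ => (0 : ℝ) := by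
    filter_upwards [isOpen_Ioo.mem_nhds hx] with y hy
    obtain ⟨g, -, hg⟩ := exists_flatDeriv_real hφ he hy
    rw [hg]; simp
  have h4 := h1.unique ((hasDerivAt_const x (0 : ℝ)).congr_of_eventuallyEq h3)
  rw [flatLogDeriv, if_pos hc, hf, show deriv (flatDeriv hk hd φ) x =
    ((deriv (flatDeriv hk hd φ) x).im : ℝ) * I from Complex.ext (by simpa using h4) (by simp),
    mul_div_mul_right _ _ I_ne_zero, ← ofReal_div, ofReal_im]

theorem hasStripPoles_flatLogDeriv {a : ℝ} (ha : φ (pr τ a) = v₂ hk hd) :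
    ∃ r : ℝ, HasStripPoles (stripHeight τ) ![-b, a, b] ![-(k + 1), r, k - 1]
      (flatLogDeriv hk hd φ) := by
  obtain ⟨r, hr⟩ := pole_v₂ hk hd hφ ha
  refine ⟨r, ⟨?_, ?_, ?_, ?_⟩⟩
  · exact periodic_flatLogDeriv hk hd (pr_add_two hφ.norm_eq hφ.im_ne)
  · exact periodic_flatLogDeriv hk hd (pr_add_half hφ.norm_eq hφ.im_ne)
  · intro s hs hne
    have key : ∀ (x : ℝ) (p : SlitTorus k d), φ (pr τ x) = p → (∀ n : ℤ, s ≠ x + 2 * n) →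
        φ (pr τ s) ≠ p := by
      rintro x _ rfl h1 h2
      obtain ⟨n, hn⟩ := eq_add_two_of_pr_eq hφ.norm_eq hφ.im_ne (φ.injective h2) (by simpa using hs)
      exact h1 n hn
    exact analyticAt_flatLogDeriv_of_ne hk hd hφ (key _ _ he.left (hne 0))
      (key _ _ he.right (hne 2)) (key _ _ ha (hne 1))
  · intro i
    fin_cases i
    · exact pole_e₁ hk hd hφ he.left
    · exact hr
    · exact pole_e₂ hk hd hφ he.right

end

/-! ### The lifted arc and the conclusion -/

theorem eventually_slope_pos {g : ℝ → ℝ} {g' x : ℝ} (hg : HasDerivWithinAt g g' (Icc 0 1) x)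
    (hg' : 0 < g') (hx : x ∉ Ioo (0 : ℝ) 1) : ∀ᶠ t in 𝓝[Ioo 0 1] x, 0 < (t - x)⁻¹ * (g t - g x) := by
  have h := (hasDerivWithinAt_iff_tendsto_slope.1 hg).eventually (lt_mem_nhds hg')
  refine Filter.Eventually.filter_mono (nhdsWithin_mono x ?_) h
  intro t ht
  refine ⟨Ioo_subset_Icc_self ht, ?_⟩
  rintro rfl
  exact hx ht

section
variable {k d : ℝ} {hk : 1 / 2 < k} {hd : 0 < d}

theorem edgeChart_arcCoord_zero (hd : 0 < d) (h : (arcCoord d 0).im < d)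
    (h' : (((-(d / 2) : ℝ) : ℂ) * I).im < d) :
    edgeChart hk (-1) (arcCoord d 0) h = edgeChart hk 0 (((-(d / 2) : ℝ) : ℂ) * I) h' := by
  rw [edgeChart, edgeChart, dif_neg, dif_neg]
  · congr 2
    simp [arcCoord]
  · simpa using hd
  · simpa [arcCoord] using hd

theorem edgeChart_arcCoord_one (hd : 0 < d) (h : (arcCoord d 1).im < d)
    (h' : (((d / 2 : ℝ) : ℂ) * I).im < d) :
    edgeChart hk (-1) (arcCoord d 1) h = edgeChart hk 0 (((d / 2 : ℝ) : ℂ) * I) h' := by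
  have e : arcCoord d 1 = ((d / 2 : ℝ) : ℂ) * I := by simp [arcCoord]; norm_num
  rw [edgeChart, edgeChart, dif_pos, dif_pos]
  · congr 3
  · simpa using (half_pos hd).le
  · rw [e]; simpa using (half_pos hd).le

theorem hasDerivAt_arcCoord (t : ℝ) : HasDerivAt (arcCoord d) (-1 + d * I) t := by
  have h1 : HasDerivAt (fun t : ℝ => ((1 - t : ℝ) : ℂ)) ((-1 : ℝ) : ℂ) t :=
    ((hasDerivAt_id t).const_sub 1).ofReal_comp
  have h2 : HasDerivAt (fun t : ℝ => (((2 * t - 1) * (d / 2) : ℝ) : ℂ))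
      ((2 * 1 * (d / 2) : ℝ) : ℂ) t :=
    ((((hasDerivAt_id t).const_mul 2).sub_const 1).mul_const (d / 2)).ofReal_comp
  have h3 := h1.add (h2.mul_const I)
  convert! h3 using 1
  push_cast; ring

variable {τ : ℂ} {φ : Torus τ ≃ₜ SlitTorus k d} {b : ℝ}
  (hφ : IsRhombicModel hk hd φ) (he : HasEnds hk hd φ b)

include hφ

theorem flatDeriv_eq_of_pr_eq {s s' : ℂ} (h : pr τ s = pr τ s') :
    flatDeriv hk hd φ s = flatDeriv hk hd φ s' := by
  obtain ⟨m, n, hs⟩ := (pr_eq_iff hφ.norm_eq hφ.im_ne).1 h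
  rw [hs, add_assoc]
  exact periodic_flatDeriv hk hd
    (fun z => (pr_eq_iff hφ.norm_eq hφ.im_ne).2 ⟨m, n, by rw [add_assoc]⟩) s'

/-- A curve whose image under the flat coordinate is the arc: the velocity. -/
theorem hasDerivWithinAt_of_flatExpOn_eq {γ ξ : ℝ → ℂ} {S : Set ℝ} {t : ℝ} {c : ℂ}
    (hγ : ContinuousWithinAt γ S t) (ht : t ∈ S) (hc : γ t ∈ offCut φ)
    (hv : φ (pr τ (γ t)) ≠ v₂ hk hd)
    (hY : ∀ u ∈ S, flatExpOn hk hd φ (γ u) = exp (2 * Real.pi * I * ξ u)) (hξ : HasDerivAt ξ c t) :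
    HasDerivWithinAt γ (c / flatDeriv hk hd φ (γ t)) S t := by
  obtain ⟨ha, hd0⟩ := flatExpOn_local hk hd hφ hc hv
  have hs := ha.hasStrictDerivAt
  have hleft := hs.eventually_left_inverse hd0
  have hinv := (hs.to_localInverse hd0).hasDerivAt
  have hexp : HasDerivAt (fun u => exp (2 * Real.pi * I * ξ u))
      (exp (2 * Real.pi * I * ξ t) * (2 * Real.pi * I * c)) t := (hξ.const_mul _).cexp
  rw [hY t ht] at hinv
  have h1 := (hinv.comp t hexp).hasDerivWithinAt (s := S)
  have h2 : ∀ᶠ u in 𝓝[S] t, γ u = (hs.localInverse (flatExpOn hk hd φ) _ _ hd0 ∘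
      fun u => exp (2 * Real.pi * I * ξ u)) u := by
    filter_upwards [hγ.eventually hleft, self_mem_nhdsWithin] with u h3 h4
    rw [Function.comp_apply, ← hY u h4, h3]
  have h3 := h1.congr_of_eventuallyEq h2 (h2.self_of_nhdsWithin ht)
  convert! h3 using 1
  rw [flatDeriv, ← hY t ht]
  have := flatExpOn_ne_zero hk hd φ hc
  have h4 := two_pi_I_ne_zero
  field_simp

include he

theorem lt_of_height_lt {x x' η η' : ℝ} {h : ((η : ℂ) * I).im < d} {h' : ((η' : ℂ) * I).im < d}
    (hx : x ∈ Ioo (-b) b) (hx' : x' ∈ Ioo (-b) b) (hη : φ (pr τ x) = edgeChart hk 0 (η * I) h)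
    (hη' : φ (pr τ x') = edgeChart hk 0 (η' * I) h') (hlt : η < η') : x < x' := by
  rw [← (strictAntiOn_flatExpOn hφ he).lt_iff_gt hx' hx, flatExpOn_of_height hη,
    flatExpOn_of_height hη', ofReal_re, ofReal_re, Real.exp_lt_exp, neg_lt_neg_iff]
  exact mul_lt_mul_of_pos_left hlt (by positivity)

omit he in
theorem exists_height_of_pr_eq {s : ℂ} {x : ℝ} (hs : s ∈ offCut φ) (h : pr τ s = pr τ x) :
    ∃ η : ℝ, ∃ h : ((η : ℂ) * I).im < d, φ (pr τ s) = edgeChart hk 0 (η * I) h := by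
  refine exists_of_mem_imaginaryAxis hk hd ?_ hs
  rw [← hφ.image_diag, h]
  -- Subtracting the even integer nearest to `x` brings it into `[-1, 1]`, the range of parameters
  -- of the diagonal.
  refine mem_image_of_mem _ ⟨x - 2 * (round (x / 2) : ℤ), ?_, ?_⟩
  · have := abs_le.1 (abs_sub_round (x / 2))
    exact ⟨by linarith [this.1], by linarith [this.2]⟩
  · rw [diag_eq_pr]
    exact (pr_eq_iff hφ.norm_eq hφ.im_ne).2 ⟨-round (x / 2), round (x / 2), by push_cast; ring⟩

/-- The arc that is straight in `ζ` meets the imaginary axis only at its ends, so the interior of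
its lift from `x₀` avoids the lines `Im s = j T`. It leaves the real axis upwards, hence stays in
the strip, and it must end on the upper edge, over `x₁`. This is the configuration of
`HasStripPoles.relation_of_arc`. -/
theorem relation_of_hasEnds : ∃ a : ℝ, φ (pr τ a) = v₂ hk hd ∧ a ∈ Ioo (-b) b ∧ a + k * b = k := by
  have hT := stripHeight_pos hφ.norm_eq hφ.im_ne
  obtain ⟨a, ha, hva⟩ := exists_real_of_height hφ he (η := 0) (by simpa using hd)
  have hva' : φ (pr τ a) = v₂ hk hd := hva.trans (v₂_eq_edgeChart hk hd).symm
  have hm : (((-(d / 2) : ℝ) : ℂ) * I).im < d := by simp; linarith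
  have hp : (((d / 2 : ℝ) : ℂ) * I).im < d := by simp; linarith
  obtain ⟨x₀, hx₀, hφ₀⟩ := exists_real_of_height hφ he hm
  obtain ⟨x₁, hx₁, hφ₁⟩ := exists_real_of_height hφ he hp
  have h0a := lt_of_height_lt hφ he hx₀ ha hφ₀ hva (by linarith)
  have ha1 := lt_of_height_lt hφ he ha hx₁ hva hφ₁ (by linarith)
  have hne : ∀ x : ℝ, x ∈ Ioo (-b) b → x ≠ a → φ (pr τ x) ≠ v₂ hk hd := by
    intro x hx hxa h
    rw [← hva'] at h
    refine hxa (ofReal_injective (eq_of_pr_eq hφ.norm_eq hφ.im_ne (φ.injective h)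
      (by simpa using hT) ?_))
    have := he.lt_one
    exact abs_lt.2 ⟨by simp; linarith [hx.1, ha.2], by simp; linarith [hx.2, ha.1]⟩
  obtain ⟨f₀, hf₀, hF₀⟩ := exists_flatDeriv_pos hφ he hx₀ (hne _ hx₀ h0a.ne)
  obtain ⟨f₁, hf₁, hF₁⟩ := exists_flatDeriv_pos hφ he hx₁ (hne _ hx₁ ha1.ne')
  -- the lifted arc
  obtain ⟨γ₀, hγ₀, hprγ₀⟩ := exists_lift_pr hφ.im_ne
    ⟨_, φ.symm.continuous.comp (continuous_arc hk hd)⟩ (s₀ := (x₀ : ℂ)) (by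
      rw [← φ.symm_apply_apply (pr τ x₀), hφ₀]
      simp only [ContinuousMap.coe_mk, Function.comp_apply]
      congr 1
      exact (edgeChart_arcCoord_zero hd _ _).symm)
  set γ : ℝ → ℂ := fun t => γ₀ (projIcc (0 : ℝ) 1 zero_le_one t) with hγ
  have hγc : Continuous γ := γ₀.continuous.comp continuous_projIcc
  have hγ0 : γ 0 = x₀ := by simp only [hγ, projIcc_left]; exact hγ₀
  have hprγ : ∀ t, ∀ ht : t ∈ Icc (0 : ℝ) 1,
      φ (pr τ (γ t)) = edgeChart hk (-1) (arcCoord d t) (arcCoord_im_lt hd ht) := by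
    intro t ht
    simp only [hγ, projIcc_of_mem zero_le_one ht, hprγ₀]
    simp
  have hoff : ∀ t ∈ Icc (0 : ℝ) 1, γ t ∈ offCut φ := fun t ht => by
    change _ ∉ _; rw [hprγ t ht]; exact edgeChart_notMem_cutRay hk hd _ _ _
  have hYγ : ∀ t ∈ Icc (0 : ℝ) 1, flatExpOn hk hd φ (γ t) = exp (2 * Real.pi * I * arcCoord d t) := by
    intro t ht
    rw [flatExpOn, hprγ t ht]
    simpa using flatExp_edgeChart hk hd (-1) (arcCoord d t) (arcCoord_im_lt hd ht)
  -- `exp (2 π i ζ)` determines `ζ` up to an integer, so the arc can be on the imaginary axis only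
  -- when its real part `1 - t` is an integer.
  have hheight : ∀ t ∈ Icc (0 : ℝ) 1, ∀ (η : ℝ) (h : ((η : ℂ) * I).im < d),
      φ (pr τ (γ t)) = edgeChart hk 0 (η * I) h → ∃ n : ℤ, 1 - t = n ∧ (2 * t - 1) * (d / 2) = η := by
    intro t ht η h hη
    have h1 := hYγ t ht
    have h2 := flatExp_edgeChart hk hd 0 (η * I) h
    rw [Int.cast_zero, ← hη] at h2
    obtain ⟨n, hn⟩ := exp_eq_exp_iff_exists_int.1 (h1.symm.trans h2)
    have hn' : arcCoord d t = η * I + n :=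
      mul_left_cancel₀ two_pi_I_ne_zero (by linear_combination hn)
    refine ⟨n, ?_, ?_⟩
    · have := congrArg re hn'; simpa [arcCoord] using this
    · have := congrArg im hn'; simpa [arcCoord] using this
  have hγv : ∀ t ∈ Icc (0 : ℝ) 1, φ (pr τ (γ t)) ≠ v₂ hk hd := by
    intro t ht h
    rw [v₂_eq_edgeChart] at h
    obtain ⟨n, hn, h0⟩ := hheight t ht 0 _ h
    have ht2 : t = 1 / 2 := by
      rcases mul_eq_zero.1 h0 with h | h <;> linarith
    have h3 : (2 * n : ℝ) = 1 := by linarith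
    have h4 : 2 * n = 1 := by exact_mod_cast h3
    omega
  -- The modulus of `exp (2 π i ζ)` determines the height, which is strictly increasing along the
  -- arc.
  have hinj : InjOn γ (Icc 0 1) := by
    intro t ht t' ht' h
    have h1 := hYγ t ht
    rw [h, hYγ t' ht'] at h1
    have h2 := congrArg norm h1
    rw [norm_exp, norm_exp] at h2
    have h3 := Real.exp_injective h2
    simp [arcCoord] at h3
    rcases h3 with h3 | h3 <;> linarith
  set c : ℂ := -1 + d * I with hc
  have hc0 : c ≠ 0 := fun h => by
    have := congrArg re h
    simp [hc] at this
  set v : ℝ → ℂ := fun t => c / flatDeriv hk hd φ (γ t) with hv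
  have hFne : ∀ t ∈ Icc (0 : ℝ) 1, flatDeriv hk hd φ (γ t) ≠ 0 := fun t ht =>
    flatDeriv_ne_zero hk hd hφ (hoff t ht) (hγv t ht)
  have hvc : ContinuousOn v (Icc 0 1) := by
    intro t ht
    refine ContinuousAt.continuousWithinAt (continuousAt_const.div ?_ (hFne t ht))
    exact ContinuousAt.comp (f := γ) (analyticAt_flatDeriv hk hd hφ (hoff t ht)).continuousAt
      hγc.continuousAt
  have hder : ∀ t ∈ Icc (0 : ℝ) 1, HasDerivWithinAt γ (v t) (Icc 0 1) t := fun t ht =>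
    hasDerivWithinAt_of_flatExpOn_eq hφ hγc.continuousWithinAt ht (hoff t ht) (hγv t ht) hYγ
      (hasDerivAt_arcCoord t)
  have hprγ1 : pr τ (γ 1) = pr τ x₁ := φ.injective (by
    rw [hprγ 1 (right_mem_Icc.2 zero_le_one), hφ₁]
    exact edgeChart_arcCoord_one hd _ _)
  have hv0 : v 0 = c / (f₀ * I) := by rw [hv]; simp only [hγ0, hF₀]
  have hv1 : v 1 = c / (f₁ * I) := by
    rw [hv]; simp only [flatDeriv_eq_of_pr_eq hφ hprγ1, hF₁]
  -- With `c = -1 + d i`, the velocity is `c / (f i) = (d + i) / f`: the lift points upwards at both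
  -- ends.
  have himv : ∀ f : ℝ, 0 < f → 0 < (c / (f * I)).im := by
    intro f hf
    have : c / (f * I) = ((d / f : ℝ) : ℂ) + ((1 / f : ℝ) : ℂ) * I := by
      have : (f : ℂ) ≠ 0 := by exact_mod_cast hf.ne'
      rw [hc]; push_cast; field_simp
      linear_combination -I_mul_I
    rw [this]
    simpa using hf
  -- the arc stays in the strip
  have hnr : ∀ t ∈ Ioo (0 : ℝ) 1, ∀ j : ℤ, (γ t).im ≠ j * stripHeight τ := by
    intro t ht j hj
    have ht' := Ioo_subset_Icc_self ht
    -- The line `Im s = j T` is a lattice translate of the real axis, so it also covers the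
    -- horizontal diagonal.
    have h1 : γ t = (((γ t).re - j : ℝ) : ℂ) + j * (1 + stripHeight τ * I) := by
      apply Complex.ext <;> simp [hj]
    have h2 : pr τ (γ t) = pr τ (((γ t).re - j : ℝ) : ℂ) := by
      conv_lhs => rw [h1]
      exact pr_add_int_half hφ.norm_eq hφ.im_ne _ j
    obtain ⟨η, h, hη⟩ := exists_height_of_pr_eq hφ (hoff t ht') h2
    obtain ⟨n, hn, -⟩ := hheight t ht' η h hη
    have h3 : (0 : ℝ) < n := by linarith [ht.2]
    have h4 : (n : ℝ) < 1 := by linarith [ht.1]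
    have h3' : 0 < n := by exact_mod_cast h3
    have h4' : n < 1 := by exact_mod_cast h4
    omega
  have himder : ∀ t ∈ Icc (0 : ℝ) 1,
      HasDerivWithinAt (fun t => (γ t).im) (v t).im (Icc 0 1) t := fun t ht =>
    imCLM.hasFDerivAt.comp_hasDerivWithinAt t (hder t ht)
  have himc : Continuous fun t => (γ t).im := continuous_im.comp hγc
  have hstart : ∃ t ∈ Ioo (0 : ℝ) 1, (γ t).im ∈ Ioo 0 (stripHeight τ) := by
    have h1 := eventually_slope_pos (himder 0 (left_mem_Icc.2 zero_le_one))
      (by rw [hv0]; exact himv f₀ hf₀) (by simp)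
    have h2 : ∀ᶠ t in 𝓝[Ioo 0 1] (0 : ℝ), (γ t).im < stripHeight τ :=
      (himc.continuousAt.eventually_lt continuousAt_const (by simpa [hγ0] using hT)).filter_mono
        nhdsWithin_le_nhds
    have := left_nhdsWithin_Ioo_neBot (zero_lt_one' ℝ)
    obtain ⟨t, h3, h4, h5⟩ := (h1.and (h2.and self_mem_nhdsWithin)).exists
    refine ⟨t, h5, ?_, h4⟩
    simp only [hγ0, ofReal_im, sub_zero] at h3
    exact pos_of_mul_pos_right h3 (inv_nonneg.2 h5.1.le)
  have hstrip : ∀ t ∈ Ioo (0 : ℝ) 1, γ t ∈ strip 0 (stripHeight τ) := by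
    obtain ⟨t₀, ht₀, h0⟩ := hstart
    have hpre : ((fun t => (γ t).im) '' Ioo 0 1).OrdConnected :=
      (isPreconnected_Ioo.image _ himc.continuousOn).ordConnected
    intro t ht
    constructor
    · by_contra hcon
      obtain ⟨u, hu, hu0⟩ := hpre.out (mem_image_of_mem _ ht) (mem_image_of_mem _ ht₀)
        (show (0 : ℝ) ∈ Icc _ _ from ⟨not_lt.1 hcon, h0.1.le⟩)
      exact hnr u hu 0 (by simpa using hu0)
    · by_contra hcon
      obtain ⟨u, hu, hu0⟩ := hpre.out (mem_image_of_mem _ ht₀) (mem_image_of_mem _ ht)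
        (show stripHeight τ ∈ Icc _ _ from ⟨h0.2.le, not_lt.1 hcon⟩)
      exact hnr u hu 1 (by simpa using hu0)
  -- the endpoint
  obtain ⟨n, hγ1⟩ : ∃ n : ℤ, γ 1 = x₁ + 2 * n + (1 + stripHeight τ * I) := by
    obtain ⟨m, n, h1⟩ := (pr_eq_iff hφ.norm_eq hφ.im_ne).1 hprγ1
    have him1 : (γ 1).im = (m + n : ℤ) * stripHeight τ := by
      rw [h1]
      simp only [add_im, intCast_im, mul_im, intCast_re, ofReal_im, ofReal_re, mul_re, I_re, I_im]
      ring
    have hb := right_nhdsWithin_Ioo_neBot (zero_lt_one' ℝ)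
    have hlim : Tendsto (fun t => (γ t).im) (𝓝[Ioo 0 1] (1 : ℝ)) (𝓝 (γ 1).im) :=
      himc.continuousAt.tendsto.mono_left nhdsWithin_le_nhds
    have hlo : 0 ≤ (γ 1).im := ge_of_tendsto hlim
      (eventually_mem_nhdsWithin.mono fun t ht => (hstrip t ht).1.le)
    have hhi : (γ 1).im ≤ stripHeight τ := le_of_tendsto hlim
      (eventually_mem_nhdsWithin.mono fun t ht => (hstrip t ht).2.le)
    -- A return to the real axis at `t = 1` would be from above, which contradicts the upward
    -- velocity there.
    have hne0 : m + n ≠ 0 := by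
      intro h0
      rw [h0, Int.cast_zero, zero_mul] at him1
      have h2 := eventually_slope_pos (himder 1 (right_mem_Icc.2 zero_le_one))
        (by rw [hv1]; exact himv f₁ hf₁) (by simp)
      obtain ⟨t, h3, h4⟩ := (h2.and self_mem_nhdsWithin).exists
      rw [him1, sub_zero] at h3
      have h5 := (hstrip t h4).1
      have h6 : (t - 1)⁻¹ < 0 := inv_lt_zero.2 (by linarith [h4.2])
      nlinarith
    rw [him1] at hlo hhi
    have h2 : (0 : ℝ) ≤ (m + n : ℤ) := nonneg_of_mul_nonneg_left hlo hT
    have h3 : ((m + n : ℤ) : ℝ) ≤ 1 := by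
      by_contra hcon
      nlinarith [not_le.1 hcon]
    have h2' : 0 ≤ m + n := by exact_mod_cast h2
    have h3' : m + n ≤ 1 := by exact_mod_cast h3
    have h4 : n = 1 - m := by omega
    -- Since `m + n = 1`, the lattice vector is `(2 m - 1) + T i = 2 (m - 1) + (1 + T i)`.
    refine ⟨m - 1, ?_⟩
    rw [h1, h4]
    push_cast
    ring
  obtain ⟨r, hr⟩ := hasStripPoles_flatLogDeriv hφ he hva'
  have hstripv : ∀ s ∈ strip 0 (stripHeight τ), φ (pr τ s) ≠ v₂ hk hd := fun s hs h =>
    pr_ne_pr_ofReal hφ hs a (φ.injective (h.trans hva'.symm))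
  refine ⟨a, hva', ha, hr.relation_of_arc (F := flatDeriv hk hd φ) (γ := γ) (v := v) (n := n)
    (c' := c) (q := f₀ / f₁) (x₀ := x₀) (x₁ := x₁) hT he.lt_one hx₀.1 h0a ha1 hx₁.2 ?_ ?_ ?_ ?_
    hγc.continuousOn hγ0 hγ1 hstrip hinj hvc ?_ hc0 ?_ (div_pos hf₀ hf₁) ?_⟩
  · intro x hx
    have hx' : x ∈ Ioo (-b) b := ⟨hx.1, hx.2.trans ha.2⟩
    exact flatLogDeriv_real hφ he hx' (hne x hx' hx.2.ne)
  · exact fun s hs => hasDerivAt_flatDeriv hφ (strip_subset_offCut hφ he hs) (hstripv s hs)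
  · exact fun s hs => flatDeriv_ne_zero hk hd hφ (strip_subset_offCut hφ he hs) (hstripv s hs)
  · exact fun s _ => periodic_flatDeriv hk hd (pr_add_two hφ.norm_eq hφ.im_ne) s
  · exact fun t ht => (hder t (Ioo_subset_Icc_self ht)).hasDerivAt (Icc_mem_nhds ht.1 ht.2)
  · exact fun t ht => div_mul_cancel₀ _ (hFne t (Ioo_subset_Icc_self ht))
  · rw [hv1, hv0]
    have h1 : (f₀ : ℂ) ≠ 0 := by exact_mod_cast hf₀.ne'
    have h2 : (f₁ : ℂ) ≠ 0 := by exact_mod_cast hf₁.ne'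
    push_cast
    field_simp

end
end Helicoid

theorem mainTheorem8 (k d : ℝ) (hk : 1 / 2 < k) (hd : 0 < d) (τ : ℂ)
    (φ : Helicoid.Torus τ ≃ₜ Helicoid.SlitTorus k d)
    (hφ : Helicoid.IsRhombicModel hk hd φ)
    (E₁ E₂ V₁ V₂ : Helicoid.Torus τ)
    (hE₁ : E₁ = φ.symm (Helicoid.e₁ k d)) (hE₂ : E₂ = φ.symm (Helicoid.e₂ hk hd))
    (hV₂ : V₂ = φ.symm (Helicoid.v₂ hk hd)) (hV₁ : V₁ = Helicoid.rot τ V₂)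
    (O : ℂ) (hO : O = (1 + τ) / 2) :
    ∃ a b : ℝ, 0 < a ∧ a < b ∧ b < 1 ∧
      E₁ = ((O - b * ((1 - τ) / 2) : ℂ) : Helicoid.Torus τ) ∧
      E₂ = ((O + b * ((1 - τ) / 2) : ℂ) : Helicoid.Torus τ) ∧
      V₁ = ((O - a * ((1 - τ) / 2) : ℂ) : Helicoid.Torus τ) ∧
      V₂ = ((O + a * ((1 - τ) / 2) : ℂ) : Helicoid.Torus τ) ∧
      a + k * b = k := by
  obtain ⟨b, he⟩ := hφ.exists_hasEnds
  obtain ⟨a, hva, ha, hrel⟩ := Helicoid.relation_of_hasEnds hφ he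
  have hV : V₂ = ((O + a * ((1 - τ) / 2) : ℂ) : Helicoid.Torus τ) := by
    rw [hV₂, ← hva, Homeomorph.symm_apply_apply, hO]; rfl
  refine ⟨a, b, ?_, ha.2, he.lt_one, ?_, ?_, ?_, hV, hrel⟩
  -- The geometry gives only `-b < a < b`; positivity of `a` comes from the relation.
  · have : a = k * (1 - b) := by linarith
    rw [this]
    exact mul_pos (by linarith) (by linarith [he.lt_one])
  · rw [hE₁, ← he.left, Homeomorph.symm_apply_apply, Helicoid.pr, hO]
    congr 1
    push_cast; ring
  · rw [hE₂, ← he.right, Homeomorph.symm_apply_apply, hO]; rfl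
  · rw [hV₁, hV, Helicoid.rot, ← QuotientAddGroup.mk_sub, hO]
    congr 1
    ring
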